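/- **Conventions.** $\widehat f(\xi)=(2\pi)^{-1/2}\int f(x)e^{-ix\xi}\,dx$ (extended to $L^2$), and a multiplier with symbol $m$ acts by $f\mapsto\mathcal F^{-1}[m\widehat f]$; $\partial_x^{-1}$ has symbol $1/(i\xi)$. Put $\|f\|_{H^s}=\|(1+|\xi|^2)^{s/2}\widehat f\|_{L^2}$, $\|f\|_{\dot H^{-1}}=\||\xi|^{-1}\widehat f\|_{L^2}$, $J=x-t\partial_x^{-2}$ (so $J\partial_x f=x\,\partial_x f-t\,\partial_x^{-1}f$) and $$\|u(t)\|_{X^s}=\left(\|u(t)\|_{H^s}^2+\|u(t)\|_{\dot H^{-1}}^2+\|J\partial_xu(t)\|_{L^2}^2\right)^{1/2}.$$ Let $\delta=\frac1{1000}$, and let $\sigma\in C_0^\infty(\mathbb R)$ be even with $0\le\sigma\le1$, $\sigma=1$ on $|\xi|\le1$ and $\sigma=0$ on $|\xi|\ge2^\delta$. For $R,R_1,R_2>0$ with $R_1<R_2$ set $\sigma_R(\xi)=\sigma(\xi/R)-\sigma(2^\delta\xi/R)$, $\sigma_{\le R}(\xi)=\sigma(\xi/R)$, $\sigma_{<R}=\sigma_{\le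 R}-\sigma_R$ and $\sigma_{R_1\le\cdot\le R_2}=\sigma_{\le R_2}-\sigma_{<R_1}$. For a real-valued $u$ let $u^+$ and $u_N^+$ ($N\in2^{\delta\mathbb Z}$) be the images of $u$ under the multipliers with symbols $\mathbf 1_{\xi>0}$ and $\sigma_N(\xi)\mathbf 1_{\xi>0}$, so that $u=2\,\mathrm{Re}\,u^+$. For $t\ge1$ set $$u^{\mathrm{hyp},+}(t,x)=\sum_{N\in2^{\delta\mathbb Z},\,N\le t}\sigma_{\frac{t}{3N^2}\le\cdot\le\frac{3t}{N^2}}(x)\,\mathbf 1_{x<0}\,u_N^+(t,x),\qquad u^{\mathrm{ell},+}=u^+-u^{\mathrm{hyp},+},\qquad u^{\mathrm{ell}}=2\,\mathrm{Re}\,u^{\mathrm{ell},+}$$ (the sum is finite at each point). **Proposition.** Let $u=u(t,x)$ be real-valued, with $u(t)\in L^2(\mathbb R)$ and $\|u(t)\|_{X^s}<\infty$ at the time $t$ considered. (i) For each $s>\frac32$ there is a constant $C=C(s)>0$ such that for all such $u$ and all $0<t<1$, $u(t)$ agrees almost everywhere with a $C^1$ function, again denoted $u(t,\cdot)$, and for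 all $x\in\mathbb R$ $$|u(t,x)|\le C\|u(t)\|_{X^s},\qquad |u_x(t,x)|\le C\|u(t)\|_{X^s}.$$ (ii) For each such $\sigma$ and each $s>\frac52$ there is a constant $C=C(s,\sigma)>0$ such that for all such $u$ and all $t\ge1$, the functions $u^{\mathrm{hyp},+}(t,\cdot)$ and $u^{\mathrm{ell}}(t,\cdot)$ are $C^1$, and for all $x\in\mathbb R$ $$|u^{\mathrm{hyp},+}(t,x)|\le C\,t^{-\frac12}\min\left\{\left(\tfrac{|x|}{t}\right)^{\frac s4-\frac12},\left(\tfrac{|x|}{t}\right)^{-\frac34}\right\}\|u(t)\|_{X^s},$$ $$|u^{\mathrm{hyp},+}_x(t,x)|\le C\,t^{-\frac12}\min\left\{\left(\tfrac{|x|}{t}\right)^{\frac s4-1},\left(\tfrac{|x|}{t}\right)^{-\frac54}\right\}\|u(t)\|_{X^s},$$ $$|u^{\mathrm{ell}}(t,x)|\le C\,t^{-\frac{2s-1}{2s+2}}(1+\log t)\,\|u(t)\|_{X^s},$$ $$|u^{\mathrm{ell}}_x(t,x)|\le C\,t^{-\frac{2s-3}{2s+2}}(1+\log t)\,\|u(t)\|_{X^s}.$$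 At $x=0$, where $u^{\mathrm{hyp},+}$ vanishes identically nearby, a negative power of $|x|/t$ is read as $0$. -/

import Mathlib

open MeasureTheory Set
open scoped ENNReal ContDiff FourierTransform

noncomputable section

namespace ShortPulse

/-- The `L²` Fourier transform of a function `f ∈ L²(ℝ)` in the unitary normalization,
`f̂(ξ) = (2π)^{-1/2} ∫ f(x) e^{-ixξ} dx`, obtained from Mathlib's `L²` Fourier transform
(which uses the phase `e^{-2πixξ}`). It is only used for `f ∈ L²`. -/
def hat (f : ℝ → ℂ) : ℝ → ℂ :=
  open Classical in
  if h : MemLp f 2 (volume : Measure ℝ) then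
    fun ξ => ((√(2 * Real.pi) : ℝ) : ℂ)⁻¹ * (𝓕 (h.toLp f) : Lp ℂ 2 (volume : Measure ℝ))
      (ξ / (2 * Real.pi))
  else 0

/-- The Fourier multiplier with symbol `m`, evaluated pointwise by the inversion integral
`(2π)^{-1/2} ∫ e^{ixξ} m(ξ) f̂(ξ) dξ`. For all symbols used below the integrand is absolutely
integrable as soon as `f ∈ H^s ∩ Ḣ^{-1}` with `s > 3/2`. -/
def multiplier (m : ℝ → ℂ) (f : ℝ → ℂ) (x : ℝ) : ℂ :=
  ((√(2 * Real.pi) : ℝ) : ℂ)⁻¹ * ∫ ξ : ℝ, Complex.exp (Complex.I * x * ξ) * (m ξ * hat f ξ)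

/-- `∂ₓ`, with symbol `iξ`. -/
def Dx : (ℝ → ℂ) → ℝ → ℂ := multiplier fun ξ => Complex.I * ξ

/-- `∂ₓ⁻¹`, with symbol `1/(iξ)`. -/
def DxInv : (ℝ → ℂ) → ℝ → ℂ := multiplier fun ξ => (Complex.I * ξ)⁻¹

/-- `J ∂ₓ f`, where `J = x - t ∂ₓ⁻²`; that is `x ∂ₓ f - t ∂ₓ⁻¹ f`. -/
def JDx (t : ℝ) (f : ℝ → ℂ) (x : ℝ) : ℂ := x * Dx f x - t * DxInv f x

/-- The inhomogeneous Sobolev norm `‖⟨ξ⟩^s f̂‖_{L²}`, possibly infinite. -/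
def hNorm (s : ℝ) (f : ℝ → ℂ) : ℝ≥0∞ :=
  eLpNorm (fun ξ : ℝ => (1 + |ξ| ^ 2) ^ (s / 2) * ‖hat f ξ‖) 2 volume

/-- The homogeneous Sobolev norm `‖|ξ|^s f̂‖_{L²}`, possibly infinite. -/
def hdotNorm (s : ℝ) (f : ℝ → ℂ) : ℝ≥0∞ :=
  eLpNorm (fun ξ : ℝ => |ξ| ^ s * ‖hat f ξ‖) 2 volume

/-- `(‖f‖_{H^s}² + ‖f‖_{Ḣ^{-1}}² + ‖J ∂ₓ f‖_{L²}²)^{1/2}` at time `t`, possibly infinite. -/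
def xENorm (s t : ℝ) (f : ℝ → ℂ) : ℝ≥0∞ :=
  (hNorm s f ^ 2 + hdotNorm (-1) f ^ 2 + eLpNorm (JDx t f) 2 volume ^ 2) ^ (1 / 2 : ℝ)

/-- The complexification of a real-valued function. -/
def cplx (f : ℝ → ℝ) : ℝ → ℂ := fun x => (f x : ℂ)

/-- The real-valued function `f` lies in `L²` and has finite `X^s` norm at time `t`. -/
def MemX (s t : ℝ) (f : ℝ → ℝ) : Prop :=
  MemLp f 2 (volume : Measure ℝ) ∧ xENorm s t (cplx f) < ⊤

/-- The `X^s` norm at time `t`, as a real number. -/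
def xNorm (s t : ℝ) (f : ℝ → ℝ) : ℝ := (xENorm s t (cplx f)).toReal

/-- The small constant fixed in the dyadic decomposition. -/
def δ : ℝ := 1 / 1000

/-- `σ` is a smooth even cutoff, `0 ≤ σ ≤ 1`, equal to `1` on `|ξ| ≤ 1` and to `0` on
`|ξ| ≥ 2^δ`. -/
structure IsCutoff (σ : ℝ → ℝ) : Prop where
  contDiff : ContDiff ℝ ∞ σ
  even : ∀ ξ, σ (-ξ) = σ ξ
  nonneg : ∀ ξ, 0 ≤ σ ξ
  le_one : ∀ ξ, σ ξ ≤ 1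
  eq_one : ∀ ξ, |ξ| ≤ 1 → σ ξ = 1
  eq_zero : ∀ ξ, (2 : ℝ) ^ δ ≤ |ξ| → σ ξ = 0

/-- `σ_R(ξ) = σ(ξ/R) - σ(2^δ ξ/R)`. -/
def sigmaAt (σ : ℝ → ℝ) (R ξ : ℝ) : ℝ := σ (ξ / R) - σ ((2 : ℝ) ^ δ * ξ / R)

/-- `σ_{≤R}(ξ) = σ(ξ/R)`. -/
def sigmaLE (σ : ℝ → ℝ) (R ξ : ℝ) : ℝ := σ (ξ / R)

/-- `σ_{<R} = σ_{≤R} - σ_R`. -/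
def sigmaLT (σ : ℝ → ℝ) (R ξ : ℝ) : ℝ := sigmaLE σ R ξ - sigmaAt σ R ξ

/-- `σ_{R₁≤·≤R₂} = σ_{≤R₂} - σ_{<R₁}`. -/
def sigmaBetween (σ : ℝ → ℝ) (R₁ R₂ ξ : ℝ) : ℝ := sigmaLE σ R₂ ξ - sigmaLT σ R₁ ξ

/-- The scaled dyadic number `2^{δk}`; these exhaust `2^{δℤ}`. -/
def dyadic (k : ℤ) : ℝ := (2 : ℝ) ^ (δ * k)

/-- `u⁺ = P⁺ u`, the projection to positive frequencies. -/
def uPlus (f : ℝ → ℝ) : ℝ → ℂ := multiplier ((Ioi (0 : ℝ)).indicator fun _ => 1) (cplx f)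

/-- `u_N⁺ = P_N⁺ u`, with symbol `σ_N(ξ) 1_{ξ>0}`. -/
def uPlusAt (σ : ℝ → ℝ) (N : ℝ) (f : ℝ → ℝ) : ℝ → ℂ :=
  multiplier ((Ioi (0 : ℝ)).indicator fun ξ => (sigmaAt σ N ξ : ℂ)) (cplx f)

/-- `σ_N^{hyp}(t,x) = σ_{t/(3N²) ≤ · ≤ 3t/N²}(x) 1_{x<0}`. -/
def sigmaHyp (σ : ℝ → ℝ) (N t : ℝ) : ℝ → ℝ :=
  (Iio (0 : ℝ)).indicator (sigmaBetween σ (1 / 3 * (t / N ^ 2)) (3 * (t / N ^ 2)))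

/-- `u_N^{hyp,+} = σ_N^{hyp} u_N⁺` at time `t`. -/
def uHypPlusAt (σ : ℝ → ℝ) (N t : ℝ) (f : ℝ → ℝ) (x : ℝ) : ℂ :=
  (sigmaHyp σ N t x : ℂ) * uPlusAt σ N f x

/-- `u^{hyp,+}`, the sum of `u_N^{hyp,+}` over `N ∈ 2^{δℤ}` with `N ≤ t`. At each point `x` only
finitely many terms are nonzero. -/
def uHypPlus (σ : ℝ → ℝ) (t : ℝ) (f : ℝ → ℝ) (x : ℝ) : ℂ :=
  ∑ᶠ k ∈ {k : ℤ | dyadic k ≤ t}, uHypPlusAt σ (dyadic k) t f x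

/-- `u^{ell,+} = u⁺ - u^{hyp,+}`. -/
def uEllPlus (σ : ℝ → ℝ) (t : ℝ) (f : ℝ → ℝ) (x : ℝ) : ℂ := uPlus f x - uHypPlus σ t f x

/-- The elliptic part `u^{ell} = 2 Re u^{ell,+}` of the real-valued function `u = 2 Re u⁺`. -/
def uEll (σ : ℝ → ℝ) (t : ℝ) (f : ℝ → ℝ) (x : ℝ) : ℝ := 2 * (uEllPlus σ t f x).re

end ShortPulse

end

open MeasureTheory Set
open scoped ENNReal ContDiff FourierTransform

noncomputable section

namespace ShortPulse

/-! On the Fourier side the weighted quantity `J ∂ₓ u` becomes a differential equation. Put `G = ξ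
û` and let `W` be minus the transform of `J ∂ₓ u`; then `G' = i t G / ξ² + W` with `W ∈ L²`
(`Profile`, produced by `MemX.exists_profile`). Equivalently `e^{it/ξ} G` has derivative `e^{it/ξ}
W`, so the positive-frequency part of `u` is an oscillatory integral with phase `xξ - t/ξ`. Its
derivative `x + t/ξ²` vanishes on `ξ > 0` only for `x < 0`, at `ξ = √(t/|x|)`.

On frequencies of size `N`, the `Ḣ^{-1}` and `H^s` norms give `‖G‖_{L²} ≲ β A` with `A` the `X^s`
norm and `β = min(N², N^{1-s})`. Since `i t/ξ²` is imaginary, `t` drops out of the derivative of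
`|G|²`, and so `|G| ≲ √β A` pointwise (`Profile.norm_sq_le`). Three bounds follow for `∫ e^{ixξ}
ρ(ξ/N) G dξ`, each up to a factor `A`: `β √N` by Cauchy-Schwarz (`Profile.norm_osc_le`), `N² √N / t`
by one integration by parts away from the stationary point (`Profile.norm_osc_le_of_nonresonant`),
and `√β √(N³/t)` for `x` whose stationary point is comparable to `N`
(`Profile.norm_osc_le_of_resonant`). They hold as they stand for `∂ₓ u_N⁺` and with an extra `N⁻¹`
for `u_N⁺`.

Hyperbolic part: the spatial cutoff forces `|x| ~ t/N²`, so boundedly many `N` matter at each `x`,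
and `N ~ (|x|/t)^{-1/2}` turns the third bound into powers of `|x|/t`, one for each branch of `β`.
The restriction `N ≤ t` keeps derivatives of the cutoff harmless.

Elliptic part: where the cutoff equals `1` the piece cancels exactly; everywhere else, and for `N >
t`, the minimum of the first two bounds is available. The sum over `N` of `min(N^{3/2}/t,
N^{-(s-1/2)})`, and its analogue for the derivative, is geometric on both sides of `N =
t^{1/(s+1)}`. This gives the stated power of `t` without a logarithm.

Small times need only Cauchy-Schwarz in frequency (`sobolev_embedding`). -/

/-! ### The `L²` Fourier transform and the Fourier integral -/

/-- For `f ∈ L¹ ∩ L²` the `L²` Fourier transform is given by the Fourier integral. -/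
lemma fourier_toLp_ae {f : ℝ → ℂ} (h1 : Integrable f) (h2 : MemLp f 2 (volume : Measure ℝ)) :
    ((𝓕 (h2.toLp f) : Lp ℂ 2 (volume : Measure ℝ)) : ℝ → ℂ) =ᵐ[volume] 𝓕 f := by
  have hcont : Continuous (𝓕 f) := VectorFourier.fourierIntegral_continuous
    Real.continuous_fourierChar (by exact continuous_inner) h1
  apply ae_eq_of_integral_contDiff_smul_eq
  · exact (Lp.memLp _).locallyIntegrable (by norm_num)
  · exact hcont.locallyIntegrable
  -- Paired with a test function, both sides move the transform onto `g`: the `L²` one through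
  -- tempered distributions, the integral one by Fubini.
  · intro g g_smooth g_cpt
    have hg₁ : HasCompactSupport (Complex.ofRealCLM ∘ g) := g_cpt.comp_left rfl
    have hg₂ : ContDiff ℝ ∞ (Complex.ofRealCLM ∘ g) := by fun_prop
    have key : ∀ F : Lp ℂ 2 (volume : Measure ℝ), ∫ x, g x • F x =
        Lp.toTemperedDistribution F (hg₁.toSchwartzMap hg₂) := by
      intro F; simp
    rw [key, ← Lp.fourier_toTemperedDistribution_eq, TemperedDistribution.fourier_apply,
      Lp.toTemperedDistribution_apply]
    have e1 : ∫ x, (𝓕 (hg₁.toSchwartzMap hg₂) : SchwartzMap ℝ ℂ) x • (h2.toLp f) x =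
        ∫ x, 𝓕 (hg₁.toSchwartzMap hg₂ : ℝ → ℂ) x • f x := by
      apply integral_congr_ae
      filter_upwards [h2.coeFn_toLp] with x hx
      rw [hx, SchwartzMap.fourier_coe]
    rw [e1]
    have := VectorFourier.integral_fourierIntegral_smul_eq_flip (L := innerₗ ℝ)
      (μ := volume) (ν := volume)
      Real.continuous_fourierChar (by exact continuous_inner)
      (hg₁.toSchwartzMap hg₂).integrable h1
    rw [flip_innerₗ] at this
    refine Eq.trans this ?_
    apply integral_congr_ae
    refine Filter.Eventually.of_forall fun x => ?_
    simp
    left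
    rfl

/-- For `f ∈ L¹ ∩ L²` the inverse `L²` Fourier transform is given by the inversion integral. -/
lemma fourierInv_toLp_ae {f : ℝ → ℂ} (h1 : Integrable f) (h2 : MemLp f 2 (volume : Measure ℝ)) :
    ((𝓕⁻ (h2.toLp f) : Lp ℂ 2 (volume : Measure ℝ)) : ℝ → ℂ) =ᵐ[volume] 𝓕⁻ f := by
  have hcont : Continuous (𝓕 f) := VectorFourier.fourierIntegral_continuous
    Real.continuous_fourierChar (by exact continuous_inner) h1
  have hcont' : Continuous (𝓕⁻ f) := by
    have : 𝓕⁻ f = fun x => 𝓕 f (-x) := by ext x; exact Real.fourierInv_eq_fourier_neg f x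
    rw [this]; fun_prop
  apply ae_eq_of_integral_contDiff_smul_eq
  · exact (Lp.memLp _).locallyIntegrable (by norm_num)
  · exact hcont'.locallyIntegrable
  · intro g g_smooth g_cpt
    have hg₁ : HasCompactSupport (Complex.ofRealCLM ∘ g) := g_cpt.comp_left rfl
    have hg₂ : ContDiff ℝ ∞ (Complex.ofRealCLM ∘ g) := by fun_prop
    have key : ∀ F : Lp ℂ 2 (volume : Measure ℝ), ∫ x, g x • F x =
        Lp.toTemperedDistribution F (hg₁.toSchwartzMap hg₂) := by
      intro F; simp
    rw [key, ← Lp.fourierInv_toTemperedDistribution_eq, TemperedDistribution.fourierInv_apply,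
      Lp.toTemperedDistribution_apply]
    have e1 : ∫ x, (𝓕⁻ (hg₁.toSchwartzMap hg₂) : SchwartzMap ℝ ℂ) x • (h2.toLp f) x =
        ∫ x, 𝓕 (hg₁.toSchwartzMap hg₂ : ℝ → ℂ) (-x) • f x := by
      apply integral_congr_ae
      filter_upwards [h2.coeFn_toLp] with x hx
      rw [hx, SchwartzMap.fourierInv_coe, Real.fourierInv_eq_fourier_neg]
    rw [e1]
    have := VectorFourier.integral_fourierIntegral_smul_eq_flip (L := innerₗ ℝ)
      (μ := volume) (ν := volume)
      Real.continuous_fourierChar (by exact continuous_inner)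
      (hg₁.toSchwartzMap hg₂).integrable h1.comp_neg
    rw [flip_innerₗ] at this
    have e2 : ∫ x, 𝓕 (hg₁.toSchwartzMap hg₂ : ℝ → ℂ) (-x) • f x =
        ∫ x, 𝓕 (hg₁.toSchwartzMap hg₂ : ℝ → ℂ) x • f (-x) := by
      rw [← integral_neg_eq_self]; simp
    rw [e2]
    refine Eq.trans this ?_
    apply integral_congr_ae
    refine Filter.Eventually.of_forall fun x => ?_
    rw [Real.fourierInv_eq_fourier_comp_neg]
    simp
    left
    rfl

/-- The Fourier transform of `v` is absolutely continuous if `x v(x)` is square integrable. -/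
lemma fourier_sub_fourier {v : ℝ → ℂ} (h1 : Integrable v)
    (h2 : MemLp (fun x : ℝ => x * v x) 2 (volume : Measure ℝ)) {a b : ℝ} (hab : a ≤ b) :
    𝓕 v b - 𝓕 v a = -(2 * Real.pi * Complex.I) *
      ∫ ξ in a..b, (𝓕 (h2.toLp _) : Lp ℂ 2 (volume : Measure ℝ)) ξ := by
  set χ : ℝ → ℂ := (Ioc a b).indicator fun _ => 1 with hχ
  have χ1 : Integrable χ := (integrable_indicator_iff measurableSet_Ioc).2 (by simp)
  have χ2 : MemLp χ 2 (volume : Measure ℝ) := memLp_indicator_const _ measurableSet_Ioc _ (by simp)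
  set Y := h2.toLp _
  -- Plancherel against the indicator of `(a, b]`: integrating the transform of `x v` over the
  -- interval is pairing `x v` with the inverse transform of the indicator.
  have e := Lp.inner_fourier_eq (𝓕⁻ (χ2.toLp χ)) Y
  rw [FourierTransform.fourier_fourierInv_eq, L2.inner_def, L2.inner_def] at e
  have e1 : ∫ ξ in a..b, (𝓕 Y : Lp ℂ 2 (volume : Measure ℝ)) ξ =
      ∫ x, inner ℂ ((χ2.toLp χ) x) ((𝓕 Y : Lp ℂ 2 (volume : Measure ℝ)) x) := by
    rw [intervalIntegral.integral_of_le hab, ← integral_indicator measurableSet_Ioc]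
    apply integral_congr_ae
    filter_upwards [χ2.coeFn_toLp] with x hx
    rw [hx, hχ]
    by_cases h : x ∈ Ioc a b <;> simp [h]
  -- The factor `x` from `x v` cancels the `1/x` in the inverse transform of an indicator, leaving
  -- the two exponentials that define `𝓕 v b` and `𝓕 v a`.
  have e3 : ∀ x : ℝ, x ≠ 0 → (2 * Real.pi * Complex.I * x) * 𝓕⁻ χ x =
      Complex.exp (2 * Real.pi * Complex.I * x * b) - Complex.exp (2 * Real.pi * Complex.I * x * a) := by
    intro x hx
    rw [Real.fourierInv_eq']
    have : ∫ v, Complex.exp (↑(2 * Real.pi * inner ℝ v x) * Complex.I) • χ v =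
        ∫ v in a..b, Complex.exp ((2 * Real.pi * Complex.I * x) * v) := by
      rw [intervalIntegral.integral_of_le hab, ← integral_indicator measurableSet_Ioc]
      congr 1; ext v
      by_cases h : v ∈ Ioc a b
      · simp [hχ, h]; congr 1; ring
      · simp [hχ, h]
    rw [this, integral_exp_mul_complex]
    · have hxc : (x : ℂ) ≠ 0 := by exact_mod_cast hx
      field_simp
    · simp [hx, Real.pi_ne_zero]
  have e2 : -(2 * Real.pi * Complex.I) *
      ∫ x, inner ℂ ((𝓕⁻ (χ2.toLp χ) : Lp ℂ 2 (volume : Measure ℝ)) x) (Y x) = 𝓕 v b - 𝓕 v a := by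
    rw [Real.fourier_real_eq_integral_exp_smul, Real.fourier_real_eq_integral_exp_smul,
      ← integral_sub, ← integral_const_mul]
    · apply integral_congr_ae
      filter_upwards [fourierInv_toLp_ae χ1 χ2, h2.coeFn_toLp,
        compl_mem_ae_iff.mpr (measure_singleton (0 : ℝ))] with x hx hy h0
      have h0' : x ≠ 0 := by simpa using h0
      have := congrArg (starRingEnd ℂ) (e3 x h0')
      rw [hx, hy]
      simp only [map_mul, map_sub, ← Complex.exp_conj, Complex.conj_ofReal, Complex.conj_I,
        map_ofNat] at this
      simp only [RCLike.inner_apply, smul_eq_mul]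
      calc _ = (2 * Real.pi * -Complex.I * x) * (starRingEnd ℂ (𝓕⁻ χ x)) * v x := by ring
        _ = _ := by
          rw [this, sub_mul]; congr 3 <;> push_cast <;> ring_nf
    · have := (Real.fourierIntegral_convergent_iff (f := v) (μ := volume) b).2 h1
      convert this using 2 with x
      rw [Circle.smul_def, Real.fourierChar_apply]; congr 3; simp; ring
    · have := (Real.fourierIntegral_convergent_iff (f := v) (μ := volume) a).2 h1
      convert this using 2 with x
      rw [Circle.smul_def, Real.fourierChar_apply]; congr 3; simp; ring
  rw [← e2, e1, e]

/-! ### The unitary normalization and Plancherel -/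

lemma map_div_volume {r : ℝ} (hr : 0 < r) :
    Measure.map (fun ξ : ℝ => ξ / r) volume = (r.toNNReal) • (volume : Measure ℝ) := by
  have := Real.map_volume_mul_left (a := r⁻¹) (by positivity)
  rw [inv_inv, abs_of_pos hr] at this
  rw [show (fun ξ : ℝ => ξ / r) = (r⁻¹ * ·) by ext; field_simp, this]
  rfl

lemma quasiMeasurePreserving_div {r : ℝ} (hr : 0 < r) :
    Measure.QuasiMeasurePreserving (fun ξ : ℝ => ξ / r) volume volume := by
  refine ⟨by fun_prop, ?_⟩
  rw [map_div_volume hr]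
  exact Measure.smul_absolutelyContinuous

lemma eLpNorm_comp_div {r : ℝ} (hr : 0 < r) {g : ℝ → ℂ}
    (hg : AEStronglyMeasurable g (volume : Measure ℝ)) :
    eLpNorm (fun ξ => g (ξ / r)) 2 volume = ENNReal.ofReal √r * eLpNorm g 2 volume := by
  have hm : AEMeasurable (fun ξ : ℝ => ξ / r) volume := by fun_prop
  have h := eLpNorm_map_measure (p := 2) (f := fun ξ : ℝ => ξ / r) (g := g) (μ := volume)
    (by rw [map_div_volume hr]; exact hg.smul_measure _) hm
  have h' := eLpNorm_smul_measure_of_ne_top (μ := (volume : Measure ℝ)) (p := 2) (by norm_num) g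
    r.toNNReal
  rw [map_div_volume hr] at h
  erw [h'] at h
  rw [show (fun ξ => g (ξ / r)) = g ∘ fun ξ : ℝ => ξ / r from rfl, ← h, Real.sqrt_eq_rpow,
    ← ENNReal.ofReal_rpow_of_nonneg hr.le (by norm_num)]
  simp [ENNReal.ofReal]

lemma hat_eq {f : ℝ → ℂ} (h : MemLp f 2 (volume : Measure ℝ)) :
    hat f = fun ξ => ((√(2 * Real.pi) : ℝ) : ℂ)⁻¹ *
      (𝓕 (h.toLp f) : Lp ℂ 2 (volume : Measure ℝ)) (ξ / (2 * Real.pi)) := by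
  rw [hat, dif_pos h]

/-- Plancherel's theorem in the unitary normalization. -/
lemma eLpNorm_hat {f : ℝ → ℂ} (h : MemLp f 2 (volume : Measure ℝ)) :
    eLpNorm (hat f) 2 volume = eLpNorm f 2 volume := by
  have hp : 0 < √(2 * Real.pi) := by positivity
  have e1 : eLpNorm (hat f) 2 volume = ‖((√(2 * Real.pi) : ℝ) : ℂ)⁻¹‖ₑ *
      eLpNorm (fun ξ => (𝓕 (h.toLp f) : Lp ℂ 2 (volume : Measure ℝ)) (ξ / (2 * Real.pi))) 2
        volume := by
    rw [← eLpNorm_const_smul, hat_eq h]; rfl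
  rw [e1, eLpNorm_comp_div (by positivity) (Lp.aestronglyMeasurable _), ← mul_assoc]
  have e2 : ‖((√(2 * Real.pi) : ℝ) : ℂ)⁻¹‖ₑ * ENNReal.ofReal √(2 * Real.pi) = 1 := by
    rw [← ofReal_norm, ← ENNReal.ofReal_mul (by positivity)]
    rw [norm_inv, Complex.norm_real, Real.norm_of_nonneg hp.le, inv_mul_cancel₀ hp.ne']
    simp
  rw [e2, one_mul]
  have e3 := Lp.norm_fourier_eq (h.toLp f)
  rw [Lp.norm_def, Lp.norm_toLp, ENNReal.toReal_eq_toReal_iff' (Lp.eLpNorm_ne_top _) h.2.ne] at e3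
  exact e3

lemma memLp_hat {f : ℝ → ℂ} (h : MemLp f 2 (volume : Measure ℝ)) :
    MemLp (hat f) 2 (volume : Measure ℝ) := by
  refine ⟨?_, by rw [eLpNorm_hat h]; exact h.2⟩
  rw [hat_eq h]
  exact ((Lp.aestronglyMeasurable _).comp_quasiMeasurePreserving
    (quasiMeasurePreserving_div (by positivity))).const_mul _

lemma hat_linear {f g : ℝ → ℂ} (hf : MemLp f 2 (volume : Measure ℝ))
    (hg : MemLp g 2 (volume : Measure ℝ)) (a b : ℂ) :
    hat (fun x => a * f x + b * g x) =ᵐ[volume] fun ξ => a * hat f ξ + b * hat g ξ := by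
  have hfg : MemLp (fun x => a * f x + b * g x) 2 (volume : Measure ℝ) :=
    (hf.const_mul a).add (hg.const_mul b)
  have e : hfg.toLp _ = a • hf.toLp f + b • hg.toLp g := by
    rw [← MemLp.toLp_const_smul, ← MemLp.toLp_const_smul, ← MemLp.toLp_add]; rfl
  have e2 : 𝓕 (hfg.toLp _) = a • 𝓕 (hf.toLp f) + b • 𝓕 (hg.toLp g) := by
    rw [e, FourierTransform.fourier_add, FourierTransform.fourier_smul,
      FourierTransform.fourier_smul]
  have e3 : (𝓕 (hfg.toLp _) : Lp ℂ 2 (volume : Measure ℝ)) =ᵐ[volume] fun x =>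
      a * (𝓕 (hf.toLp f) : Lp ℂ 2 (volume : Measure ℝ)) x +
      b * (𝓕 (hg.toLp g) : Lp ℂ 2 (volume : Measure ℝ)) x := by
    rw [e2]
    filter_upwards [Lp.coeFn_add (a • 𝓕 (hf.toLp f)) (b • 𝓕 (hg.toLp g)),
      Lp.coeFn_smul a (𝓕 (hf.toLp f)), Lp.coeFn_smul b (𝓕 (hg.toLp g))] with x h1 h2 h3
    rw [h1, Pi.add_apply, h2, h3]; rfl
  rw [hat_eq hf, hat_eq hg, hat_eq hfg]
  filter_upwards [(quasiMeasurePreserving_div (r := 2 * Real.pi) (by positivity)).ae e3] with x hx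
  rw [hx]; ring

lemma ae_eq_of_hat_ae_eq {f g : ℝ → ℂ} (hf : MemLp f 2 (volume : Measure ℝ))
    (hg : MemLp g 2 (volume : Measure ℝ)) (h : hat f =ᵐ[volume] hat g) : f =ᵐ[volume] g := by
  have hfg : MemLp (fun x => 1 * f x + (-1) * g x) 2 (volume : Measure ℝ) :=
    (hf.const_mul 1).add (hg.const_mul (-1))
  have e : hat (fun x => 1 * f x + (-1) * g x) =ᵐ[volume] 0 := by
    filter_upwards [hat_linear hf hg 1 (-1), h] with x h1 h2
    rw [h1, h2]; simp
  have e2 := eLpNorm_hat hfg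
  rw [eLpNorm_congr_ae e, eLpNorm_zero, eq_comm, eLpNorm_eq_zero_iff hfg.1 (by norm_num)] at e2
  filter_upwards [e2] with x hx
  have : 1 * f x + (-1) * g x = 0 := hx
  linear_combination this

/-! ### The inversion integral -/

/-- The inversion integral `(2π)^{-1/2} ∫ e^{ixξ} a(ξ) dξ`. -/
def invInt (a : ℝ → ℂ) (x : ℝ) : ℂ :=
  ((√(2 * Real.pi) : ℝ) : ℂ)⁻¹ * ∫ ξ : ℝ, Complex.exp (Complex.I * x * ξ) * a ξ

lemma multiplier_eq (m f) : multiplier m f = invInt fun ξ => m ξ * hat f ξ := rfl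

lemma invInt_eq_fourierInv (a : ℝ → ℂ) (x : ℝ) :
    invInt a x = ((√(2 * Real.pi) : ℝ) : ℂ) * 𝓕⁻ (fun η => a (2 * Real.pi * η)) x := by
  rw [Real.fourierInv_eq', invInt]
  have h := Measure.integral_comp_mul_left (fun ξ : ℝ => Complex.exp (Complex.I * x * ξ) * a ξ)
    (2 * Real.pi)
  have h2 : (∫ v, Complex.exp (↑(2 * Real.pi * inner ℝ v x) * Complex.I) • a (2 * Real.pi * v)) =
      ∫ v : ℝ, Complex.exp (Complex.I * x * ((2 * Real.pi * v : ℝ) : ℂ)) * a (2 * Real.pi * v) := by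
    congr 1; ext v; rw [smul_eq_mul]; congr 2; simp; ring
  have h3 : ((√(2 * Real.pi) : ℝ) : ℂ) * ((√(2 * Real.pi) : ℝ) : ℂ) = 2 * Real.pi := by
    rw [← Complex.ofReal_mul, Real.mul_self_sqrt (by positivity)]; simp
  have h4 : ((√(2 * Real.pi) : ℝ) : ℂ) ≠ 0 := by
    exact_mod_cast (by positivity : √(2 * Real.pi) ≠ 0)
  have h5 : (2 * Real.pi : ℂ) ≠ 0 := by rw [← h3]; exact mul_ne_zero h4 h4
  rw [h2, h, abs_of_pos (by positivity), Complex.real_smul, ← mul_assoc]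
  congr 1
  push_cast
  field_simp
  rw [sq, h3]

lemma memLp_comp_mul {r : ℝ} (hr : 0 < r) {g : ℝ → ℂ} (hg : MemLp g 2 (volume : Measure ℝ)) :
    MemLp (fun ξ => g (r * ξ)) 2 (volume : Measure ℝ) := by
  have e : (fun ξ => g (r * ξ)) = fun ξ => g (ξ / r⁻¹) := by ext; congr 1; field_simp
  rw [e]
  refine ⟨hg.1.comp_quasiMeasurePreserving (quasiMeasurePreserving_div (by positivity)), ?_⟩
  rw [eLpNorm_comp_div (by positivity) hg.1]
  exact ENNReal.mul_lt_top (by simp) hg.2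

/-- The inversion integral of `a ∈ L¹ ∩ L²` is in `L²`, with Fourier transform `a`. -/
lemma hat_invInt {a : ℝ → ℂ} (h1 : Integrable a) (h2 : MemLp a 2 (volume : Measure ℝ)) :
    MemLp (invInt a) 2 (volume : Measure ℝ) ∧ hat (invInt a) =ᵐ[volume] a := by
  have hp : 0 < 2 * Real.pi := by positivity
  have hs : ((√(2 * Real.pi) : ℝ) : ℂ) ≠ 0 := by
    exact_mod_cast (by positivity : √(2 * Real.pi) ≠ 0)
  set a' : ℝ → ℂ := fun η => a (2 * Real.pi * η)
  have h1' : Integrable a' := h1.comp_mul_left' hp.ne'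
  have h2' : MemLp a' 2 (volume : Measure ℝ) := memLp_comp_mul hp h2
  have e : invInt a =ᵐ[volume]
      ((√(2 * Real.pi) : ℝ) : ℂ) • (𝓕⁻ (h2'.toLp a') : Lp ℂ 2 (volume : Measure ℝ)) := by
    refine Filter.EventuallyEq.trans (Filter.Eventually.of_forall (invInt_eq_fourierInv a)) ?_
    filter_upwards [fourierInv_toLp_ae h1' h2'] with x hx
    rw [Pi.smul_apply, hx]; rfl
  have hm : MemLp (invInt a) 2 (volume : Measure ℝ) :=
    ((Lp.memLp _).const_smul _).ae_eq e.symm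
  refine ⟨hm, ?_⟩
  have e2 : hm.toLp _ = ((√(2 * Real.pi) : ℝ) : ℂ) • 𝓕⁻ (h2'.toLp a') := by
    apply Lp.ext
    exact (hm.coeFn_toLp.trans e).trans (Lp.coeFn_smul _ _).symm
  have e3 : 𝓕 (hm.toLp _) = ((√(2 * Real.pi) : ℝ) : ℂ) • h2'.toLp a' := by
    rw [e2, FourierTransform.fourier_smul, FourierTransform.fourier_fourierInv_eq]
  have e4 : (𝓕 (hm.toLp _) : Lp ℂ 2 (volume : Measure ℝ)) =ᵐ[volume]
      fun η => ((√(2 * Real.pi) : ℝ) : ℂ) * a (2 * Real.pi * η) := by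
    rw [e3]
    filter_upwards [Lp.coeFn_smul ((√(2 * Real.pi) : ℝ) : ℂ) (h2'.toLp a'), h2'.coeFn_toLp]
      with x h1 h2
    rw [h1, Pi.smul_apply, h2]; rfl
  rw [hat_eq hm]
  filter_upwards [(quasiMeasurePreserving_div hp).ae e4] with x hx
  rw [hx, ← mul_assoc, inv_mul_cancel₀ hs, one_mul]
  congr 1; field_simp

/-- Fourier inversion for `f ∈ L²` with integrable Fourier transform. -/
lemma ae_eq_invInt_hat {f : ℝ → ℂ} (hf : MemLp f 2 (volume : Measure ℝ))
    (h1 : Integrable (hat f)) : f =ᵐ[volume] invInt (hat f) := by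
  obtain ⟨h, h'⟩ := hat_invInt h1 (memLp_hat hf)
  exact ae_eq_of_hat_ae_eq hf h h'.symm

/-- Decay of `v` is regularity of its transform: `v ∈ L¹` supplies the continuous representative,
and `x v ∈ L²` makes it absolutely continuous with an `L²` derivative. Only the rescaling by `2π`
separates this from `fourier_sub_fourier`. -/
lemma exists_eq_integral_hat {v : ℝ → ℂ} (h1 : Integrable v)
    (h2 : MemLp v 2 (volume : Measure ℝ))
    (h3 : MemLp (fun x : ℝ => x * v x) 2 (volume : Measure ℝ)) :
    ∃ G : ℝ → ℂ, Continuous G ∧ hat v =ᵐ[volume] G ∧ ∀ a b, a ≤ b →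
      G b - G a = -Complex.I * ∫ ξ in a..b, hat (fun x : ℝ => x * v x) ξ := by
  have hp : 0 < 2 * Real.pi := by positivity
  have hcont : Continuous (𝓕 v) := VectorFourier.fourierIntegral_continuous
    Real.continuous_fourierChar (by exact continuous_inner) h1
  refine ⟨fun ξ => ((√(2 * Real.pi) : ℝ) : ℂ)⁻¹ * 𝓕 v (ξ / (2 * Real.pi)), by fun_prop, ?_, ?_⟩
  · rw [hat_eq h2]
    filter_upwards [(quasiMeasurePreserving_div hp).ae (fourier_toLp_ae h1 h2)] with x hx
    rw [hx]
  · intro a b hab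
    rw [← mul_sub, fourier_sub_fourier h1 h3 (by gcongr), hat_eq h3,
      intervalIntegral.integral_const_mul,
      intervalIntegral.integral_comp_div (fun x => (𝓕 (h3.toLp _) : Lp ℂ 2 (volume : Measure ℝ)) x)
        hp.ne', Complex.real_smul]
    push_cast
    ring

/-! ### Weighted Cauchy-Schwarz inequalities -/

/-- The Cauchy-Schwarz inequality for integrals of norms. -/
lemma integral_norm_mul_norm_le {α E F : Type*} [MeasurableSpace α] {μ : Measure α}
    [NormedAddCommGroup E] [NormedAddCommGroup F] {f : α → E} {g : α → F}
    (hf : MemLp f 2 μ) (hg : MemLp g 2 μ) :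
    ∫ a, ‖f a‖ * ‖g a‖ ∂μ ≤ √(∫ a, ‖f a‖ ^ 2 ∂μ) * √(∫ a, ‖g a‖ ^ 2 ∂μ) := by
  have h := integral_mul_norm_le_Lp_mul_Lq (μ := μ) (f := fun a => ‖f a‖) (g := fun a => ‖g a‖)
    Real.HolderConjugate.two_two
    (by simpa using hf.norm) (by simpa using hg.norm)
  simpa [Real.sqrt_eq_rpow] using h

/-- Passage from the extended-real norms in the definition of `X^s` to the real integrals in which
all later estimates are made. -/
lemma integrable_sq_and_integral_le {α E : Type*} [MeasurableSpace α] {μ : Measure α}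
    [NormedAddCommGroup E] {f : α → E} {A : ℝ} (hA : 0 ≤ A)
    (hf : AEStronglyMeasurable f μ) (h : eLpNorm f 2 μ ≤ ENNReal.ofReal A) :
    Integrable (fun x => ‖f x‖ ^ 2) μ ∧ ∫ x, ‖f x‖ ^ 2 ∂μ ≤ A ^ 2 := by
  have hm : MemLp f 2 μ := ⟨hf, h.trans_lt ENNReal.ofReal_lt_top⟩
  have hi := (memLp_two_iff_integrable_sq_norm hf).1 hm
  refine ⟨hi, ?_⟩
  have e := hm.eLpNorm_eq_integral_rpow_norm (by norm_num) (by norm_num)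
  rw [e, ENNReal.ofReal_le_ofReal_iff hA] at h
  simp only [ENNReal.toReal_ofNat, Real.rpow_ofNat] at h
  have h0 : 0 ≤ ∫ x, ‖f x‖ ^ 2 ∂μ := by positivity
  rw [← Real.sqrt_le_sqrt_iff (by positivity), Real.sqrt_sq hA, Real.sqrt_eq_rpow]
  simpa using h

lemma memLp_japanese {p : ℝ} (hp : 1 / 2 < p) :
    MemLp (fun ξ : ℝ => (1 + |ξ| ^ 2) ^ (-p / 2)) 2 (volume : Measure ℝ) := by
  have hm : AEStronglyMeasurable (fun ξ : ℝ => (1 + |ξ| ^ 2) ^ (-p / 2)) volume := by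
    apply Continuous.aestronglyMeasurable
    refine Continuous.rpow_const (by fun_prop) fun x => Or.inl (by positivity)
  rw [memLp_two_iff_integrable_sq_norm hm]
  have := integrable_rpow_neg_one_add_norm_sq (E := ℝ) (r := 2 * p) (μ := volume)
    (by simp; linarith)
  refine this.congr (Filter.Eventually.of_forall fun ξ => ?_)
  simp only [Real.norm_eq_abs, abs_of_nonneg (by positivity : 0 ≤ (1 + |ξ| ^ 2) ^ (-p / 2))]
  rw [← Real.rpow_natCast ((1 + |ξ| ^ 2) ^ (-p / 2)), ← Real.rpow_mul (by positivity)]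
  congr 1; push_cast; ring

/-- `⟨ξ⟩^r h` is integrable if `⟨ξ⟩^s h` is square integrable and `s > r + 1/2`. -/
lemma integrable_weight {s r : ℝ} {h : ℝ → ℂ} (hrs : r + 1 / 2 < s)
    (hK : MemLp (fun ξ : ℝ => (1 + |ξ| ^ 2) ^ (s / 2) * ‖h ξ‖) 2 (volume : Measure ℝ)) :
    Integrable (fun ξ : ℝ => (1 + |ξ| ^ 2) ^ (r / 2) * ‖h ξ‖) ∧
    ∫ ξ : ℝ, (1 + |ξ| ^ 2) ^ (r / 2) * ‖h ξ‖ ≤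
      √(∫ ξ : ℝ, ‖(1 + |ξ| ^ 2) ^ (-(s - r) / 2)‖ ^ 2) *
      √(∫ ξ : ℝ, ‖(1 + |ξ| ^ 2) ^ (s / 2) * ‖h ξ‖‖ ^ 2) := by
  have hw := memLp_japanese (p := s - r) (by linarith)
  have e : ∀ ξ : ℝ, (1 + |ξ| ^ 2) ^ (r / 2) * ‖h ξ‖ =
      (1 + |ξ| ^ 2) ^ (-(s - r) / 2) * ((1 + |ξ| ^ 2) ^ (s / 2) * ‖h ξ‖) := by
    intro ξ
    rw [← mul_assoc, ← Real.rpow_add (by positivity)]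
    congr 2; ring
  refine ⟨?_, ?_⟩
  · simp_rw [e]
    exact hw.integrable_mul hK
  · refine le_trans (le_of_eq ?_) (integral_norm_mul_norm_le hw hK)
    congr 1; ext ξ
    rw [e, Real.norm_of_nonneg (by positivity), Real.norm_of_nonneg (by positivity)]

lemma abs_rpow_le_japanese {ξ r : ℝ} (hr : 0 ≤ r) : |ξ| ^ r ≤ (1 + |ξ| ^ 2) ^ (r / 2) := by
  calc |ξ| ^ r = (|ξ| ^ 2) ^ (r / 2) := by
        rw [← Real.rpow_natCast, ← Real.rpow_mul (abs_nonneg _)]; congr 1; push_cast; ring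
    _ ≤ _ := Real.rpow_le_rpow (by positivity) (by linarith) (by positivity)

lemma le_sqrt_sum_sq (a b c : ℝ≥0∞) :
    a ≤ (a ^ 2 + b ^ 2 + c ^ 2) ^ (1 / 2 : ℝ) ∧ b ≤ (a ^ 2 + b ^ 2 + c ^ 2) ^ (1 / 2 : ℝ) ∧
      c ≤ (a ^ 2 + b ^ 2 + c ^ 2) ^ (1 / 2 : ℝ) := by
  have h : ∀ d : ℝ≥0∞, d = (d ^ 2) ^ (1 / 2 : ℝ) := by
    intro d; rw [← ENNReal.rpow_natCast, ← ENNReal.rpow_mul]; norm_num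
  refine ⟨?_, ?_, ?_⟩
  · conv_lhs => rw [h a]
    exact ENNReal.rpow_le_rpow (by rw [add_assoc]; exact le_self_add) (by norm_num)
  · conv_lhs => rw [h b]
    exact ENNReal.rpow_le_rpow (by rw [add_right_comm]; exact le_add_self) (by norm_num)
  · conv_lhs => rw [h c]
    exact ENNReal.rpow_le_rpow le_add_self (by norm_num)

/-! ### Integrability of `û` from the `X^s` norm -/

section MemX

variable {s t : ℝ} {f : ℝ → ℝ}

lemma MemX.cplx (hf : MemX s t f) : MemLp (cplx f) 2 (volume : Measure ℝ) := hf.1.ofReal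

lemma xNorm_nonneg : 0 ≤ xNorm s t f := ENNReal.toReal_nonneg

lemma MemX.ofReal_xNorm (hf : MemX s t f) :
    ENNReal.ofReal (xNorm s t f) = xENorm s t (ShortPulse.cplx f) :=
  ENNReal.ofReal_toReal hf.2.ne

lemma MemX.memLp_hNorm (hf : MemX s t f) :
    MemLp (fun ξ : ℝ => (1 + |ξ| ^ 2) ^ (s / 2) * ‖hat (ShortPulse.cplx f) ξ‖) 2
      (volume : Measure ℝ) ∧
    eLpNorm (fun ξ : ℝ => (1 + |ξ| ^ 2) ^ (s / 2) * ‖hat (ShortPulse.cplx f) ξ‖) 2 volume ≤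
      ENNReal.ofReal (xNorm s t f) := by
  have h : hNorm s (ShortPulse.cplx f) ≤ ENNReal.ofReal (xNorm s t f) := by
    rw [hf.ofReal_xNorm]; exact (le_sqrt_sum_sq _ _ _).1
  refine ⟨⟨?_, lt_of_le_of_lt h ENNReal.ofReal_lt_top⟩, h⟩
  refine AEStronglyMeasurable.mul (Continuous.aestronglyMeasurable ?_) (memLp_hat hf.cplx).1.norm
  refine Continuous.rpow_const (by fun_prop) fun x => Or.inl (by positivity)

lemma MemX.memLp_hdotNorm (hf : MemX s t f) :
    MemLp (fun ξ : ℝ => |ξ| ^ (-1 : ℝ) * ‖hat (ShortPulse.cplx f) ξ‖) 2 (volume : Measure ℝ) ∧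
    eLpNorm (fun ξ : ℝ => |ξ| ^ (-1 : ℝ) * ‖hat (ShortPulse.cplx f) ξ‖) 2 volume ≤
      ENNReal.ofReal (xNorm s t f) := by
  have h : hdotNorm (-1) (ShortPulse.cplx f) ≤ ENNReal.ofReal (xNorm s t f) := by
    rw [hf.ofReal_xNorm]; exact (le_sqrt_sum_sq _ _ _).2.1
  refine ⟨⟨?_, lt_of_le_of_lt h ENNReal.ofReal_lt_top⟩, h⟩
  refine AEStronglyMeasurable.mul (Measurable.aestronglyMeasurable ?_) (memLp_hat hf.cplx).1.norm
  fun_prop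

lemma MemX.eLpNorm_JDx (hf : MemX s t f) :
    eLpNorm (JDx t (ShortPulse.cplx f)) 2 volume ≤ ENNReal.ofReal (xNorm s t f) := by
  rw [hf.ofReal_xNorm]; exact (le_sqrt_sum_sq _ _ _).2.2

/-- `|ξ|^r û` is integrable for `0 ≤ r < s - 1/2`. -/
lemma MemX.integrable_abs_rpow_mul (hf : MemX s t f) {r : ℝ} (hr : 0 ≤ r) (hrs : r + 1 / 2 < s) :
    Integrable (fun ξ : ℝ => |ξ| ^ r * ‖hat (ShortPulse.cplx f) ξ‖) := by
  refine (integrable_weight hrs hf.memLp_hNorm.1).1.mono' ?_ ?_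
  · exact AEStronglyMeasurable.mul (Measurable.aestronglyMeasurable (by fun_prop))
      (memLp_hat hf.cplx).1.norm
  · refine Filter.Eventually.of_forall fun ξ => ?_
    rw [Real.norm_of_nonneg (by positivity)]
    gcongr
    exact abs_rpow_le_japanese hr

lemma MemX.integral_abs_rpow_mul_le (hf : MemX s t f) {r : ℝ} (hr : 0 ≤ r) (hrs : r + 1 / 2 < s) :
    ∫ ξ : ℝ, |ξ| ^ r * ‖hat (ShortPulse.cplx f) ξ‖ ≤
      √(∫ ξ : ℝ, ‖(1 + |ξ| ^ 2) ^ (-(s - r) / 2)‖ ^ 2) * xNorm s t f := by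
  obtain ⟨h1, h2⟩ := integrable_weight hrs hf.memLp_hNorm.1
  refine (integral_mono (hf.integrable_abs_rpow_mul hr hrs) h1 fun ξ => ?_).trans (h2.trans ?_)
  · exact mul_le_mul_of_nonneg_right (abs_rpow_le_japanese hr) (norm_nonneg _)
  · gcongr
    rw [← Real.sqrt_sq (xNorm_nonneg (s := s) (t := t) (f := f))]
    exact Real.sqrt_le_sqrt
      (integrable_sq_and_integral_le xNorm_nonneg hf.memLp_hNorm.1.1 hf.memLp_hNorm.2).2

lemma MemX.integrable_hat (hf : MemX s t f) (hs : 3 / 2 < s) :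
    Integrable (hat (ShortPulse.cplx f)) := by
  have := hf.integrable_abs_rpow_mul le_rfl (by linarith : (0 : ℝ) + 1 / 2 < s)
  simp only [Real.rpow_zero, one_mul] at this
  exact (integrable_norm_iff (memLp_hat hf.cplx).1).1 this

lemma MemX.integrable_mul_hat (hf : MemX s t f) (hs : 3 / 2 < s) :
    Integrable (fun ξ : ℝ => (ξ : ℂ) * hat (ShortPulse.cplx f) ξ) := by
  have := hf.integrable_abs_rpow_mul zero_le_one (by linarith : (1 : ℝ) + 1 / 2 < s)
  refine (integrable_norm_iff ?_).1 ?_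
  · exact AEStronglyMeasurable.mul (by fun_prop) (memLp_hat hf.cplx).1
  · simpa using this

lemma MemX.memLp_mul_hat (hf : MemX s t f) (hs : 3 / 2 < s) :
    MemLp (fun ξ : ℝ => (ξ : ℂ) * hat (ShortPulse.cplx f) ξ) 2 (volume : Measure ℝ) := by
  refine hf.memLp_hNorm.1.of_le (AEStronglyMeasurable.mul (by fun_prop) (memLp_hat hf.cplx).1) ?_
  refine Filter.Eventually.of_forall fun ξ => ?_
  rw [norm_mul, Real.norm_of_nonneg (by positivity), Complex.norm_real, Real.norm_eq_abs]
  gcongr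
  calc |ξ| = |ξ| ^ (1 : ℝ) := by simp
    _ ≤ _ := abs_rpow_le_japanese zero_le_one
    _ ≤ _ := Real.rpow_le_rpow_of_exponent_le (by nlinarith [sq_nonneg |ξ|]) (by linarith)

lemma MemX.memLp_inv_mul_hat (hf : MemX s t f) :
    MemLp (fun ξ : ℝ => (ξ : ℂ)⁻¹ * hat (ShortPulse.cplx f) ξ) 2 (volume : Measure ℝ) := by
  refine hf.memLp_hdotNorm.1.of_le
    (AEStronglyMeasurable.mul (Measurable.aestronglyMeasurable (by fun_prop))
      (memLp_hat hf.cplx).1) ?_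
  refine Filter.Eventually.of_forall fun ξ => ?_
  rw [norm_mul, norm_inv, Real.norm_of_nonneg (by positivity), Complex.norm_real, Real.norm_eq_abs,
    Real.rpow_neg_one]

/-- On `|ξ| ≤ 1` square integrability on a bounded set suffices; on `|ξ| ≥ 1` the factor `1/ξ` is at
most `1` in modulus and `û` is already integrable. -/
lemma MemX.integrable_inv_mul_hat (hf : MemX s t f) (hs : 3 / 2 < s) :
    Integrable (fun ξ : ℝ => (ξ : ℂ)⁻¹ * hat (ShortPulse.cplx f) ξ) := by
  have h2 := hf.memLp_inv_mul_hat
  have hs' : MeasurableSet (Icc (-1 : ℝ) 1) := measurableSet_Icc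
  have h3 : IntegrableOn (fun ξ : ℝ => (ξ : ℂ)⁻¹ * hat (ShortPulse.cplx f) ξ) (Icc (-1) 1) :=
    (h2.restrict (Icc (-1) 1)).integrable (by norm_num)
  have h4 := (h3.integrable_indicator hs').norm.add (hf.integrable_hat hs).norm
  refine h4.mono' h2.1 (Filter.Eventually.of_forall fun ξ => ?_)
  by_cases h : ξ ∈ Icc (-1 : ℝ) 1
  · simp [h]
  · have h' : 1 ≤ |ξ| := by
      by_contra h'
      exact h (abs_le.1 (not_le.1 h').le)
    simp only [Pi.add_apply, indicator_of_notMem h, norm_zero, zero_add]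
    rw [norm_mul, norm_inv, Complex.norm_real, Real.norm_eq_abs]
    exact mul_le_of_le_one_left (norm_nonneg _) (inv_le_one_of_one_le₀ h')

end MemX

/-! ### The profile equation -/

/-- The data extracted from a function with finite `X^s` norm: `G` is the continuous representative
of `ξ û(ξ)`, whose derivative is `i t G / ξ² + W` with `W` the Fourier transform of `-J ∂ₓ u`. -/
structure Profile (s t A : ℝ) (G W : ℝ → ℂ) : Prop where
  cont : Continuous G
  memLp_W : MemLp W 2 (volume : Measure ℝ)
  integral_W_le : ∫ ξ, ‖W ξ‖ ^ 2 ≤ A ^ 2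
  sub_eq : ∀ a b, 0 < a → a ≤ b →
    G b - G a = ∫ ξ in a..b, (Complex.I * t / ξ ^ 2 * G ξ + W ξ)
  integrable_low : Integrable fun ξ : ℝ => ‖G ξ‖ ^ 2 / ξ ^ 4
  low : ∫ ξ : ℝ, ‖G ξ‖ ^ 2 / ξ ^ 4 ≤ A ^ 2
  integrable_high : Integrable fun ξ : ℝ => |ξ| ^ (2 * s - 2) * ‖G ξ‖ ^ 2
  high : ∫ ξ : ℝ, |ξ| ^ (2 * s - 2) * ‖G ξ‖ ^ 2 ≤ A ^ 2

/-- Cauchy-Schwarz against `(1 + x²)^{-1/2}`, which is square integrable on the line. It applies to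
`v = ∂ₓ u`, so that the transform of `∂ₓ u` is an honest continuous function. -/
lemma integrable_of_memLp_mul {v : ℝ → ℂ} (h1 : MemLp v 2 (volume : Measure ℝ))
    (h2 : MemLp (fun x : ℝ => x * v x) 2 (volume : Measure ℝ)) : Integrable v := by
  have h3 : MemLp (fun x : ℝ => (1 + |x| ^ 2) ^ ((1 : ℝ) / 2) * ‖v x‖) 2 (volume : Measure ℝ) := by
    refine (h1.norm.add h2.norm).of_le ?_ (Filter.Eventually.of_forall fun x => ?_)
    · refine AEStronglyMeasurable.mul (Continuous.aestronglyMeasurable ?_) h1.1.norm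
      refine Continuous.rpow_const (by fun_prop) fun x => Or.inl (by positivity)
    · rw [Real.norm_of_nonneg (by positivity), Pi.add_apply, Real.norm_of_nonneg (by positivity),
        norm_mul, Complex.norm_real, Real.norm_eq_abs, ← Real.sqrt_eq_rpow, ← one_add_mul]
      gcongr
      rw [Real.sqrt_le_left (by positivity)]
      nlinarith [abs_nonneg x]
  have := (integrable_weight (r := 0) (s := 1) (by norm_num) h3).1
  simp only [zero_div, Real.rpow_zero, one_mul] at this
  exact (integrable_norm_iff h1.1).1 this

/-- Rewrite `J ∂ₓ u = w` as `x ∂ₓ u = w + t ∂ₓ⁻¹ u`. The right side is in `L²` by the `Ḣ^{-1}` norm,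
and multiplication by `x` is `i d/dξ` on the Fourier side; substituting the symbol of `∂ₓ⁻¹` gives
the equation for `ξ û`. -/
theorem MemX.exists_profile {s t : ℝ} {f : ℝ → ℝ} (hf : MemX s t f) (hs : 3 / 2 < s) :
    ∃ G W : ℝ → ℂ, Profile s t (xNorm s t f) G W ∧
      ∀ᵐ ξ : ℝ, hat (ShortPulse.cplx f) ξ = (ξ : ℂ)⁻¹ * G ξ := by
  set h := hat (ShortPulse.cplx f) with hh
  obtain ⟨v2, hv⟩ := hat_invInt (a := fun ξ : ℝ => Complex.I * ξ * h ξ)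
    (by simpa [mul_assoc] using (hf.integrable_mul_hat hs).const_mul Complex.I)
    (by simpa [mul_assoc] using (hf.memLp_mul_hat hs).const_mul Complex.I)
  obtain ⟨z2, hz⟩ := hat_invInt (a := fun ξ : ℝ => (Complex.I * ξ)⁻¹ * h ξ)
    (by simpa [mul_assoc, mul_comm] using (hf.integrable_inv_mul_hat hs).const_mul Complex.I⁻¹)
    (by simpa [mul_assoc, mul_comm] using (hf.memLp_inv_mul_hat).const_mul Complex.I⁻¹)
  change MemLp (Dx (ShortPulse.cplx f)) 2 volume at v2
  change MemLp (DxInv (ShortPulse.cplx f)) 2 volume at z2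
  change hat (Dx (ShortPulse.cplx f)) =ᵐ[volume] _ at hv
  change hat (DxInv (ShortPulse.cplx f)) =ᵐ[volume] _ at hz
  set v := Dx (ShortPulse.cplx f)
  set z := DxInv (ShortPulse.cplx f)
  have w2 : MemLp (JDx t (ShortPulse.cplx f)) 2 (volume : Measure ℝ) := by
    refine ⟨?_, hf.eLpNorm_JDx.trans_lt ENNReal.ofReal_lt_top⟩
    exact ((by fun_prop : AEStronglyMeasurable (fun x : ℝ => (x : ℂ)) volume).mul v2.1).sub
      (z2.1.const_mul (t : ℂ))
  set w := JDx t (ShortPulse.cplx f)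
  have ey : (fun x : ℝ => x * v x) = fun x => 1 * w x + t * z x := by
    ext x; simp only [w, JDx, v, z]; ring
  have y2 : MemLp (fun x : ℝ => x * v x) 2 (volume : Measure ℝ) := by
    rw [ey]; exact (w2.const_mul 1).add (z2.const_mul _)
  obtain ⟨G, hG1, hG2, hG3⟩ := exists_eq_integral_hat (integrable_of_memLp_mul v2 y2) v2 y2
  have hne : ∀ᵐ ξ : ℝ, ξ ≠ 0 := by
    filter_upwards [compl_mem_ae_iff.mpr (measure_singleton (0 : ℝ))] with x hx
    simpa using hx
  have hGh : ∀ᵐ ξ : ℝ, h ξ = (ξ : ℂ)⁻¹ * (-Complex.I * G ξ) := by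
    filter_upwards [hG2, hv, hne] with ξ h1 h2 h3
    have h3' : (ξ : ℂ) ≠ 0 := by exact_mod_cast h3
    rw [← h1, h2]
    field_simp
    simp
  have hW := integrable_sq_and_integral_le (A := xNorm s t f) xNorm_nonneg (memLp_hat w2).1
    (by rw [eLpNorm_hat w2]; exact hf.eLpNorm_JDx)
  have hlow := integrable_sq_and_integral_le xNorm_nonneg hf.memLp_hdotNorm.1.1 hf.memLp_hdotNorm.2
  have hhigh := integrable_sq_and_integral_le xNorm_nonneg hf.memLp_hNorm.1.1 hf.memLp_hNorm.2
  have elow : ∀ᵐ ξ : ℝ, ‖|ξ| ^ (-1 : ℝ) * ‖hat (ShortPulse.cplx f) ξ‖‖ ^ 2 =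
      ‖-Complex.I * G ξ‖ ^ 2 / ξ ^ 4 := by
    filter_upwards [hGh] with ξ h1
    rw [Real.norm_of_nonneg (by positivity), ← hh, h1, norm_mul (ξ : ℂ)⁻¹, norm_inv,
      Complex.norm_real, Real.rpow_neg_one, Real.norm_eq_abs, ← mul_assoc, ← sq, mul_pow, inv_pow, inv_pow, ← pow_mul,
      Even.pow_abs (by decide)]
    ring
  have ehigh : ∀ᵐ ξ : ℝ, |ξ| ^ (2 * s - 2) * ‖-Complex.I * G ξ‖ ^ 2 ≤
      ‖(1 + |ξ| ^ 2) ^ (s / 2) * ‖hat (ShortPulse.cplx f) ξ‖‖ ^ 2 := by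
    filter_upwards [hGh, hne] with ξ h1 h2
    have h2' : 0 < |ξ| := by positivity
    rw [Real.norm_of_nonneg (by positivity), mul_pow, ← hh, h1, norm_mul (ξ : ℂ)⁻¹, norm_inv,
      Complex.norm_real, Real.norm_eq_abs, mul_pow, ← mul_assoc]
    refine mul_le_mul_of_nonneg_right ?_ (by positivity)
    calc |ξ| ^ (2 * s - 2) = (|ξ| ^ s) ^ 2 * |ξ|⁻¹ ^ 2 := by
          rw [Real.rpow_sub h2', mul_comm 2 s, Real.rpow_mul h2'.le, inv_pow]; simp [div_eq_mul_inv]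
      _ ≤ _ := by gcongr; exact abs_rpow_le_japanese (by linarith)
  -- The local `G` represents the transform of `∂ₓ u`, that is `i ξ û`; the factor `-i` makes the
  -- profile `ξ û`.
  refine ⟨fun ξ => -Complex.I * G ξ, fun ξ => -hat w ξ, ⟨by fun_prop, (memLp_hat w2).neg, ?_, ?_,
    ?_, ?_, ?_, ?_⟩, hGh⟩
  · simpa using hW.2
  · intro a b ha hab
    rw [← mul_sub, hG3 a b hab, ← mul_assoc, ey]
    simp only [mul_neg, neg_mul, Complex.I_mul_I, neg_neg, one_mul]
    simp only [one_mul] at *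
    rw [← intervalIntegral.integral_neg]
    apply intervalIntegral.integral_congr_ae
    filter_upwards [hat_linear w2 z2 1 t, hz, hGh, hne] with ξ h1 h2 h3 h4 _
    simp only [one_mul] at h1
    have h4' : (ξ : ℂ) ≠ 0 := by exact_mod_cast h4
    rw [h1, h2, h3]
    field_simp
    simp
  · exact hlow.1.congr elow
  · rw [← integral_congr_ae elow]; exact hlow.2
  · refine hhigh.1.mono' ?_ ?_
    · refine Measurable.aestronglyMeasurable ?_
      have := hG1.measurable
      fun_prop
    · filter_upwards [ehigh] with ξ h1
      rwa [Real.norm_of_nonneg (by positivity)]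
  · refine le_trans (integral_mono_of_nonneg ?_ hhigh.1 ehigh) hhigh.2
    exact Filter.Eventually.of_forall fun ξ => by positivity

/-! ### Regularity of inversion integrals and the bound for small times -/

lemma norm_exp_I_mul (x ξ : ℝ) : ‖Complex.exp (Complex.I * x * ξ)‖ = 1 := by
  rw [show Complex.I * x * ξ = ((x * ξ : ℝ) : ℂ) * Complex.I by push_cast; ring]
  exact Complex.norm_exp_ofReal_mul_I _

lemma integrable_exp_mul {a : ℝ → ℂ} (h : Integrable a) (x : ℝ) :
    Integrable fun ξ : ℝ => Complex.exp (Complex.I * x * ξ) * a ξ := by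
  refine h.bdd_mul (c := 1) (by fun_prop) (Filter.Eventually.of_forall fun ξ => ?_)
  rw [norm_exp_I_mul]

lemma norm_invInt_const_le : ‖((√(2 * Real.pi) : ℝ) : ℂ)⁻¹‖ ≤ 1 := by
  rw [norm_inv, Complex.norm_real, Real.norm_of_nonneg (by positivity)]
  apply inv_le_one_of_one_le₀
  rw [Real.one_le_sqrt]
  linarith [Real.pi_gt_three]

lemma norm_invInt_le (a : ℝ → ℂ) (x : ℝ) : ‖invInt a x‖ ≤
    ‖∫ ξ : ℝ, Complex.exp (Complex.I * x * ξ) * a ξ‖ := by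
  rw [invInt, norm_mul]
  exact mul_le_of_le_one_left (norm_nonneg _) norm_invInt_const_le

lemma norm_invInt_le_integral (a : ℝ → ℂ) (x : ℝ) : ‖invInt a x‖ ≤ ∫ ξ : ℝ, ‖a ξ‖ := by
  refine (norm_invInt_le a x).trans ((norm_integral_le_integral_norm _).trans (le_of_eq ?_))
  congr 1; ext ξ
  rw [norm_mul, norm_exp_I_mul, one_mul]

lemma continuous_invInt {a : ℝ → ℂ} (h : Integrable a) : Continuous (invInt a) := by
  refine continuous_const.mul ?_
  refine continuous_of_dominated (bound := fun ξ => ‖a ξ‖)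
    (fun x => (integrable_exp_mul h x).1) ?_ h.norm ?_
  · intro x
    refine Filter.Eventually.of_forall fun ξ => ?_
    rw [norm_mul, norm_exp_I_mul, one_mul]
  · exact Filter.Eventually.of_forall fun ξ => by fun_prop

lemma hasDerivAt_invInt {a : ℝ → ℂ} (h : Integrable a)
    (h' : Integrable fun ξ : ℝ => (ξ : ℂ) * a ξ) (x : ℝ) :
    HasDerivAt (invInt a) (invInt (fun ξ : ℝ => Complex.I * ξ * a ξ) x) x := by
  refine HasDerivAt.const_mul _ ?_
  refine (hasDerivAt_integral_of_dominated_loc_of_deriv_le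
    (F' := fun (y ξ : ℝ) => Complex.exp (Complex.I * y * ξ) * (Complex.I * ξ * a ξ))
    (bound := fun ξ : ℝ => ‖(ξ : ℂ) * a ξ‖) Filter.univ_mem
    (Filter.Eventually.of_forall fun x => (integrable_exp_mul h x).1) (integrable_exp_mul h x)
    ?_ ?_ h'.norm ?_).2
  · have : Integrable (fun ξ : ℝ => Complex.I * ξ * a ξ) := by
      simpa [mul_assoc] using h'.const_mul Complex.I
    exact (integrable_exp_mul this x).1
  · refine Filter.Eventually.of_forall fun ξ y _ => ?_
    rw [norm_mul, norm_exp_I_mul, one_mul, mul_assoc, norm_mul, Complex.norm_I, one_mul]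
  · refine Filter.Eventually.of_forall fun ξ y _ => ?_
    have h1 : HasDerivAt (fun y : ℝ => Complex.I * y * ξ) (Complex.I * ξ) y := by
      have := ((Complex.ofRealCLM.hasDerivAt (x := y)).const_mul Complex.I).mul_const (ξ : ℂ)
      simpa using this
    have := h1.cexp.mul_const (a ξ)
    exact this.congr_deriv (mul_assoc _ _ _)

lemma contDiff_invInt {a : ℝ → ℂ} (h : Integrable a)
    (h' : Integrable fun ξ : ℝ => (ξ : ℂ) * a ξ) : ContDiff ℝ 1 (invInt a) := by
  rw [contDiff_one_iff_deriv]
  refine ⟨fun x => (hasDerivAt_invInt h h' x).differentiableAt, ?_⟩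
  rw [funext fun x => (hasDerivAt_invInt h h' x).deriv]
  refine continuous_invInt ?_
  simpa [mul_assoc] using h'.const_mul Complex.I

/-- Both `û` and `ξ û` are integrable, since `⟨ξ⟩^{-(s-r)}` is square integrable for `r = 0, 1`
exactly when `s > 3/2`; the inversion integral may then be differentiated under the sign. -/
theorem sobolev_embedding (s : ℝ) (hs : 3 / 2 < s) : ∃ C : ℝ, 0 < C ∧
    ∀ (f : ℝ → ℝ) (t : ℝ), MemX s t f →
      ∃ v : ℝ → ℝ, ContDiff ℝ 1 v ∧ f =ᵐ[volume] v ∧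
        (∀ x, |v x| ≤ C * xNorm s t f) ∧ (∀ x, |deriv v x| ≤ C * xNorm s t f) := by
  set C0 := √(∫ ξ : ℝ, ‖(1 + |ξ| ^ 2) ^ (-(s - 0) / 2)‖ ^ 2)
  set C1 := √(∫ ξ : ℝ, ‖(1 + |ξ| ^ 2) ^ (-(s - 1) / 2)‖ ^ 2)
  have hC0 : 0 ≤ C0 := Real.sqrt_nonneg _
  have hC1 : 0 ≤ C1 := Real.sqrt_nonneg _
  refine ⟨C0 + C1 + 1, by positivity, fun f t hf => ?_⟩
  have i0 := hf.integrable_hat hs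
  have i1 := hf.integrable_mul_hat hs
  have hA : 0 ≤ xNorm s t f := xNorm_nonneg
  have hd := contDiff_invInt i0 i1
  have hder : ∀ x, HasDerivAt (fun x => (invInt (hat (cplx f)) x).re)
      (invInt (fun ξ : ℝ => Complex.I * ξ * hat (cplx f) ξ) x).re x := fun x =>
    Complex.reCLM.hasFDerivAt.comp_hasDerivAt x (hasDerivAt_invInt i0 i1 x)
  refine ⟨fun x => (invInt (hat (cplx f)) x).re, Complex.reCLM.contDiff.comp hd, ?_, ?_, ?_⟩
  · filter_upwards [ae_eq_invInt_hat hf.cplx i0] with x hx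
    rw [← hx]; simp [cplx]
  · intro x
    have h1 := hf.integral_abs_rpow_mul_le le_rfl (by linarith : (0 : ℝ) + 1 / 2 < s)
    simp only [Real.rpow_zero, one_mul] at h1
    refine (Complex.abs_re_le_norm _).trans ((norm_invInt_le_integral _ _).trans (h1.trans ?_))
    gcongr
    linarith
  · intro x
    have h1 := hf.integral_abs_rpow_mul_le zero_le_one (by linarith : (1 : ℝ) + 1 / 2 < s)
    rw [(hder x).deriv]
    refine (Complex.abs_re_le_norm _).trans ((norm_invInt_le_integral _ _).trans ?_)
    refine (le_of_eq ?_).trans (h1.trans ?_)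
    · congr 1; ext ξ; simp
    · gcongr
      linarith

/-! ### Integration by parts along the profile -/

/-- The product rule for primitives of integrable functions. -/
lemma mul_sub_mul_eq_integral {F f K k : ℝ → ℂ} {a b : ℝ} (hab : a ≤ b)
    (hf : IntervalIntegrable f volume a b) (hk : IntervalIntegrable k volume a b)
    (hF : ∀ x ∈ Icc a b, F x - F a = ∫ ξ in a..x, f ξ)
    (hK : ∀ x ∈ Icc a b, K x - K a = ∫ ξ in a..x, k ξ) :
    F b * K b - F a * K a = ∫ ξ in a..b, (f ξ * K ξ + F ξ * k ξ) := by
  have hf' := (intervalIntegrable_iff_integrableOn_Ioc_of_le hab).1 hf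
  have hk' := (intervalIntegrable_iff_integrableOn_Ioc_of_le hab).1 hk
  set μ := (volume : Measure ℝ).restrict (Ioc a b) with hμ
  -- The integrands are merely integrable, so no pointwise derivative is used: the product of the
  -- two increments is a double integral over the square, and Fubini on the two sides of the
  -- diagonal yields the two terms of the product rule.
  have hH : Integrable (fun p : ℝ × ℝ => f p.1 * k p.2) (μ.prod μ) := hf'.mul_prod hk'
  have hS : MeasurableSet {p : ℝ × ℝ | p.2 ≤ p.1} := measurableSet_le measurable_snd measurable_fst
  have e0 := integral_add_compl hS hH
  rw [integral_prod_mul (μ := μ) (ν := μ) f k] at e0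
  have hFb := hF b (right_mem_Icc.2 hab)
  have hKb := hK b (right_mem_Icc.2 hab)
  rw [intervalIntegral.integral_of_le hab] at hFb hKb
  rw [← hFb, ← hKb] at e0
  have e1 : ∫ p in {p : ℝ × ℝ | p.2 ≤ p.1}, f p.1 * k p.2 ∂(μ.prod μ) =
      ∫ x, f x * (K x - K a) ∂μ := by
    rw [← integral_indicator hS, integral_prod _ (hH.indicator hS)]
    refine setIntegral_congr_fun measurableSet_Ioc fun x hx => ?_
    have : ∀ y, ({p : ℝ × ℝ | p.2 ≤ p.1}).indicator (fun p : ℝ × ℝ => f p.1 * k p.2) (x, y) =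
        f x * (Iic x).indicator k y := by
      intro y; by_cases h : y ≤ x <;> simp [indicator, h]
    simp only [this]
    rw [integral_const_mul, hK x ⟨hx.1.le, hx.2⟩, intervalIntegral.integral_of_le hx.1.le,
      integral_indicator measurableSet_Iic, hμ, Measure.restrict_restrict measurableSet_Iic,
      inter_comm, Ioc_inter_Iic, min_eq_right hx.2]
  have e2 : ∫ p in {p : ℝ × ℝ | p.2 ≤ p.1}ᶜ, f p.1 * k p.2 ∂(μ.prod μ) =
      ∫ x, (F x - F a) * k x ∂μ := by
    rw [← integral_indicator hS.compl, integral_prod_symm _ (hH.indicator hS.compl)]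
    refine setIntegral_congr_fun measurableSet_Ioc fun x hx => ?_
    have : ∀ y, ({p : ℝ × ℝ | p.2 ≤ p.1}ᶜ).indicator (fun p : ℝ × ℝ => f p.1 * k p.2) (y, x) =
        (Iio x).indicator f y * k x := by
      intro y; by_cases h : y < x <;> simp [indicator, h]
    simp only [this]
    rw [integral_mul_const, hF x ⟨hx.1.le, hx.2⟩, intervalIntegral.integral_of_le hx.1.le,
      integral_indicator measurableSet_Iio, hμ, Measure.restrict_restrict measurableSet_Iio,
      integral_Ioc_eq_integral_Ioo]
    congr 3
    ext y
    simp only [mem_inter_iff, mem_Iio, mem_Ioc, mem_Ioo]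
    exact ⟨fun h => ⟨h.2.1, h.1⟩, fun h => ⟨h.2, h.1, h.2.le.trans hx.2⟩⟩
  have cF : ContinuousOn F (Icc a b) := by
    have h : ContinuousOn (fun x => F a + ∫ ξ in a..x, f ξ) (Icc a b) := by
      refine continuousOn_const.add ?_
      rw [← uIcc_of_le hab] at *
      exact intervalIntegral.continuousOn_primitive_interval' hf left_mem_uIcc
    refine h.congr fun x hx => ?_
    simp only [← hF x hx]; ring
  have cK : ContinuousOn K (Icc a b) := by
    have h : ContinuousOn (fun x => K a + ∫ ξ in a..x, k ξ) (Icc a b) := by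
      refine continuousOn_const.add ?_
      rw [← uIcc_of_le hab] at *
      exact intervalIntegral.continuousOn_primitive_interval' hk left_mem_uIcc
    refine h.congr fun x hx => ?_
    simp only [← hK x hx]; ring
  have i1 : Integrable (fun x => f x * K x) μ := by
    have := hf.mul_continuousOn (g := K) (by rwa [uIcc_of_le hab])
    exact (intervalIntegrable_iff_integrableOn_Ioc_of_le hab).1 this
  have i2 : Integrable (fun x => F x * k x) μ := by
    have := hk.continuousOn_mul (g := F) (by rwa [uIcc_of_le hab])
    exact (intervalIntegrable_iff_integrableOn_Ioc_of_le hab).1 this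
  rw [intervalIntegral.integral_of_le hab, integral_add i1 i2]
  simp only [mul_sub, sub_mul] at e1 e2
  rw [integral_sub i1 (hf'.mul_const _), integral_mul_const, ← hFb] at e1
  rw [integral_sub i2 (hk'.const_mul _), integral_const_mul, ← hKb] at e2
  rw [e1, e2] at e0
  linear_combination -e0

namespace Profile

variable {s t A : ℝ} {G W : ℝ → ℂ}

lemma intervalIntegrable (P : Profile s t A G W) {a b : ℝ} (ha : 0 < a) (hab : a ≤ b) :
    IntervalIntegrable (fun ξ : ℝ => Complex.I * t / ξ ^ 2 * G ξ + W ξ) volume a b := by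
  refine IntervalIntegrable.add (ContinuousOn.intervalIntegrable ?_) ?_
  · refine ContinuousOn.mul (ContinuousOn.div (by fun_prop) (by fun_prop) fun x hx => ?_)
      P.cont.continuousOn
    rw [uIcc_of_le hab] at hx
    have : x ≠ 0 := (ha.trans_le hx.1).ne'
    exact_mod_cast pow_ne_zero 2 this
  · rw [intervalIntegrable_iff_integrableOn_Ioc_of_le hab]
    exact (P.memLp_W.restrict _).integrable (by norm_num)

lemma integrableOn_norm_W_mul (P : Profile s t A G W) {a b : ℝ} {h : ℝ → ℝ}
    (hc : ContinuousOn h (Icc a b)) :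
    IntegrableOn (fun ξ => ‖W ξ‖ * |h ξ|) (Ioc a b) := by
  rcases le_or_gt b a with hab | hab
  · simp [Ioc_eq_empty_of_le hab]
  have h1 : IntegrableOn (fun ξ => ‖W ξ‖) (Ioc a b) :=
    ((P.memLp_W.restrict _).integrable (by norm_num)).norm
  have := ((intervalIntegrable_iff_integrableOn_Ioc_of_le hab.le).2 h1).mul_continuousOn
    (g := fun ξ => |h ξ|) (by rw [uIcc_of_le hab.le]; exact hc.abs)
  exact (intervalIntegrable_iff_integrableOn_Ioc_of_le hab.le).1 this

lemma integrableOn_norm_G_mul (P : Profile s t A G W) {a b : ℝ} {h : ℝ → ℝ}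
    (hc : ContinuousOn h (Icc a b)) :
    IntegrableOn (fun ξ => ‖G ξ‖ * |h ξ|) (Ioc a b) := by
  have : ContinuousOn (fun ξ => ‖G ξ‖ * |h ξ|) (Icc a b) :=
    P.cont.norm.continuousOn.mul hc.abs
  exact this.integrableOn_Icc.mono_set Ioc_subset_Icc_self

/-- Integration by parts against the oscillating factor. -/
lemma norm_integral_phase_le (P : Profile s t A G W) {a b : ℝ} (ha : 0 < a) (hab : a ≤ b)
    (x : ℝ) {h h' : ℝ → ℝ} (hd : ∀ ξ ∈ Icc a b, HasDerivAt h (h' ξ) ξ)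
    (hc : ContinuousOn h' (Icc a b)) (h_left : h a = 0) (h_right : h b = 0) :
    ‖∫ ξ in a..b, Complex.exp (Complex.I * x * ξ) * (((x + t / ξ ^ 2) * h ξ : ℝ) * G ξ)‖ ≤
      ∫ ξ in Ioc a b, (‖W ξ‖ * |h ξ| + ‖G ξ‖ * |h' ξ|) := by
  set k : ℝ → ℂ := fun ξ => Complex.exp (Complex.I * x * ξ) * (Complex.I * x * h ξ + h' ξ)
  have hch : ContinuousOn h (Icc a b) := fun ξ hξ => (hd ξ hξ).continuousAt.continuousWithinAt
  have hck : ContinuousOn k (Icc a b) := by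
    refine ContinuousOn.mul (by fun_prop) (ContinuousOn.add (ContinuousOn.mul (by fun_prop) ?_) ?_)
    · exact Complex.continuous_ofReal.comp_continuousOn hch
    · exact Complex.continuous_ofReal.comp_continuousOn hc
  have hdk : ∀ ξ ∈ Icc a b,
      HasDerivAt (fun ξ : ℝ => Complex.exp (Complex.I * x * ξ) * h ξ) (k ξ) ξ := by
    intro ξ hξ
    have h1 : HasDerivAt (fun ξ : ℝ => Complex.I * x * ξ) (Complex.I * x) ξ := by
      simpa using (Complex.ofRealCLM.hasDerivAt (x := ξ)).const_mul (Complex.I * x)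
    refine (h1.cexp.mul (hd ξ hξ).ofReal_comp).congr_deriv ?_
    simp only [k]; ring
  have hki : ∀ y ∈ Icc a b, IntervalIntegrable k volume a y := fun y hy =>
    ContinuousOn.intervalIntegrable (by
      rw [uIcc_of_le hy.1]; exact hck.mono (Icc_subset_Icc_right hy.2))
  have key := mul_sub_mul_eq_integral (F := G) (K := fun ξ : ℝ => Complex.exp (Complex.I * x * ξ) * h ξ)
    hab (P.intervalIntegrable ha hab) (hki b (right_mem_Icc.2 hab))
    (fun y hy => P.sub_eq a y ha hy.1) (fun y hy => by
      refine (intervalIntegral.integral_eq_sub_of_hasDerivAt (fun z hz => hdk z ?_) (hki y hy)).symm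
      rw [uIcc_of_le hy.1] at hz
      exact ⟨hz.1, hz.2.trans hy.2⟩)
  simp only [h_left, h_right, Complex.ofReal_zero, mul_zero, sub_zero] at key
  have c1 : ContinuousOn (fun ξ : ℝ => Complex.exp (Complex.I * x * ξ) *
      (((x + t / ξ ^ 2) * h ξ : ℝ) * G ξ)) (Icc a b) := by
    refine ContinuousOn.mul (by fun_prop) (ContinuousOn.mul ?_ P.cont.continuousOn)
    refine Complex.continuous_ofReal.comp_continuousOn (ContinuousOn.mul
      (continuousOn_const.add (ContinuousOn.div (by fun_prop) (by fun_prop) fun y hy => ?_)) hch)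
    exact pow_ne_zero 2 (ha.trans_le hy.1).ne'
  have i1 : IntervalIntegrable (fun ξ : ℝ => Complex.exp (Complex.I * x * ξ) *
      (((x + t / ξ ^ 2) * h ξ : ℝ) * G ξ)) volume a b :=
    ContinuousOn.intervalIntegrable (by rwa [uIcc_of_le hab])
  have i2 : IntervalIntegrable (fun ξ : ℝ => Complex.exp (Complex.I * x * ξ) *
      (W ξ * h ξ + G ξ * h' ξ)) volume a b := by
    refine IntervalIntegrable.continuousOn_mul (IntervalIntegrable.add ?_ ?_) (by fun_prop)
    · refine IntervalIntegrable.mul_continuousOn ?_ ?_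
      · rw [intervalIntegrable_iff_integrableOn_Ioc_of_le hab]
        exact (P.memLp_W.restrict _).integrable (by norm_num)
      · rw [uIcc_of_le hab]; exact Complex.continuous_ofReal.comp_continuousOn hch
    · refine ContinuousOn.intervalIntegrable ?_
      rw [uIcc_of_le hab]
      exact P.cont.continuousOn.mul (Complex.continuous_ofReal.comp_continuousOn hc)
  -- By the profile equation the derivative of `e^{ixξ} h G` is `e^{ixξ} (i (x + t/ξ²) h G + W h + G
  -- h')`, and its integral vanishes because `h` is zero at both ends.
  have e : ∫ ξ in a..b, Complex.exp (Complex.I * x * ξ) * (W ξ * h ξ + G ξ * h' ξ) =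
      -(Complex.I * ∫ ξ in a..b, Complex.exp (Complex.I * x * ξ) *
        (((x + t / ξ ^ 2) * h ξ : ℝ) * G ξ)) := by
    rw [eq_neg_iff_add_eq_zero, ← intervalIntegral.integral_const_mul,
      ← intervalIntegral.integral_add i2 (i1.const_mul _), key]
    congr 1; ext ξ
    simp only [k]; push_cast; ring
  have e' : ‖∫ ξ in a..b, Complex.exp (Complex.I * x * ξ) *
      (((x + t / ξ ^ 2) * h ξ : ℝ) * G ξ)‖ =
      ‖∫ ξ in a..b, Complex.exp (Complex.I * x * ξ) * (W ξ * h ξ + G ξ * h' ξ)‖ := by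
    rw [e, norm_neg, norm_mul, Complex.norm_I, one_mul]
  rw [e', intervalIntegral.integral_of_le hab]
  refine norm_integral_le_of_norm_le
    ((P.integrableOn_norm_W_mul hch).add (P.integrableOn_norm_G_mul hc)) ?_
  refine Filter.Eventually.of_forall fun ξ => ?_
  rw [norm_mul, norm_exp_I_mul, one_mul]
  refine (norm_add_le _ _).trans (le_of_eq ?_)
  simp only [norm_mul, Complex.norm_real, Real.norm_eq_abs]

/-- The coefficient `i t/ξ²` is purely imaginary and only rotates `G`, so the derivative of `|G|²`
is `2 Re(W Ḡ)`. The resulting bound has no dependence on `t`. -/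
lemma norm_sq_sub_le (P : Profile s t A G W) {a b : ℝ} (ha : 0 < a) (hab : a ≤ b) :
    |‖G b‖ ^ 2 - ‖G a‖ ^ 2| ≤ 2 * ∫ ξ in Ioc a b, ‖W ξ‖ * ‖G ξ‖ := by
  have hi := P.intervalIntegrable ha hab
  have hconj : ∀ a b, ∀ f : ℝ → ℂ, ∫ ξ in a..b, (starRingEnd ℂ) (f ξ) =
      (starRingEnd ℂ) (∫ ξ in a..b, f ξ) := by
    intro a b f
    simp only [intervalIntegral, integral_conj, map_sub]
  have key := mul_sub_mul_eq_integral (F := G) (K := fun ξ => (starRingEnd ℂ) (G ξ))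
    (k := fun ξ => (starRingEnd ℂ) (Complex.I * t / ξ ^ 2 * G ξ + W ξ))
    hab hi ?_ (fun y hy => P.sub_eq a y ha hy.1) (fun y hy => by
      rw [hconj, ← P.sub_eq a y ha hy.1, map_sub])
  · have e : |‖G b‖ ^ 2 - ‖G a‖ ^ 2| = ‖G b * (starRingEnd ℂ) (G b) - G a * (starRingEnd ℂ) (G a)‖ := by
      rw [Complex.mul_conj, Complex.mul_conj, Complex.normSq_eq_norm_sq, Complex.normSq_eq_norm_sq,
        ← Complex.ofReal_sub, Complex.norm_real, Real.norm_eq_abs]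
    rw [e, key, intervalIntegral.integral_of_le hab, ← integral_const_mul]
    have hint : IntegrableOn (fun ξ => ‖W ξ‖ * ‖G ξ‖) (Ioc a b) := by
      simpa using P.integrableOn_norm_W_mul (a := a) (b := b) (h := fun ξ => ‖G ξ‖)
        P.cont.norm.continuousOn
    refine norm_integral_le_of_norm_le (hint.const_mul 2) (Filter.Eventually.of_forall fun ξ => ?_)
    have : (Complex.I * t / ξ ^ 2 * G ξ + W ξ) * (starRingEnd ℂ) (G ξ) +
        G ξ * (starRingEnd ℂ) (Complex.I * t / ξ ^ 2 * G ξ + W ξ) =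
        W ξ * (starRingEnd ℂ) (G ξ) + G ξ * (starRingEnd ℂ) (W ξ) := by
      simp only [map_add, map_mul, map_div₀, map_pow, Complex.conj_I, Complex.conj_ofReal]
      ring
    rw [this]
    refine (norm_add_le _ _).trans (le_of_eq ?_)
    simp only [norm_mul, RCLike.norm_conj]
    ring
  · rw [intervalIntegrable_iff_integrableOn_Ioc_of_le hab] at hi ⊢
    exact (integrable_norm_iff (Complex.continuous_conj.comp_aestronglyMeasurable hi.1)).1
      (by simp only [RCLike.norm_conj]; exact hi.norm)

end Profile

/-! ### Size of the profile at a dyadic frequency -/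

/-- The size of `‖G‖_{L²}` at frequency `N` for a normalized profile. -/
def scaleBound (s N : ℝ) : ℝ := min (N ^ 2) (N ^ (1 - s))

lemma scaleBound_pos {s N : ℝ} (hN : 0 < N) : 0 < scaleBound s N :=
  lt_min (by positivity) (by positivity)

/-- The branch `N²` serves for `N ≤ 1` and the branch `N^{1-s}` for `N ≥ 1`. This is what allows one
factor `β` to be traded for the length of the frequency block. -/
lemma scaleBound_le_self {s N : ℝ} (hs : 0 ≤ s) (hN : 0 < N) : scaleBound s N ≤ N := by
  rcases le_total N 1 with h | h
  · exact (min_le_left _ _).trans (by nlinarith)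
  · refine (min_le_right _ _).trans ?_
    calc N ^ (1 - s) ≤ N ^ (1 : ℝ) := Real.rpow_le_rpow_of_exponent_le h (by linarith)
      _ = N := Real.rpow_one N

/-- The ratio `2^δ` of consecutive dyadic scales. -/
def κ : ℝ := (2 : ℝ) ^ δ

lemma one_lt_κ : 1 < κ := Real.one_lt_rpow (by norm_num) (by norm_num [δ])

lemma κ_pos : 0 < κ := zero_lt_one.trans one_lt_κ

/-- Bernoulli's inequality for `(1 + 1/10)^1000`. The bound is crude, but enough to keep a dyadic
block between `10/11 N` and `11/10 N`. -/
lemma κ_le : κ ≤ 11 / 10 := by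
  have h : (2 : ℝ) ≤ (11 / 10 : ℝ) ^ (1000 : ℝ) := by
    rw [show (1000 : ℝ) = ((1000 : ℕ) : ℝ) by norm_num, Real.rpow_natCast]
    rw [show (11 / 10 : ℝ) = 1 + 1 / 10 by norm_num]
    refine le_trans ?_ (one_add_mul_le_pow (by norm_num) 1000)
    norm_num
  calc κ ≤ ((11 / 10 : ℝ) ^ (1000 : ℝ)) ^ (1 / 1000 : ℝ) :=
        Real.rpow_le_rpow (by norm_num) h (by norm_num [δ])
    _ = 11 / 10 := by rw [← Real.rpow_mul (by norm_num)]; norm_num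

lemma inv_κ_ge : 10 / 11 ≤ κ⁻¹ := by
  rw [le_inv_comm₀ (by norm_num) κ_pos]
  exact κ_le.trans (by norm_num)

lemma inv_κ_lt_κ : κ⁻¹ < κ := (inv_lt_one_of_one_lt₀ one_lt_κ).trans one_lt_κ

/-- The constant in the localized bounds for a profile. -/
def profileConst (s : ℝ) : ℝ := 4 * 2 ^ s

lemma four_le_profileConst {s : ℝ} (hs : 0 ≤ s) : 4 ≤ profileConst s := by
  have : (1 : ℝ) ≤ 2 ^ s := Real.one_le_rpow (by norm_num) hs
  rw [profileConst]; linarith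

namespace Profile

variable {s t A : ℝ} {G W : ℝ → ℂ}

/-- The `Ḣ^{-1}` norm gives the branch `N²` and the `H^s` norm the branch `N^{1-s}`; both hold at
every `N`. On `(N/2, 2N]` the weights cost `4` and `2^s` respectively, whence the product in
`profileConst`. -/
lemma integral_norm_sq_le (P : Profile s t A G W) (hs : 1 ≤ s) {N : ℝ}
    (hN : 0 < N) :
    ∫ ξ in Ioc (N / 2) (2 * N), ‖G ξ‖ ^ 2 ≤ (profileConst s * A * scaleBound s N) ^ 2 := by
  have hi : IntegrableOn (fun ξ => ‖G ξ‖ ^ 2) (Ioc (N / 2) (2 * N)) :=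
    (P.cont.norm.pow 2).continuousOn.integrableOn_Icc.mono_set Ioc_subset_Icc_self
  have hA2 : 0 ≤ A ^ 2 := sq_nonneg A
  have h2s : (1 : ℝ) ≤ 2 ^ s := Real.one_le_rpow (by norm_num) (by linarith)
  have h1 : ∫ ξ in Ioc (N / 2) (2 * N), ‖G ξ‖ ^ 2 ≤ 16 * N ^ 4 * A ^ 2 := by
    calc ∫ ξ in Ioc (N / 2) (2 * N), ‖G ξ‖ ^ 2
        ≤ ∫ ξ in Ioc (N / 2) (2 * N), 16 * N ^ 4 * (‖G ξ‖ ^ 2 / ξ ^ 4) := by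
          refine setIntegral_mono_on hi (P.integrable_low.integrableOn.const_mul _)
            measurableSet_Ioc fun ξ hξ => ?_
          have hξ0 : 0 < ξ := lt_trans (by positivity) hξ.1
          have : ξ ^ 4 ≤ 16 * N ^ 4 := by
            calc ξ ^ 4 ≤ (2 * N) ^ 4 := by gcongr; exact hξ.2
              _ = _ := by ring
          rw [mul_div_assoc', le_div_iff₀ (by positivity), mul_comm]
          gcongr
      _ ≤ 16 * N ^ 4 * ∫ ξ, (‖G ξ‖ ^ 2 / ξ ^ 4) := by
          rw [integral_const_mul]
          exact mul_le_mul_of_nonneg_left (setIntegral_le_integral P.integrable_low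
            (Filter.Eventually.of_forall fun ξ => by positivity)) (by positivity)
      _ ≤ _ := by gcongr; exact P.low
  have h2 : ∫ ξ in Ioc (N / 2) (2 * N), ‖G ξ‖ ^ 2 ≤ (2 ^ s * N ^ (1 - s) * A) ^ 2 := by
    have e : (N / 2) ^ (2 - 2 * s) ≤ (2 ^ s * N ^ (1 - s)) ^ 2 := by
      rw [Real.div_rpow hN.le (by norm_num), mul_pow, ← Real.rpow_natCast (N ^ (1 - s)),
        ← Real.rpow_mul hN.le, ← Real.rpow_natCast (2 ^ s), ← Real.rpow_mul (by norm_num),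
        div_eq_mul_inv, ← Real.rpow_neg (by norm_num), mul_comm]
      push_cast
      rw [show (1 - s) * 2 = 2 - 2 * s by ring]
      gcongr <;> linarith
    calc ∫ ξ in Ioc (N / 2) (2 * N), ‖G ξ‖ ^ 2
        ≤ ∫ ξ in Ioc (N / 2) (2 * N), (2 ^ s * N ^ (1 - s)) ^ 2 *
            (|ξ| ^ (2 * s - 2) * ‖G ξ‖ ^ 2) := by
          refine setIntegral_mono_on hi (P.integrable_high.integrableOn.const_mul _)
            measurableSet_Ioc fun ξ hξ => ?_
          have hξ0 : 0 < ξ := lt_trans (by positivity) hξ.1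
          have h3 : 1 ≤ (N / 2) ^ (2 - 2 * s) * ξ ^ (2 * s - 2) := by
            rw [show 2 - 2 * s = -(2 * s - 2) by ring, Real.rpow_neg (by positivity),
              ← Real.inv_rpow (by positivity), ← Real.mul_rpow (by positivity) hξ0.le]
            refine Real.one_le_rpow ?_ (by linarith)
            rw [inv_mul_eq_div, le_div_iff₀ (by positivity), one_mul]
            exact hξ.1.le
          rw [abs_of_pos hξ0, ← mul_assoc]
          refine le_mul_of_one_le_left (by positivity) (h3.trans ?_)
          gcongr
      _ ≤ (2 ^ s * N ^ (1 - s)) ^ 2 * ∫ ξ, (|ξ| ^ (2 * s - 2) * ‖G ξ‖ ^ 2) := by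
          rw [integral_const_mul]
          exact mul_le_mul_of_nonneg_left (setIntegral_le_integral P.integrable_high
            (Filter.Eventually.of_forall fun ξ => by positivity)) (by positivity)
      _ ≤ _ := by rw [mul_pow (2 ^ s * N ^ (1 - s))]; gcongr; exact P.high
  rw [scaleBound, profileConst]
  rcases min_choice (N ^ 2) (N ^ (1 - s)) with h | h
  · rw [h]
    refine h1.trans ?_
    calc 16 * N ^ 4 * A ^ 2 = 1 ^ 2 * (16 * N ^ 4 * A ^ 2) := by ring
      _ ≤ (2 ^ s) ^ 2 * (16 * N ^ 4 * A ^ 2) := by gcongr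
      _ = _ := by ring
  · rw [h]
    refine h2.trans ?_
    have : 0 ≤ (2 ^ s * N ^ (1 - s) * A) ^ 2 := sq_nonneg _
    calc _ ≤ 16 * (2 ^ s * N ^ (1 - s) * A) ^ 2 := by linarith
      _ = _ := by ring

lemma integral_W_mul_le (P : Profile s t A G W) (hA : 0 ≤ A) {a b : ℝ} {h : ℝ → ℝ}
    (hc : ContinuousOn h (Icc a b)) :
    ∫ ξ in Ioc a b, ‖W ξ‖ * |h ξ| ≤ A * √(∫ ξ in Ioc a b, h ξ ^ 2) := by
  have hm : MemLp h 2 ((volume : Measure ℝ).restrict (Ioc a b)) := by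
    have := (memLp_two_iff_integrable_sq (hc.aestronglyMeasurable measurableSet_Icc)).2
      ((hc.pow 2).integrableOn_Icc (μ := volume))
    exact this.mono_measure (Measure.restrict_mono Ioc_subset_Icc_self le_rfl)
  refine (integral_norm_mul_norm_le (P.memLp_W.restrict _) hm).trans ?_
  simp only [Real.norm_eq_abs, sq_abs]
  gcongr
  refine Real.sqrt_le_iff.2 ⟨hA, le_trans ?_ P.integral_W_le⟩
  exact setIntegral_le_integral ((memLp_two_iff_integrable_sq_norm P.memLp_W.1).1 P.memLp_W)
    (Filter.Eventually.of_forall fun ξ => by positivity)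

lemma integral_G_mul_le (P : Profile s t A G W) (hs : 1 ≤ s) (hA : 0 ≤ A) {N : ℝ} (hN : 0 < N)
    {a b : ℝ} (ha : N / 2 ≤ a) (hb : b ≤ 2 * N) {h : ℝ → ℝ} (hc : ContinuousOn h (Icc a b)) :
    ∫ ξ in Ioc a b, ‖G ξ‖ * |h ξ| ≤
      profileConst s * A * scaleBound s N * √(∫ ξ in Ioc a b, h ξ ^ 2) := by
  have mem : ∀ {E : Type} [NormedAddCommGroup E] (f : ℝ → E), ContinuousOn f (Icc a b) →
      MemLp f 2 ((volume : Measure ℝ).restrict (Ioc a b)) := by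
    intro E _ f hf
    have := (memLp_two_iff_integrable_sq_norm (hf.aestronglyMeasurable measurableSet_Icc)).2
      ((hf.norm.pow 2).integrableOn_Icc (μ := volume))
    exact this.mono_measure (Measure.restrict_mono Ioc_subset_Icc_self le_rfl)
  refine (integral_norm_mul_norm_le (mem G P.cont.continuousOn) (mem h hc)).trans ?_
  simp only [Real.norm_eq_abs, sq_abs]
  gcongr
  have hpos := scaleBound_pos (s := s) hN
  have hC := four_le_profileConst (s := s) (by linarith)
  refine Real.sqrt_le_iff.2 ⟨by positivity, le_trans ?_ (P.integral_norm_sq_le hs hN)⟩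
  refine setIntegral_mono_set ?_ (Filter.Eventually.of_forall fun ξ => by positivity)
    (LE.le.eventuallyLE (Ioc_subset_Ioc ha hb))
  exact (P.cont.norm.pow 2).continuousOn.integrableOn_Icc.mono_set Ioc_subset_Icc_self

/-- The pointwise bound for the profile. -/
lemma norm_sq_le (P : Profile s t A G W) (hs : 1 ≤ s) (hA : 0 ≤ A) {N : ℝ} (hN : 0 < N) {ξ : ℝ}
    (hξ : ξ ∈ Icc (N / 2) (2 * N)) :
    ‖G ξ‖ ^ 2 ≤ 2 * profileConst s ^ 2 * A ^ 2 * scaleBound s N := by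
  set C := profileConst s
  set β := scaleBound s N
  have hβ : 0 < β := scaleBound_pos hN
  have hβN : β ≤ N := scaleBound_le_self (by linarith) hN
  have hC : 4 ≤ C := four_le_profileConst (by linarith)
  have hWG : IntegrableOn (fun ξ => ‖W ξ‖ * ‖G ξ‖) (Ioc (N / 2) (2 * N)) := by
    simpa using P.integrableOn_norm_W_mul (h := fun ξ => ‖G ξ‖) P.cont.norm.continuousOn
  have hG2 : IntegrableOn (fun ξ => ‖G ξ‖ ^ 2) (Ioc (N / 2) (2 * N)) :=
    (P.cont.norm.pow 2).continuousOn.integrableOn_Icc.mono_set Ioc_subset_Icc_self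
  have hJ : ∫ ζ in Ioc (N / 2) (2 * N), ‖W ζ‖ * ‖G ζ‖ ≤ C * A ^ 2 * β := by
    have h1 := P.integral_W_mul_le hA (a := N / 2) (b := 2 * N) (h := fun ξ => ‖G ξ‖)
      P.cont.norm.continuousOn
    simp only [abs_norm] at h1
    refine h1.trans ?_
    calc A * √(∫ ξ in Ioc (N / 2) (2 * N), ‖G ξ‖ ^ 2) ≤ A * (C * A * β) := by
          gcongr
          exact Real.sqrt_le_iff.2 ⟨by positivity, P.integral_norm_sq_le hs hN⟩
      _ = _ := by ring
  -- Within the block `|G|²` varies by at most `2 ∫ |W| |G|`. Averaging over the comparison point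
  -- `a` then replaces the unknown value `|G a|²` by the `L²` bound.
  have hsub : ∀ a ∈ Ioc (N / 2) (2 * N), ‖G ξ‖ ^ 2 ≤ ‖G a‖ ^ 2 + 2 * (C * A ^ 2 * β) := by
    intro a ha
    have mono : ∀ c d, N / 2 ≤ c → d ≤ 2 * N → ∫ ζ in Ioc c d, ‖W ζ‖ * ‖G ζ‖ ≤ C * A ^ 2 * β :=
      fun c d hc hd => (setIntegral_mono_set hWG
        (Filter.Eventually.of_forall fun ξ => by positivity)
        (LE.le.eventuallyLE (Ioc_subset_Ioc hc hd))).trans hJ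
    rcases le_total a ξ with h | h
    · have h1 := P.norm_sq_sub_le (lt_trans (by positivity) ha.1) h
      have h2 := mono a ξ ha.1.le hξ.2
      have h3 := (abs_le.1 h1).2
      linarith
    · have h1 := P.norm_sq_sub_le (lt_of_lt_of_le (by positivity) hξ.1) h
      have h2 := mono ξ a hξ.1 ha.2
      have h3 := (abs_le.1 h1).1
      linarith
  have hconst : ∀ c : ℝ, IntegrableOn (fun _ => c) (Ioc (N / 2) (2 * N)) := fun c =>
    continuousOn_const.integrableOn_Icc.mono_set Ioc_subset_Icc_self
  have hint := setIntegral_mono_on (μ := volume) (f := fun _ : ℝ => ‖G ξ‖ ^ 2)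
    (g := fun a => ‖G a‖ ^ 2 + 2 * (C * A ^ 2 * β)) (hconst _) (hG2.add (hconst _))
    measurableSet_Ioc hsub
  rw [integral_add hG2 (hconst _)] at hint
  simp only [setIntegral_const, smul_eq_mul, Real.volume_real_Ioc_of_le (by linarith : N / 2 ≤ 2 * N)]
    at hint
  have h4 := P.integral_norm_sq_le hs hN
  -- The `L²` bound is of order `β²`; `β ≤ N` turns it into `β N`, and division by the block length
  -- `3N/2` leaves `β`.
  have h5 : (C * A * β) ^ 2 ≤ C ^ 2 * A ^ 2 * β * N := by
    calc (C * A * β) ^ 2 = C ^ 2 * A ^ 2 * β * β := by ring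
      _ ≤ _ := by gcongr
  have h6 : C * A ^ 2 * β ≤ C ^ 2 * A ^ 2 * β / 4 := by
    have : 0 ≤ A ^ 2 * β := by positivity
    nlinarith [mul_nonneg this (mul_nonneg (by linarith : 0 ≤ C) (by linarith : 0 ≤ C - 4))]
  have h7 : (2 * N - N / 2) * ‖G ξ‖ ^ 2 ≤
      (2 * N - N / 2) * (2 * C ^ 2 * A ^ 2 * β) := by
    have h8 : (2 * N - N / 2) * (2 * (C * A ^ 2 * β)) ≤
        (2 * N - N / 2) * (2 * (C ^ 2 * A ^ 2 * β / 4)) :=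
      mul_le_mul_of_nonneg_left (by linarith) (by linarith)
    have h9 : 0 ≤ C ^ 2 * A ^ 2 * β * N := by positivity
    nlinarith
  exact le_of_mul_le_mul_left h7 (by linarith)

end Profile

/-! ### Frequency-localized oscillatory integrals -/

/-- A `C¹` amplitude `ρ` supported in `[2^{-δ}, 2^δ]`. -/
structure Amplitude (ρ ρ' : ℝ → ℝ) (K : ℝ) : Prop where
  hasDerivAt : ∀ η, HasDerivAt ρ (ρ' η) η
  cont : Continuous ρ'
  eq_zero_left : ∀ η ≤ κ⁻¹, ρ η = 0
  eq_zero_right : ∀ η, κ ≤ η → ρ η = 0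
  abs_le : ∀ η, |ρ η| ≤ K
  abs_deriv_le : ∀ η, |ρ' η| ≤ K

/-- The oscillatory integral `∫ e^{ixξ} ρ(ξ/N) G(ξ) dξ`. -/
def osc (G : ℝ → ℂ) (ρ : ℝ → ℝ) (N x : ℝ) : ℂ :=
  ∫ ξ in (κ⁻¹ * N)..(κ * N), Complex.exp (Complex.I * x * ξ) * ((ρ (ξ / N) : ℝ) * G ξ)

lemma scale_facts {N : ℝ} (hN : 0 < N) :
    0 < κ⁻¹ * N ∧ κ⁻¹ * N ≤ κ * N ∧ N / 2 ≤ κ⁻¹ * N ∧ κ * N ≤ 2 * N ∧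
      10 / 11 * N ≤ κ⁻¹ * N ∧ κ * N ≤ 11 / 10 * N ∧ κ * N - κ⁻¹ * N ≤ N := by
  have h1 := inv_κ_ge
  have h2 := κ_le
  have h3 := one_lt_κ
  have h4 := inv_κ_lt_κ
  refine ⟨by positivity, ?_, ?_, ?_, ?_, ?_, ?_⟩ <;> nlinarith

namespace Profile

variable {s t A K : ℝ} {G W : ℝ → ℂ} {ρ ρ' : ℝ → ℝ}

lemma integral_G_le (P : Profile s t A G W) (hs : 1 ≤ s) (hA : 0 ≤ A) {N : ℝ} (hN : 0 < N) :
    ∫ ξ in Ioc (κ⁻¹ * N) (κ * N), ‖G ξ‖ ≤ profileConst s * A * scaleBound s N * √N := by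
  obtain ⟨h0, h1, h2, h3, h4, h5, h6⟩ := scale_facts hN
  have := P.integral_G_mul_le hs hA hN h2 h3 (h := fun _ => 1) continuousOn_const
  simp only [abs_one, mul_one, one_pow, setIntegral_const, smul_eq_mul,
    Real.volume_real_Ioc_of_le h1] at this
  refine this.trans ?_
  have hC := four_le_profileConst (s := s) (by linarith)
  have := scaleBound_pos (s := s) hN
  gcongr

/-- The trivial bound for a frequency localized piece. -/
lemma norm_osc_le (P : Profile s t A G W) (R : Amplitude ρ ρ' K) (hs : 1 ≤ s) (hA : 0 ≤ A)
    {N : ℝ} (hN : 0 < N) (x : ℝ) :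
    ‖osc G ρ N x‖ ≤ profileConst s * K * A * (scaleBound s N * √N) := by
  obtain ⟨h0, h1, h2, h3, h4, h5, h6⟩ := scale_facts hN
  have hK : 0 ≤ K := (abs_nonneg _).trans (R.abs_le 0)
  have hi : IntegrableOn (fun ξ => ‖G ξ‖) (Ioc (κ⁻¹ * N) (κ * N)) :=
    P.cont.norm.continuousOn.integrableOn_Icc.mono_set Ioc_subset_Icc_self
  rw [osc, intervalIntegral.integral_of_le h1]
  calc _ ≤ ∫ ξ in Ioc (κ⁻¹ * N) (κ * N), K * ‖G ξ‖ := by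
        refine norm_integral_le_of_norm_le (hi.const_mul K) (Filter.Eventually.of_forall fun ξ => ?_)
        rw [norm_mul, norm_exp_I_mul, one_mul, norm_mul, Complex.norm_real, Real.norm_eq_abs]
        gcongr
        exact R.abs_le _
    _ ≤ K * (profileConst s * A * scaleBound s N * √N) := by
        rw [integral_const_mul]
        gcongr
        exact P.integral_G_le hs hA hN
    _ = _ := by ring

end Profile

/-- The primitive is an arctangent, so the total mass is at most `π/d`. The independence from `a`
and `b` is what the splitting near a stationary point requires. -/
lemma setIntegral_inv_sq_add_sq_le {a b d : ℝ} (ξ₀ : ℝ) (hab : a ≤ b) (hd : 0 < d) :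
    ∫ ξ in Ioc a b, (d ^ 2 + (ξ - ξ₀) ^ 2)⁻¹ ≤ 4 / d := by
  have hder : ∀ ξ ∈ uIcc a b, HasDerivAt (fun ξ => Real.arctan ((ξ - ξ₀) / d) / d)
      (d ^ 2 + (ξ - ξ₀) ^ 2)⁻¹ ξ := by
    intro ξ _
    have h1 : HasDerivAt (fun ξ => (ξ - ξ₀) / d) (1 / d) ξ :=
      ((hasDerivAt_id ξ).sub_const ξ₀).div_const d
    refine (h1.arctan.div_const d).congr_deriv ?_
    have : d ^ 2 + (ξ - ξ₀) ^ 2 ≠ 0 := by positivity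
    field_simp
  have hc : Continuous fun ξ => (d ^ 2 + (ξ - ξ₀) ^ 2)⁻¹ :=
    Continuous.inv₀ (by fun_prop) fun ξ => by positivity
  rw [← intervalIntegral.integral_of_le hab,
    intervalIntegral.integral_eq_sub_of_hasDerivAt hder (hc.intervalIntegrable _ _), ← sub_div]
  gcongr
  linarith [Real.arctan_lt_pi_div_two ((b - ξ₀) / d), Real.neg_pi_div_two_lt_arctan ((a - ξ₀) / d),
    Real.pi_lt_four]

namespace Amplitude

variable {ρ ρ' : ℝ → ℝ} {K : ℝ}

lemma nonneg (R : Amplitude ρ ρ' K) : 0 ≤ K := (abs_nonneg _).trans (R.abs_le 0)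

lemma continuous (R : Amplitude ρ ρ' K) : Continuous ρ :=
  continuous_iff_continuousAt.2 fun η => (R.hasDerivAt η).continuousAt

lemma hasDerivAt_scale (R : Amplitude ρ ρ' K) (N ξ : ℝ) :
    HasDerivAt (fun ξ => ρ (ξ / N)) (ρ' (ξ / N) / N) ξ := by
  have := (R.hasDerivAt (ξ / N)).comp ξ ((hasDerivAt_id ξ).div_const N)
  exact this.congr_deriv (by simp [div_eq_mul_inv])

lemma left_eq_zero (R : Amplitude ρ ρ' K) {N : ℝ} (hN : 0 < N) : ρ (κ⁻¹ * N / N) = 0 :=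
  R.eq_zero_left _ (by rw [mul_div_cancel_right₀ _ hN.ne'])

lemma right_eq_zero (R : Amplitude ρ ρ' K) {N : ℝ} (hN : 0 < N) : ρ (κ * N / N) = 0 :=
  R.eq_zero_right _ (by rw [mul_div_cancel_right₀ _ hN.ne'])

end Amplitude

namespace Profile

variable {s t A K : ℝ} {G W : ℝ → ℂ} {ρ ρ' : ℝ → ℝ}

/-- The bound for a frequency localized piece away from the stationary points of the phase. -/
lemma norm_osc_le_of_nonresonant (P : Profile s t A G W) (R : Amplitude ρ ρ' K) (hs : 1 ≤ s)
    (hA : 0 ≤ A) (ht : 0 < t) {N : ℝ} (hN : 0 < N) {x : ℝ}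
    (hx : ∀ ξ ∈ Icc (κ⁻¹ * N) (κ * N), t / (4 * N ^ 2) ≤ |x + t / ξ ^ 2|) :
    ‖osc G ρ N x‖ ≤ 51 * profileConst s * K * A * (N ^ 2 * √N / t) := by
  obtain ⟨h0, h1, h2, h3, h4, h5, h6⟩ := scale_facts hN
  have hK := R.nonneg
  have hC := four_le_profileConst (s := s) (by linarith)
  set C := profileConst s
  have hφ : ∀ ξ ∈ Icc (κ⁻¹ * N) (κ * N), x + t / ξ ^ 2 ≠ 0 := fun ξ hξ h => by
    have := hx ξ hξ
    rw [h, abs_zero] at this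
    exact absurd this (not_le.2 (by positivity))
  -- Dividing the amplitude by the phase derivative makes `norm_integral_phase_le` apply to the
  -- whole integral.
  set h : ℝ → ℝ := fun ξ => ρ (ξ / N) / (x + t / ξ ^ 2)
  set h' : ℝ → ℝ := fun ξ => (ρ' (ξ / N) / N * (x + t / ξ ^ 2) - ρ (ξ / N) * (-(t * (2 * ξ)) /
    (ξ ^ 2) ^ 2)) / (x + t / ξ ^ 2) ^ 2
  have hpos : ∀ ξ ∈ Icc (κ⁻¹ * N) (κ * N), 0 < ξ := fun ξ hξ => h0.trans_le hξ.1
  have hd : ∀ ξ ∈ Icc (κ⁻¹ * N) (κ * N), HasDerivAt h (h' ξ) ξ := by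
    intro ξ hξ
    have hξ0 := hpos ξ hξ
    have e1 : HasDerivAt (fun ξ => x + t / ξ ^ 2) (-(t * (2 * ξ)) / (ξ ^ 2) ^ 2) ξ := by
      refine (((hasDerivAt_const ξ t).div (hasDerivAt_pow 2 ξ) (by positivity)).const_add
        x).congr_deriv ?_
      simp
    exact (R.hasDerivAt_scale N ξ).div e1 (hφ ξ hξ)
  have hc' : ContinuousOn h' (Icc (κ⁻¹ * N) (κ * N)) := by
    have c1 := R.continuous
    have c2 := R.cont
    have c3 : ContinuousOn (fun ξ : ℝ => x + t / ξ ^ 2) (Icc (κ⁻¹ * N) (κ * N)) :=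
      continuousOn_const.add (continuousOn_const.div (by fun_prop)
        fun ξ hξ => pow_ne_zero 2 (hpos ξ hξ).ne')
    refine ContinuousOn.div (ContinuousOn.sub (ContinuousOn.mul (by fun_prop) c3)
      (ContinuousOn.mul (by fun_prop) (ContinuousOn.div (by fun_prop) (by fun_prop)
        fun ξ hξ => ?_))) (c3.pow 2) fun ξ hξ => pow_ne_zero 2 (hφ ξ hξ)
    have := hpos ξ hξ
    positivity
  have hc : ContinuousOn h (Icc (κ⁻¹ * N) (κ * N)) :=
    fun ξ hξ => (hd ξ hξ).continuousAt.continuousWithinAt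
  have key := P.norm_integral_phase_le h0 h1 x hd hc' (by simp [h, R.left_eq_zero hN])
    (by simp [h, R.right_eq_zero hN])
  have e : osc G ρ N x = ∫ ξ in (κ⁻¹ * N)..(κ * N),
      Complex.exp (Complex.I * x * ξ) * (((x + t / ξ ^ 2) * h ξ : ℝ) * G ξ) := by
    refine intervalIntegral.integral_congr fun ξ hξ => ?_
    rw [uIcc_of_le h1] at hξ
    simp only [h]
    rw [mul_div_cancel₀ _ (hφ ξ hξ)]
  have binv : ∀ ξ ∈ Icc (κ⁻¹ * N) (κ * N), |x + t / ξ ^ 2|⁻¹ ≤ 4 * N ^ 2 / t := fun ξ hξ => by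
    rw [inv_le_comm₀ (abs_pos.2 (hφ ξ hξ)) (by positivity), inv_div]
    exact hx ξ hξ
  have b1 : ∀ ξ ∈ Icc (κ⁻¹ * N) (κ * N), |h ξ| ≤ K * (4 * N ^ 2 / t) := fun ξ hξ => by
    rw [abs_div, div_eq_mul_inv]
    gcongr
    · exact R.abs_le _
    · exact binv ξ hξ
  have b2 : ∀ ξ ∈ Icc (κ⁻¹ * N) (κ * N), |h' ξ| ≤ 50 * K * N / t := fun ξ hξ => by
    have hξ0 := hpos ξ hξ
    have e2 : h' ξ = ρ' (ξ / N) / N * (x + t / ξ ^ 2)⁻¹ +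
        ρ (ξ / N) * (2 * t * (ξ⁻¹) ^ 3) * ((x + t / ξ ^ 2)⁻¹) ^ 2 := by
      have := hφ ξ hξ
      simp only [h']
      generalize x + t / ξ ^ 2 = φ at *
      field_simp
      ring
    have e3 : ξ⁻¹ ≤ 11 / 10 * N⁻¹ := by
      rw [inv_le_comm₀ hξ0 (by positivity), mul_inv, inv_inv]
      have := hξ.1
      norm_num
      linarith
    rw [e2]
    refine (abs_add_le _ _).trans ?_
    rw [abs_mul, abs_mul, abs_mul, abs_div, abs_inv, abs_pow, abs_inv, abs_of_pos hN,
      abs_of_pos (by positivity : 0 < 2 * t * (ξ⁻¹) ^ 3)]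
    calc _ ≤ K / N * (4 * N ^ 2 / t) + K * (2 * t * (11 / 10 * N⁻¹) ^ 3) * (4 * N ^ 2 / t) ^ 2 := by
          have := binv ξ hξ
          have := R.abs_le (ξ / N)
          have := R.abs_deriv_le (ξ / N)
          gcongr
      _ = (4 + 2 * (11 / 10) ^ 3 * 16) * (K * N / t) := by field_simp; ring
      _ ≤ 50 * (K * N / t) := by gcongr; norm_num
      _ = _ := by ring
  rw [e]
  refine key.trans ?_
  rw [integral_add (P.integrableOn_norm_W_mul hc) (P.integrableOn_norm_G_mul hc')]
  have i1 : ∫ ξ in Ioc (κ⁻¹ * N) (κ * N), ‖W ξ‖ * |h ξ| ≤ A * (K * (4 * N ^ 2 / t) * √N) := by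
    refine (P.integral_W_mul_le hA hc).trans ?_
    gcongr
    refine Real.sqrt_le_iff.2 ⟨by positivity, ?_⟩
    calc ∫ ξ in Ioc (κ⁻¹ * N) (κ * N), h ξ ^ 2
        ≤ ∫ ξ in Ioc (κ⁻¹ * N) (κ * N), (K * (4 * N ^ 2 / t)) ^ 2 := by
          refine setIntegral_mono_on ((hc.pow 2).integrableOn_Icc.mono_set Ioc_subset_Icc_self)
            (continuousOn_const.integrableOn_Icc.mono_set Ioc_subset_Icc_self) measurableSet_Ioc
            fun ξ hξ => ?_
          rw [← sq_abs]
          gcongr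
          exact b1 ξ (Ioc_subset_Icc_self hξ)
      _ = (κ * N - κ⁻¹ * N) * (K * (4 * N ^ 2 / t)) ^ 2 := by
          rw [setIntegral_const, smul_eq_mul, Real.volume_real_Ioc_of_le h1]
      _ ≤ N * (K * (4 * N ^ 2 / t)) ^ 2 := by gcongr
      _ = _ := by rw [mul_pow _ √N, Real.sq_sqrt hN.le]; ring
  -- Here `β` is only used through `β ≤ N`, which brings this term to the same size `N² √N / t` as
  -- the one with `W`.
  have i2 : ∫ ξ in Ioc (κ⁻¹ * N) (κ * N), ‖G ξ‖ * |h' ξ| ≤ 50 * K * N / t * (C * A * N * √N) := by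
    calc _ ≤ ∫ ξ in Ioc (κ⁻¹ * N) (κ * N), 50 * K * N / t * ‖G ξ‖ := by
          refine setIntegral_mono_on (P.integrableOn_norm_G_mul hc')
            ((P.cont.norm.continuousOn.integrableOn_Icc.mono_set Ioc_subset_Icc_self).const_mul _)
            measurableSet_Ioc fun ξ hξ => ?_
          rw [mul_comm]
          gcongr
          exact b2 ξ (Ioc_subset_Icc_self hξ)
      _ ≤ _ := by
          rw [integral_const_mul]
          refine mul_le_mul_of_nonneg_left ((P.integral_G_le hs hA hN).trans ?_) (by positivity)
          gcongr
          exact scaleBound_le_self (by linarith) hN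
  calc _ ≤ A * (K * (4 * N ^ 2 / t) * √N) + 50 * K * N / t * (C * A * N * √N) := add_le_add i1 i2
    _ = (4 + 50 * C) * (K * A * (N ^ 2 * √N / t)) := by ring
    _ ≤ (51 * C) * (K * A * (N ^ 2 * √N / t)) := by gcongr; linarith
    _ = _ := by ring

lemma norm_le (P : Profile s t A G W) (hs : 1 ≤ s) (hA : 0 ≤ A) {N : ℝ} (hN : 0 < N) {ξ : ℝ}
    (hξ : ξ ∈ Icc (N / 2) (2 * N)) :
    ‖G ξ‖ ≤ 2 * profileConst s * A * √(scaleBound s N) := by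
  have hC := four_le_profileConst (s := s) (by linarith)
  have hβ := scaleBound_pos (s := s) hN
  refine abs_le_of_sq_le_sq' ?_ (by positivity) |>.2
  rw [mul_pow, Real.sq_sqrt hβ.le]
  refine (P.norm_sq_le hs hA hN hξ).trans ?_
  have : 0 ≤ profileConst s ^ 2 * A ^ 2 * scaleBound s N := by positivity
  linarith

/-- The stationary phase bound with a splitting at distance `d` from the stationary point. -/
lemma norm_osc_le_of_split (P : Profile s t A G W) (R : Amplitude ρ ρ' K) (hs : 1 ≤ s)
    (hA : 0 ≤ A) (ht : 0 < t) {N ξ₀ d : ℝ} (hN : 0 < N) (hξ₀ : ξ₀ ∈ Icc (N / 2) (2 * N))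
    (hd : 0 < d) :
    ‖osc G ρ N (-(t / ξ₀ ^ 2))‖ ≤ profileConst s * K * A * (10 * (N ^ 3 / t) / √d +
      184 * √(scaleBound s N) * (N ^ 3 / t) / d +
      min (8 * √(scaleBound s N) * d) (2 * scaleBound s N * √d)) := by
  obtain ⟨h0, h1, h2, h3, h4, h5, h6⟩ := scale_facts hN
  have hK := R.nonneg
  have hC := four_le_profileConst (s := s) (by linarith)
  have hβ := scaleBound_pos (s := s) hN
  have hGle : ∀ ξ ∈ Icc (κ⁻¹ * N) (κ * N), ‖G ξ‖ ≤ 2 * profileConst s * A * √(scaleBound s N) :=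
    fun ξ hξ => P.norm_le hs hA hN ⟨h2.trans hξ.1, hξ.2.trans h3⟩
  have hIGle : ∀ h : ℝ → ℝ, ContinuousOn h (Icc (κ⁻¹ * N) (κ * N)) →
      ∫ ξ in Ioc (κ⁻¹ * N) (κ * N), ‖G ξ‖ * |h ξ| ≤
      profileConst s * A * scaleBound s N * √(∫ ξ in Ioc (κ⁻¹ * N) (κ * N), h ξ ^ 2) :=
    fun h hc => P.integral_G_mul_le hs hA hN h2 h3 hc
  set C := profileConst s
  set β := scaleBound s N
  have hξ₀p : 0 < ξ₀ := lt_of_lt_of_le (by positivity) hξ₀.1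
  -- A smooth substitute for cutting at `|ξ - ξ₀| = d`: `1 = d² k + (ξ - ξ₀)² k`, where the first
  -- part is concentrated near the stationary point and the second can be divided by the phase
  -- derivative.
  set k : ℝ → ℝ := fun ξ => (d ^ 2 + (ξ - ξ₀) ^ 2)⁻¹ with hk
  have hkpos : ∀ ξ, 0 < k ξ := fun ξ => by simp only [k]; positivity
  have hck : Continuous k := Continuous.inv₀ (by fun_prop) fun ξ => by positivity
  have hik : ∫ ξ in Ioc (κ⁻¹ * N) (κ * N), k ξ ≤ 4 / d := setIntegral_inv_sq_add_sq_le ξ₀ h1 hd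
  have hkI : IntegrableOn k (Ioc (κ⁻¹ * N) (κ * N)) :=
    hck.continuousOn.integrableOn_Icc.mono_set Ioc_subset_Icc_self
  have hk1 : ∀ ξ, d ^ 2 * k ξ + (ξ - ξ₀) ^ 2 * k ξ = 1 := fun ξ => by
    have : d ^ 2 + (ξ - ξ₀) ^ 2 ≠ 0 := by positivity
    simp only [k]; field_simp
  have hk2 : ∀ ξ, (ξ - ξ₀) ^ 2 * k ξ ≤ 1 := fun ξ => by
    have := mul_nonneg (sq_nonneg d) (hkpos ξ).le
    linarith [hk1 ξ]
  have hk3 : ∀ ξ, d ^ 2 * k ξ ≤ 1 := fun ξ => by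
    have := mul_nonneg (sq_nonneg (ξ - ξ₀)) (hkpos ξ).le
    linarith [hk1 ξ]
  have hpos : ∀ ξ ∈ Icc (κ⁻¹ * N) (κ * N), 0 < ξ := fun ξ hξ => h0.trans_le hξ.1
  -- At `x = -t/ξ₀²` the phase derivative factors as `-(ξ - ξ₀)/q`. Hence `h = -ρ q m`, with `m = (ξ
  -- - ξ₀) k`, satisfies `(x + t/ξ²) h = ρ (ξ - ξ₀)² k`.
  set q : ℝ → ℝ := fun ξ => ξ ^ 2 * (ξ₀ ^ 2 / t) / (ξ + ξ₀)
  set q' : ℝ → ℝ := fun ξ => ((2 * ξ) * (ξ₀ ^ 2 / t) * (ξ + ξ₀) - ξ ^ 2 * (ξ₀ ^ 2 / t) * 1) /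
    (ξ + ξ₀) ^ 2
  set m : ℝ → ℝ := fun ξ => (ξ - ξ₀) * k ξ
  set m' : ℝ → ℝ := fun ξ => 1 * k ξ + (ξ - ξ₀) * (-(2 * (ξ - ξ₀)) / (d ^ 2 + (ξ - ξ₀) ^ 2) ^ 2)
  have dq : ∀ ξ ∈ Icc (κ⁻¹ * N) (κ * N), HasDerivAt q (q' ξ) ξ := by
    intro ξ hξ
    have := hpos ξ hξ
    refine HasDerivAt.div ?_ ((hasDerivAt_id ξ).add_const ξ₀) (by positivity)
    refine ((hasDerivAt_pow 2 ξ).mul_const (ξ₀ ^ 2 / t)).congr_deriv ?_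
    simp
  have dm : ∀ ξ, HasDerivAt m (m' ξ) ξ := by
    intro ξ
    refine HasDerivAt.mul ((hasDerivAt_id ξ).sub_const ξ₀) ?_
    have : HasDerivAt (fun ξ => d ^ 2 + (ξ - ξ₀) ^ 2) (2 * (ξ - ξ₀)) ξ := by
      refine ((((hasDerivAt_id ξ).sub_const ξ₀).pow 2).const_add (d ^ 2)).congr_deriv ?_
      simp
    exact this.inv (by positivity)
  set h : ℝ → ℝ := fun ξ => -(ρ (ξ / N) * q ξ * m ξ)
  set h' : ℝ → ℝ := fun ξ => -((ρ' (ξ / N) / N * q ξ + ρ (ξ / N) * q' ξ) * m ξ +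
    ρ (ξ / N) * q ξ * m' ξ)
  have hd' : ∀ ξ ∈ Icc (κ⁻¹ * N) (κ * N), HasDerivAt h (h' ξ) ξ := fun ξ hξ =>
    (((R.hasDerivAt_scale N ξ).mul (dq ξ hξ)).mul (dm ξ)).neg
  have cq : ContinuousOn q (Icc (κ⁻¹ * N) (κ * N)) := fun ξ hξ =>
    (dq ξ hξ).continuousAt.continuousWithinAt
  have cm : Continuous m := by fun_prop
  have cq' : ContinuousOn q' (Icc (κ⁻¹ * N) (κ * N)) := by
    refine ContinuousOn.div (by fun_prop) (by fun_prop) fun ξ hξ => ?_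
    have := hpos ξ hξ
    positivity
  have cm' : Continuous m' := by
    refine Continuous.add (by fun_prop) (Continuous.mul (by fun_prop)
      (Continuous.div (by fun_prop) (by fun_prop) fun ξ => by positivity))
  have hc' : ContinuousOn h' (Icc (κ⁻¹ * N) (κ * N)) := by
    have c1 := R.continuous
    have c2 := R.cont
    refine ContinuousOn.neg (ContinuousOn.add (ContinuousOn.mul (ContinuousOn.add
      (ContinuousOn.mul (by fun_prop) cq) (ContinuousOn.mul (by fun_prop) cq')) cm.continuousOn)
      (ContinuousOn.mul (ContinuousOn.mul (by fun_prop) cq) cm'.continuousOn))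
  have hc : ContinuousOn h (Icc (κ⁻¹ * N) (κ * N)) :=
    fun ξ hξ => (hd' ξ hξ).continuousAt.continuousWithinAt
  have key := P.norm_integral_phase_le h0 h1 (-(t / ξ₀ ^ 2)) hd' hc'
    (by simp [h, R.left_eq_zero hN]) (by simp [h, R.right_eq_zero hN])
  have hφ : ∀ ξ ∈ Icc (κ⁻¹ * N) (κ * N), (-(t / ξ₀ ^ 2) + t / ξ ^ 2) * h ξ =
      ρ (ξ / N) * ((ξ - ξ₀) ^ 2 * k ξ) := by
    intro ξ hξ
    have := hpos ξ hξ
    simp only [h, q, m]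
    generalize k ξ = y
    generalize ρ (ξ / N) = z
    field_simp
    ring
  have ci : ContinuousOn (fun ξ : ℝ => Complex.exp (Complex.I * (-(t / ξ₀ ^ 2) : ℝ) * ξ) *
      (((-(t / ξ₀ ^ 2) + t / ξ ^ 2) * h ξ : ℝ) * G ξ)) (Icc (κ⁻¹ * N) (κ * N)) := by
    refine ContinuousOn.mul (by fun_prop) (ContinuousOn.mul ?_ P.cont.continuousOn)
    refine Complex.continuous_ofReal.comp_continuousOn (ContinuousOn.mul
      (continuousOn_const.add (ContinuousOn.div (by fun_prop) (by fun_prop) fun y hy => ?_)) hc)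
    exact pow_ne_zero 2 (hpos y hy).ne'
  have ci2 : Continuous (fun ξ : ℝ => Complex.exp (Complex.I * (-(t / ξ₀ ^ 2) : ℝ) * ξ) *
      ((ρ (ξ / N) * (d ^ 2 * k ξ) : ℝ) * G ξ)) := by
    have c1 := R.continuous
    have c2 := P.cont
    fun_prop
  have esplit : osc G ρ N (-(t / ξ₀ ^ 2)) = (∫ ξ in (κ⁻¹ * N)..(κ * N),
      Complex.exp (Complex.I * (-(t / ξ₀ ^ 2) : ℝ) * ξ) *
        (((-(t / ξ₀ ^ 2) + t / ξ ^ 2) * h ξ : ℝ) * G ξ)) +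
      ∫ ξ in (κ⁻¹ * N)..(κ * N), Complex.exp (Complex.I * (-(t / ξ₀ ^ 2) : ℝ) * ξ) *
        ((ρ (ξ / N) * (d ^ 2 * k ξ) : ℝ) * G ξ) := by
    rw [← intervalIntegral.integral_add
      (ContinuousOn.intervalIntegrable (by rwa [uIcc_of_le h1])) (ci2.intervalIntegrable _ _)]
    refine intervalIntegral.integral_congr fun ξ hξ => ?_
    rw [uIcc_of_le h1] at hξ
    rw [hφ ξ hξ, ← mul_add, ← add_mul, ← Complex.ofReal_add, ← mul_add,
      add_comm ((ξ - ξ₀) ^ 2 * k ξ), hk1, mul_one]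
  have bη : ∀ ξ ∈ Icc (κ⁻¹ * N) (κ * N), |ξ - ξ₀| ≤ 2 * N := fun ξ hξ => by
    have := hpos ξ hξ
    rw [abs_le]
    constructor <;> linarith [hξ.1, hξ.2, hξ₀.1, hξ₀.2]
  have bq : ∀ ξ ∈ Icc (κ⁻¹ * N) (κ * N), |q ξ| ≤ 5 * (N ^ 3 / t) := fun ξ hξ => by
    have hξ0 := hpos ξ hξ
    rw [abs_of_nonneg (by positivity)]
    calc q ξ = ξ * (ξ₀ ^ 2 / t) * (ξ / (ξ + ξ₀)) := by simp only [q]; ring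
      _ ≤ (11 / 10 * N) * ((2 * N) ^ 2 / t) * 1 := by
          gcongr
          · exact hξ.2.trans h5
          · exact hξ₀.2
          · rw [div_le_one (by positivity)]; linarith
      _ = 44 / 10 * (N ^ 3 / t) := by ring
      _ ≤ _ := by gcongr; norm_num
  have bq' : ∀ ξ ∈ Icc (κ⁻¹ * N) (κ * N), |q' ξ| ≤ 4 * (N ^ 2 / t) := fun ξ hξ => by
    have hξ0 := hpos ξ hξ
    have e : q' ξ = (ξ₀ ^ 2 / t) * ((ξ ^ 2 + 2 * ξ * ξ₀) / (ξ + ξ₀) ^ 2) := by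
      simp only [q']; ring
    rw [e, abs_of_nonneg (by positivity)]
    calc _ ≤ ((2 * N) ^ 2 / t) * 1 := by
          gcongr
          · exact hξ₀.2
          · rw [div_le_one (by positivity)]; nlinarith
      _ = _ := by ring
  have bm : ∀ ξ, |m ξ| = |ξ - ξ₀| * k ξ := fun ξ => by rw [abs_mul, abs_of_pos (hkpos ξ)]
  have bm' : ∀ ξ, |m' ξ| ≤ k ξ := fun ξ => by
    have e : m' ξ = k ξ * (1 - 2 * ((ξ - ξ₀) ^ 2 * k ξ)) := by
      have : d ^ 2 + (ξ - ξ₀) ^ 2 ≠ 0 := by positivity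
      simp only [m', k]; field_simp; ring
    rw [e, abs_mul, abs_of_pos (hkpos ξ)]
    refine mul_le_of_le_one_right (hkpos ξ).le (abs_le.2 ⟨by linarith [hk2 ξ], ?_⟩)
    linarith [mul_nonneg (sq_nonneg (ξ - ξ₀)) (hkpos ξ).le]
  have bh : ∀ ξ ∈ Icc (κ⁻¹ * N) (κ * N), h ξ ^ 2 ≤ (5 * K * (N ^ 3 / t)) ^ 2 * k ξ := fun ξ hξ => by
    have e : |h ξ| ≤ K * (5 * (N ^ 3 / t)) * (|ξ - ξ₀| * k ξ) := by
      rw [abs_neg, abs_mul, abs_mul, bm]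
      have := R.abs_le (ξ / N)
      have := bq ξ hξ
      have := hkpos ξ
      gcongr
    have hk0 := (hkpos ξ).le
    calc h ξ ^ 2 = |h ξ| ^ 2 := (sq_abs _).symm
      _ ≤ (K * (5 * (N ^ 3 / t)) * (|ξ - ξ₀| * k ξ)) ^ 2 := by gcongr
      _ = (5 * K * (N ^ 3 / t)) ^ 2 * k ξ * ((ξ - ξ₀) ^ 2 * k ξ) := by
          rw [← sq_abs (ξ - ξ₀)]; ring
      _ ≤ _ := mul_le_of_le_one_right (by positivity) (hk2 ξ)
  -- The constant is `23 = (5 + 4)·2 + 5`, from the bounds on `q`, `q'` and `|ξ - ξ₀| ≤ 2N`; with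
  -- `2` from the pointwise bound on `G` and `4` from the mass of `k` it becomes `184`.
  have bh' : ∀ ξ ∈ Icc (κ⁻¹ * N) (κ * N), |h' ξ| ≤ 23 * K * (N ^ 3 / t) * k ξ := fun ξ hξ => by
    have hk0 := (hkpos ξ).le
    have r1 := R.abs_le (ξ / N)
    have r2 := R.abs_deriv_le (ξ / N)
    have r3 := bq ξ hξ
    have r4 := bq' ξ hξ
    have r5 := bη ξ hξ
    rw [abs_neg]
    calc _ ≤ (|ρ' (ξ / N)| / N * |q ξ| + |ρ (ξ / N)| * |q' ξ|) * |m ξ| +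
          |ρ (ξ / N)| * |q ξ| * |m' ξ| := by
          refine (abs_add_le _ _).trans ?_
          rw [abs_mul _ (m ξ), abs_mul _ (m' ξ), abs_mul _ (q ξ)]
          gcongr
          refine (abs_add_le _ _).trans ?_
          rw [abs_mul, abs_mul, abs_div, abs_of_pos hN]
      _ ≤ (K / N * (5 * (N ^ 3 / t)) + K * (4 * (N ^ 2 / t))) * (2 * N * k ξ) +
          K * (5 * (N ^ 3 / t)) * k ξ := by
          rw [bm]
          have := bm' ξ
          gcongr
      _ = _ := by field_simp; ring
  have hd2 : √(4 / d) = 2 / √d := by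
    rw [Real.sqrt_div (by norm_num), show (4 : ℝ) = 2 ^ 2 by norm_num, Real.sqrt_sq (by norm_num)]
  have i1 : ∫ ξ in Ioc (κ⁻¹ * N) (κ * N), ‖W ξ‖ * |h ξ| ≤
      A * (5 * K * (N ^ 3 / t) * (2 / √d)) := by
    refine (P.integral_W_mul_le hA hc).trans ?_
    gcongr
    rw [← hd2]
    refine Real.sqrt_le_iff.2 ⟨by positivity, ?_⟩
    calc ∫ ξ in Ioc (κ⁻¹ * N) (κ * N), h ξ ^ 2
        ≤ ∫ ξ in Ioc (κ⁻¹ * N) (κ * N), (5 * K * (N ^ 3 / t)) ^ 2 * k ξ := by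
          refine setIntegral_mono_on ((hc.pow 2).integrableOn_Icc.mono_set Ioc_subset_Icc_self)
            (hkI.const_mul _) measurableSet_Ioc fun ξ hξ => bh ξ (Ioc_subset_Icc_self hξ)
      _ ≤ (5 * K * (N ^ 3 / t)) ^ 2 * (4 / d) := by
          rw [integral_const_mul]
          exact mul_le_mul_of_nonneg_left hik (by positivity)
      _ = _ := by rw [mul_pow _ √(4 / d), Real.sq_sqrt (by positivity)]
  have i2 : ∫ ξ in Ioc (κ⁻¹ * N) (κ * N), ‖G ξ‖ * |h' ξ| ≤
      2 * C * A * √β * (23 * K * (N ^ 3 / t)) * (4 / d) := by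
    calc _ ≤ ∫ ξ in Ioc (κ⁻¹ * N) (κ * N), 2 * C * A * √β * (23 * K * (N ^ 3 / t)) * k ξ := by
          refine setIntegral_mono_on (P.integrableOn_norm_G_mul hc')
            (hkI.const_mul _) measurableSet_Ioc fun ξ hξ => ?_
          rw [mul_assoc _ (23 * K * (N ^ 3 / t))]
          have r1 := hGle ξ (Ioc_subset_Icc_self hξ)
          have r2 := bh' ξ (Ioc_subset_Icc_self hξ)
          gcongr
      _ ≤ _ := by
          rw [integral_const_mul]
          exact mul_le_mul_of_nonneg_left hik (by positivity)
  have cdk : Continuous fun ξ => d ^ 2 * k ξ := by fun_prop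
  have hiG := P.integrableOn_norm_G_mul (a := κ⁻¹ * N) (b := κ * N) cdk.continuousOn
  have i3 : ‖∫ ξ in (κ⁻¹ * N)..(κ * N), Complex.exp (Complex.I * (-(t / ξ₀ ^ 2) : ℝ) * ξ) *
        ((ρ (ξ / N) * (d ^ 2 * k ξ) : ℝ) * G ξ)‖ ≤
      K * ∫ ξ in Ioc (κ⁻¹ * N) (κ * N), ‖G ξ‖ * |d ^ 2 * k ξ| := by
    rw [intervalIntegral.integral_of_le h1, ← integral_const_mul]
    refine norm_integral_le_of_norm_le (hiG.const_mul K) (Filter.Eventually.of_forall fun ξ => ?_)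
    rw [norm_mul, norm_exp_I_mul, one_mul, norm_mul, Complex.norm_real, Real.norm_eq_abs, abs_mul,
      mul_assoc, mul_comm _ ‖G ξ‖]
    gcongr
    exact R.abs_le _
  -- The stationary part is estimated without oscillation in two ways: the pointwise bound on `G`
  -- with the `L¹` norm of `d² k`, or the `L²` bound on `G` with its `L²` norm. Which one is smaller
  -- depends on the choice of `d`.
  have i4 : ∫ ξ in Ioc (κ⁻¹ * N) (κ * N), ‖G ξ‖ * |d ^ 2 * k ξ| ≤
      C * A * min (8 * √β * d) (2 * β * √d) := by
    rw [mul_min_of_nonneg _ _ (by positivity)]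
    refine le_min ?_ ?_
    · calc _ ≤ ∫ ξ in Ioc (κ⁻¹ * N) (κ * N), 2 * C * A * √β * d ^ 2 * k ξ := by
            refine setIntegral_mono_on hiG (hkI.const_mul _) measurableSet_Ioc fun ξ hξ => ?_
            have hk0 := (hkpos ξ).le
            rw [abs_of_nonneg (by positivity), mul_assoc _ (d ^ 2)]
            have r1 := hGle ξ (Ioc_subset_Icc_self hξ)
            gcongr
        _ ≤ 2 * C * A * √β * d ^ 2 * (4 / d) := by
            rw [integral_const_mul]
            exact mul_le_mul_of_nonneg_left hik (by positivity)
        _ = _ := by field_simp; ring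
    · refine (hIGle _ cdk.continuousOn).trans ?_
      rw [show C * A * (2 * β * √d) = C * A * β * (2 * √d) by ring]
      gcongr
      refine Real.sqrt_le_iff.2 ⟨by positivity, ?_⟩
      calc _ ≤ ∫ ξ in Ioc (κ⁻¹ * N) (κ * N), d ^ 2 * k ξ := by
            refine setIntegral_mono_on
              ((cdk.pow 2).continuousOn.integrableOn_Icc.mono_set Ioc_subset_Icc_self)
              (hkI.const_mul _) measurableSet_Ioc fun ξ hξ => ?_
            have hk0 := (hkpos ξ).le
            rw [sq (d ^ 2 * k ξ)]
            exact mul_le_of_le_one_left (by positivity) (hk3 ξ)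
        _ ≤ d ^ 2 * (4 / d) := by
            rw [integral_const_mul]
            exact mul_le_mul_of_nonneg_left hik (by positivity)
        _ = _ := by rw [mul_pow, Real.sq_sqrt hd.le]; field_simp; ring
  rw [integral_add (P.integrableOn_norm_W_mul hc) (P.integrableOn_norm_G_mul hc')] at key
  rw [esplit]
  refine (norm_add_le _ _).trans ?_
  have i5 : A * (5 * K * (N ^ 3 / t) * (2 / √d)) ≤ C * (A * (5 * K * (N ^ 3 / t) * (2 / √d))) :=
    le_mul_of_one_le_left (by positivity) (by linarith)
  calc _ ≤ (A * (5 * K * (N ^ 3 / t) * (2 / √d)) +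
        2 * C * A * √β * (23 * K * (N ^ 3 / t)) * (4 / d)) +
        K * (C * A * min (8 * √β * d) (2 * β * √d)) := by
        refine add_le_add (key.trans (add_le_add i1 i2)) (i3.trans ?_)
        gcongr
    _ ≤ (C * (A * (5 * K * (N ^ 3 / t) * (2 / √d))) +
        2 * C * A * √β * (23 * K * (N ^ 3 / t)) * (4 / d)) +
        K * (C * A * min (8 * √β * d) (2 * β * √d)) := by gcongr
    _ = _ := by ring

/-- The bound for a frequency localized piece near the stationary point of the phase. -/
lemma norm_osc_le_of_resonant (P : Profile s t A G W) (R : Amplitude ρ ρ' K) (hs : 1 ≤ s)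
    (hA : 0 ≤ A) (ht : 0 < t) {N ξ₀ : ℝ} (hN : 0 < N) (hξ₀ : ξ₀ ∈ Icc (N / 2) (2 * N)) :
    ‖osc G ρ N (-(t / ξ₀ ^ 2))‖ ≤
      202 * profileConst s * K * A * (√(scaleBound s N) * √(N ^ 3 / t)) := by
  have hK := R.nonneg
  have hC := four_le_profileConst (s := s) (by linarith)
  have hβ := scaleBound_pos (s := s) hN
  have hsplit := fun d (hd : 0 < d) => P.norm_osc_le_of_split R hs hA ht hN hξ₀ hd
  set β := scaleBound s N
  set B := √β
  set L := √(N ^ 3 / t)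
  have hB : 0 < B := Real.sqrt_pos.2 hβ
  have hL : 0 < L := Real.sqrt_pos.2 (by positivity)
  have hB2 : β = B ^ 2 := (Real.sq_sqrt hβ.le).symm
  have hL2 : N ^ 3 / t = L ^ 2 := (Real.sq_sqrt (by positivity)).symm
  rw [hB2, hL2] at hsplit
  -- `L` is the natural stationary phase width, as the second derivative of the phase is about
  -- `t/N³`. It is the right choice when `L ≤ β`; otherwise the `W` term would dominate, and the
  -- larger `d = L²/β` balances it against the `L²` form of the stationary part. The first case
  -- gives `10 + 184 + 8 = 202`.
  have main : ∃ d, 0 < d ∧ 10 * L ^ 2 / √d + 184 * B * L ^ 2 / d +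
      min (8 * B * d) (2 * B ^ 2 * √d) ≤ 202 * (B * L) := by
    rcases le_total L (B ^ 2) with h | h
    · refine ⟨L, hL, ?_⟩
      have hq : √L ≤ B := Real.sqrt_le_iff.2 ⟨hB.le, h⟩
      have e1 : L ^ 2 / √L = L * √L := by
        rw [div_eq_iff (by positivity), mul_assoc, Real.mul_self_sqrt hL.le]; ring
      have e2 : L ^ 2 / L = L := by field_simp
      have e3 := min_le_left (8 * B * L) (2 * B ^ 2 * √L)
      rw [mul_div_assoc, mul_div_assoc, e1, e2]
      have e4 : L * √L ≤ L * B := by gcongr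
      linarith
    · refine ⟨(L / B) ^ 2, by positivity, ?_⟩
      rw [Real.sqrt_sq (by positivity)]
      have e1 : 10 * L ^ 2 / (L / B) = 10 * (B * L) := by field_simp
      have e2 : 184 * B * L ^ 2 / (L / B) ^ 2 = 184 * (B * B ^ 2) := by field_simp
      have e3 := min_le_right (8 * B * (L / B) ^ 2) (2 * B ^ 2 * (L / B))
      have e4 : 2 * B ^ 2 * (L / B) = 2 * (B * L) := by field_simp
      have e5 : B * B ^ 2 ≤ B * L := by gcongr
      have e6 : 0 ≤ B * L := by positivity
      rw [e1, e2]
      linarith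
  obtain ⟨d, hd, hle⟩ := main
  refine (hsplit d hd).trans ?_
  calc _ ≤ profileConst s * K * A * (202 * (B * L)) := by gcongr
    _ = _ := by ring

end Profile

/-! ### The dyadic pieces `u_N⁺` -/

lemma exists_amplitude {ρ : ℝ → ℝ} (hρ : ContDiff ℝ 1 ρ) (hl : ∀ η ≤ κ⁻¹, ρ η = 0)
    (hr : ∀ η, κ ≤ η → ρ η = 0) : ∃ K, Amplitude ρ (deriv ρ) K := by
  have hcs : HasCompactSupport ρ := HasCompactSupport.intro (isCompact_Icc (a := κ⁻¹) (b := κ))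
    fun η hη => by
      by_contra h
      exact hη ⟨not_lt.1 fun h' => h (hl η h'.le), not_lt.1 fun h' => h (hr η h'.le)⟩
  obtain ⟨K, hK⟩ := hcs.exists_bound_of_continuous hρ.continuous
  obtain ⟨K', hK'⟩ := hcs.deriv.exists_bound_of_continuous (hρ.continuous_deriv le_rfl)
  exact ⟨max K K', fun η => (hρ.differentiable one_ne_zero η).hasDerivAt,
    hρ.continuous_deriv le_rfl, hl, hr, fun η => (hK η).trans (le_max_left _ _),
    fun η => (hK' η).trans (le_max_right _ _)⟩

/-- The amplitude `σ₁(η) 1_{η>0}`. -/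
def ampl (σ : ℝ → ℝ) (η : ℝ) : ℝ := (Ioi (0 : ℝ)).indicator (fun η => σ η - σ (κ * η)) η

section Cutoff

variable {σ : ℝ → ℝ} (hσ : IsCutoff σ)
include hσ

lemma IsCutoff.ampl_eq_zero_left {η : ℝ} (h : η ≤ κ⁻¹) : ampl σ η = 0 := by
  by_cases h0 : 0 < η
  · have h1 : κ * η ≤ 1 := by
      calc κ * η ≤ κ * κ⁻¹ := by have := κ_pos; gcongr
        _ = 1 := mul_inv_cancel₀ κ_pos.ne'
    have h2 : η ≤ 1 := h.trans (inv_lt_one_of_one_lt₀ one_lt_κ).le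
    rw [ampl, indicator_of_mem (mem_Ioi.2 h0), hσ.eq_one η (by rwa [abs_of_pos h0]),
      hσ.eq_one (κ * η) (by rwa [abs_of_pos (mul_pos κ_pos h0)]), sub_self]
  · exact indicator_of_notMem (by simpa using h0) _

lemma IsCutoff.ampl_eq_zero_right {η : ℝ} (h : κ ≤ η) : ampl σ η = 0 := by
  have h0 : 0 < η := κ_pos.trans_le h
  have h1 : κ ≤ κ * η := le_mul_of_one_le_right κ_pos.le (one_lt_κ.le.trans h)
  rw [ampl, indicator_of_mem (mem_Ioi.2 h0), hσ.eq_zero η (by rwa [abs_of_pos h0]),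
      hσ.eq_zero (κ * η) (by rwa [abs_of_pos (mul_pos κ_pos h0)]), sub_self]

/-- The jump of the indicator at `0` is invisible, because `σ(η) - σ(κη)` already vanishes for `|η|
≤ κ⁻¹`. -/
lemma IsCutoff.contDiff_ampl : ContDiff ℝ 1 (ampl σ) := by
  have hσ1 : ContDiff ℝ 1 σ := hσ.contDiff.of_le (by exact_mod_cast le_top)
  have hk : 0 < κ⁻¹ := inv_pos.2 κ_pos
  rw [contDiff_iff_contDiffAt]
  intro η
  rcases lt_or_ge η κ⁻¹ with h | h
  · refine (contDiffAt_const (c := (0 : ℝ))).congr_of_eventuallyEq ?_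
    filter_upwards [Iio_mem_nhds h] with y hy using hσ.ampl_eq_zero_left (mem_Iio.1 hy).le
  · have : ContDiffAt ℝ 1 (fun η => σ η - σ (κ * η)) η :=
      (hσ1.sub (hσ1.comp (contDiff_const.mul contDiff_id))).contDiffAt
    refine this.congr_of_eventuallyEq ?_
    filter_upwards [Ioi_mem_nhds (hk.trans_le h)] with y hy using indicator_of_mem hy _

lemma IsCutoff.contDiff_ampl_div : ContDiff ℝ 1 (fun η => ampl σ η / η) := by
  have hk : 0 < κ⁻¹ := inv_pos.2 κ_pos
  rw [contDiff_iff_contDiffAt]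
  intro η
  rcases lt_or_ge η κ⁻¹ with h | h
  · refine (contDiffAt_const (c := (0 : ℝ))).congr_of_eventuallyEq ?_
    filter_upwards [Iio_mem_nhds h] with y hy
    rw [hσ.ampl_eq_zero_left (mem_Iio.1 hy).le, zero_div]
  · exact hσ.contDiff_ampl.contDiffAt.div contDiffAt_id (hk.trans_le h).ne'

omit hσ in
lemma indicator_sigmaAt {N : ℝ} (hN : 0 < N) (ξ : ℝ) :
    (Ioi (0 : ℝ)).indicator (fun ξ => (sigmaAt σ N ξ : ℂ)) ξ = (ampl σ (ξ / N) : ℂ) := by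
  by_cases h : 0 < ξ
  · rw [indicator_of_mem (mem_Ioi.2 h), ampl, indicator_of_mem (mem_Ioi.2 (div_pos h hN)), sigmaAt,
      mul_div_assoc]
    rfl
  · have h' : ¬ 0 < ξ / N := not_lt.2 (div_nonpos_of_nonpos_of_nonneg (not_lt.1 h) hN.le)
    rw [indicator_of_notMem (by simpa using h), ampl, indicator_of_notMem (by simpa using h')]
    simp

lemma IsCutoff.abs_ampl_le_one (η : ℝ) : |ampl σ η| ≤ 1 := by
  by_cases h : 0 < η
  · rw [ampl, indicator_of_mem (mem_Ioi.2 h), abs_le]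
    have := hσ.nonneg η
    have := hσ.nonneg (κ * η)
    have := hσ.le_one η
    have := hσ.le_one (κ * η)
    constructor <;> linarith
  · rw [ampl, indicator_of_notMem (by simpa using h)]; simp

omit hσ in
lemma osc_eq_integral {G : ℝ → ℂ} {ρ : ℝ → ℝ} {N : ℝ} (hN : 0 < N) (x : ℝ)
    (hl : ∀ η ≤ κ⁻¹, ρ η = 0) (hr : ∀ η, κ ≤ η → ρ η = 0) :
    osc G ρ N x = ∫ ξ : ℝ, Complex.exp (Complex.I * x * ξ) * ((ρ (ξ / N) : ℝ) * G ξ) := by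
  refine intervalIntegral.integral_eq_integral_of_support_subset fun ξ hξ => ?_
  by_contra h
  apply hξ
  have : ρ (ξ / N) = 0 := by
    rcases le_or_gt ξ (κ⁻¹ * N) with h1 | h1
    · exact hl _ ((div_le_iff₀ hN).2 h1)
    · refine hr _ ((le_div_iff₀ hN).2 ?_)
      by_contra h2
      exact h ⟨h1, (not_le.1 h2).le⟩
  simp [this]

section Piece

variable {s t : ℝ} {f : ℝ → ℝ} (hf : MemX s t f) (hs : 3 / 2 < s) {N : ℝ} (hN : 0 < N)
include hf hs hN

omit hN in
lemma integrable_ampl_mul_hat :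
    Integrable (fun ξ : ℝ => (ampl σ (ξ / N) : ℂ) * hat (cplx f) ξ) ∧
    Integrable (fun ξ : ℝ => (ξ : ℂ) * ((ampl σ (ξ / N) : ℂ) * hat (cplx f) ξ)) := by
  have hc : Continuous fun ξ : ℝ => (ampl σ (ξ / N) : ℂ) := by
    have := hσ.contDiff_ampl.continuous
    fun_prop
  have hb : ∀ᵐ ξ : ℝ, ‖(ampl σ (ξ / N) : ℂ)‖ ≤ 1 := Filter.Eventually.of_forall fun ξ => by
    rw [Complex.norm_real]; exact hσ.abs_ampl_le_one _
  refine ⟨(hf.integrable_hat hs).bdd_mul hc.aestronglyMeasurable hb, ?_⟩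
  have := (hf.integrable_mul_hat hs).bdd_mul hc.aestronglyMeasurable hb
  refine this.congr (Filter.Eventually.of_forall fun ξ => by ring)

omit hσ hf hs in
lemma uPlusAt_eq_invInt :
    uPlusAt σ N f = invInt fun ξ => (ampl σ (ξ / N) : ℂ) * hat (cplx f) ξ := by
  rw [uPlusAt, multiplier_eq]
  congr 1; ext ξ
  rw [indicator_sigmaAt hN]

lemma contDiff_uPlusAt : ContDiff ℝ 1 (uPlusAt σ N f) := by
  rw [uPlusAt_eq_invInt hN]
  obtain ⟨h1, h2⟩ := integrable_ampl_mul_hat hσ hf hs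
  exact contDiff_invInt h1 h2

variable {G : ℝ → ℂ} (hG : ∀ᵐ ξ : ℝ, hat (cplx f) ξ = (ξ : ℂ)⁻¹ * G ξ) (x : ℝ)
include hG

omit hf hs in
-- Since `û = G/ξ`, writing `1/ξ = N⁻¹ (ξ/N)⁻¹` puts the singular factor into the amplitude, where
-- it is smooth, and leaves a gain of `N⁻¹`.
lemma norm_uPlusAt_le : ‖uPlusAt σ N f x‖ ≤ N⁻¹ * ‖osc G (fun η => ampl σ η / η) N x‖ := by
  rw [uPlusAt_eq_invInt hN, osc_eq_integral hN x
    (fun η h => by rw [hσ.ampl_eq_zero_left h, zero_div])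
    (fun η h => by rw [hσ.ampl_eq_zero_right h, zero_div])]
  refine (norm_invInt_le _ _).trans (le_of_eq ?_)
  rw [← Real.norm_of_nonneg (inv_pos.2 hN).le, ← Complex.norm_real, ← norm_mul, ← integral_const_mul]
  congr 1
  refine integral_congr_ae ?_
  filter_upwards [hG] with ξ hξ
  have hN' : (N : ℂ) ≠ 0 := by exact_mod_cast hN.ne'
  rw [hξ]
  push_cast
  by_cases h0 : (ξ : ℂ) = 0
  · simp [h0]
  · field_simp

/-- The symbol `iξ` of the derivative cancels the `1/ξ` in `û = G/ξ`, so `G` appears with the plain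
amplitude and without the gain `N⁻¹`. -/
lemma hasDerivAt_uPlusAt : ∃ d : ℂ, HasDerivAt (uPlusAt σ N f) d x ∧ ‖d‖ ≤ ‖osc G (ampl σ) N x‖ := by
  obtain ⟨h1, h2⟩ := integrable_ampl_mul_hat hσ hf hs
  rw [uPlusAt_eq_invInt hN]
  refine ⟨_, hasDerivAt_invInt h1 h2 x, (norm_invInt_le _ _).trans (le_of_eq ?_)⟩
  rw [osc_eq_integral hN x (fun η h => hσ.ampl_eq_zero_left h)
    (fun η h => hσ.ampl_eq_zero_right h)]
  rw [← one_mul ‖∫ ξ : ℝ, Complex.exp (Complex.I * x * ξ) * ((ampl σ (ξ / N) : ℝ) * G ξ)‖,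
    ← Complex.norm_I, ← norm_mul, ← integral_const_mul]
  congr 1
  refine integral_congr_ae ?_
  filter_upwards [hG, compl_mem_ae_iff.mpr (measure_singleton (0 : ℝ))] with ξ hξ h0
  have h0' : (ξ : ℂ) ≠ 0 := by simpa using h0
  rw [hξ]
  field_simp

end Piece

end Cutoff

/-- The bounds for the frequency localized pieces `u_N⁺`. -/
structure PieceBound (s t A M : ℝ) (v : ℝ → ℂ) (N : ℝ) : Prop where
  contDiff : ContDiff ℝ 1 v
  norm_le : ∀ x, ‖v x‖ ≤ M * A * (N⁻¹ * (scaleBound s N * √N))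
  norm_deriv_le : ∀ x, ‖deriv v x‖ ≤ M * A * (scaleBound s N * √N)
  norm_le_nonres : ∀ x, (∀ ξ ∈ Icc (κ⁻¹ * N) (κ * N), t / (4 * N ^ 2) ≤ |x + t / ξ ^ 2|) →
    ‖v x‖ ≤ M * A * (N⁻¹ * (N ^ 2 * √N / t))
  norm_deriv_le_nonres : ∀ x, (∀ ξ ∈ Icc (κ⁻¹ * N) (κ * N), t / (4 * N ^ 2) ≤ |x + t / ξ ^ 2|) →
    ‖deriv v x‖ ≤ M * A * (N ^ 2 * √N / t)
  norm_le_res : ∀ ξ₀ ∈ Icc (N / 2) (2 * N),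
    ‖v (-(t / ξ₀ ^ 2))‖ ≤ M * A * (N⁻¹ * (√(scaleBound s N) * √(N ^ 3 / t)))
  norm_deriv_le_res : ∀ ξ₀ ∈ Icc (N / 2) (2 * N),
    ‖deriv v (-(t / ξ₀ ^ 2))‖ ≤ M * A * (√(scaleBound s N) * √(N ^ 3 / t))

theorem exists_pieceBound {σ : ℝ → ℝ} (hσ : IsCutoff σ) {s : ℝ} (hs : 3 / 2 < s) :
    ∃ M, 0 < M ∧ ∀ (f : ℝ → ℝ) (t : ℝ), 0 < t → MemX s t f → ∀ N, 0 < N →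
      PieceBound s t (xNorm s t f) M (uPlusAt σ N f) N := by
  obtain ⟨K₀, R₀⟩ := exists_amplitude hσ.contDiff_ampl_div
    (fun η h => by rw [hσ.ampl_eq_zero_left h, zero_div])
    (fun η h => by rw [hσ.ampl_eq_zero_right h, zero_div])
  obtain ⟨K₁, R₁⟩ := exists_amplitude hσ.contDiff_ampl (fun η h => hσ.ampl_eq_zero_left h)
    (fun η h => hσ.ampl_eq_zero_right h)
  have hK₀ := R₀.nonneg
  have hK₁ := R₁.nonneg
  have hC := four_le_profileConst (s := s) (by linarith)
  -- `202` is the largest of the constants `1`, `51`, `202` of the three oscillatory bounds; the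
  -- summand `1` ensures positivity.
  refine ⟨202 * profileConst s * (K₀ + K₁ + 1), by positivity, fun f t ht hf N hN => ?_⟩
  obtain ⟨G, W, P, hG⟩ := hf.exists_profile hs
  have hA : 0 ≤ xNorm s t f := xNorm_nonneg
  set A := xNorm s t f
  have hβ := scaleBound_pos (s := s) hN
  have b0 : ∀ x, ‖uPlusAt σ N f x‖ ≤ N⁻¹ * ‖osc G (fun η => ampl σ η / η) N x‖ :=
    fun x => norm_uPlusAt_le hσ hN hG x
  have b1 : ∀ x, ‖deriv (uPlusAt σ N f) x‖ ≤ ‖osc G (ampl σ) N x‖ := fun x => by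
    obtain ⟨d, hd, hd'⟩ := hasDerivAt_uPlusAt hσ hf hs hN hG x
    rwa [hd.deriv]
  have hs1 : 1 ≤ s := by linarith
  have conv0 : ∀ {x c X : ℝ}, 0 ≤ X → c ≤ 202 →
      ‖osc G (fun η => ampl σ η / η) N x‖ ≤ c * profileConst s * K₀ * A * X →
      ‖uPlusAt σ N f x‖ ≤ 202 * profileConst s * (K₀ + K₁ + 1) * A * (N⁻¹ * X) := by
    intro x c X hX hc h
    refine (b0 x).trans ?_
    calc _ ≤ N⁻¹ * (c * profileConst s * K₀ * A * X) := by gcongr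
      _ ≤ N⁻¹ * (202 * profileConst s * (K₀ + K₁ + 1) * A * X) := by gcongr; linarith
      _ = _ := by ring
  have conv1 : ∀ {x c X : ℝ}, 0 ≤ X → c ≤ 202 →
      ‖osc G (ampl σ) N x‖ ≤ c * profileConst s * K₁ * A * X →
      ‖deriv (uPlusAt σ N f) x‖ ≤ 202 * profileConst s * (K₀ + K₁ + 1) * A * X := by
    intro x c X hX hc h
    refine (b1 x).trans (h.trans ?_)
    gcongr
    linarith
  refine ⟨contDiff_uPlusAt hσ hf hs hN, fun x => ?_, fun x => ?_, fun x hx => ?_, fun x hx => ?_,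
    fun ξ₀ hξ₀ => ?_, fun ξ₀ hξ₀ => ?_⟩
  · exact conv0 (c := 1) (by positivity) (by norm_num)
      (by rw [one_mul]; exact P.norm_osc_le R₀ hs1 hA hN x)
  · exact conv1 (c := 1) (by positivity) (by norm_num)
      (by rw [one_mul]; exact P.norm_osc_le R₁ hs1 hA hN x)
  · exact conv0 (by positivity) (by norm_num) (P.norm_osc_le_of_nonresonant R₀ hs1 hA ht hN hx)
  · exact conv1 (by positivity) (by norm_num) (P.norm_osc_le_of_nonresonant R₁ hs1 hA ht hN hx)
  · exact conv0 (by positivity) le_rfl (P.norm_osc_le_of_resonant R₀ hs1 hA ht hN hξ₀)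
  · exact conv1 (by positivity) le_rfl (P.norm_osc_le_of_resonant R₁ hs1 hA ht hN hξ₀)

/-! ### The spatial cutoff and the nonresonant region -/

lemma sigmaBetween_eq (σ : ℝ → ℝ) (R₁ R₂ x : ℝ) :
    sigmaBetween σ R₁ R₂ x = σ (x / R₂) - σ (κ * x / R₁) := by
  simp only [sigmaBetween, sigmaLE, sigmaLT, sigmaAt, κ]
  ring

lemma sigmaHyp_of_neg (σ : ℝ → ℝ) (N t : ℝ) {x : ℝ} (hx : x < 0) :
    sigmaHyp σ N t x = σ (x / (3 * (t / N ^ 2))) - σ (κ * x / (1 / 3 * (t / N ^ 2))) := by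
  rw [sigmaHyp, indicator_of_mem (mem_Iio.2 hx), sigmaBetween_eq]

lemma sigmaHyp_of_nonneg (σ : ℝ → ℝ) (N t : ℝ) {x : ℝ} (hx : 0 ≤ x) : sigmaHyp σ N t x = 0 :=
  indicator_of_notMem (by simpa using hx) _

section SigmaHyp

variable {σ : ℝ → ℝ} (hσ : IsCutoff σ) {N t : ℝ} (hT : 0 < t / N ^ 2)
include hσ hT

lemma sigmaHyp_eq_zero_of_le {x : ℝ} (hx : |x| ≤ κ⁻¹ * (1 / 3 * (t / N ^ 2))) :
    sigmaHyp σ N t x = 0 := by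
  rcases le_or_gt 0 x with h | h
  · exact sigmaHyp_of_nonneg σ N t h
  · have hκ := κ_pos
    have h1 : |κ * x / (1 / 3 * (t / N ^ 2))| ≤ 1 := by
      rw [abs_div, abs_mul, abs_of_pos hκ, abs_of_pos (by positivity : 0 < 1 / 3 * (t / N ^ 2)),
        div_le_one (by positivity)]
      calc κ * |x| ≤ κ * (κ⁻¹ * (1 / 3 * (t / N ^ 2))) := by gcongr
        _ = _ := by rw [← mul_assoc, mul_inv_cancel₀ hκ.ne', one_mul]
    have h2 : |x / (3 * (t / N ^ 2))| ≤ 1 := by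
      rw [abs_div, abs_of_pos (by positivity : 0 < 3 * (t / N ^ 2)), div_le_one (by positivity)]
      have : κ⁻¹ ≤ 1 := (inv_lt_one_of_one_lt₀ one_lt_κ).le
      nlinarith
    rw [sigmaHyp_of_neg σ N t h, hσ.eq_one _ h1, hσ.eq_one _ h2, sub_self]

lemma sigmaHyp_eq_zero_of_ge {x : ℝ} (hx : κ * (3 * (t / N ^ 2)) ≤ |x|) :
    sigmaHyp σ N t x = 0 := by
  rcases le_or_gt 0 x with h | h
  · exact sigmaHyp_of_nonneg σ N t h
  · have hκ := κ_pos
    have hκ1 := one_lt_κ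
    have h1 : κ ≤ |κ * x / (1 / 3 * (t / N ^ 2))| := by
      rw [abs_div, abs_mul, abs_of_pos hκ, abs_of_pos (by positivity : 0 < 1 / 3 * (t / N ^ 2)),
        le_div_iff₀ (by positivity)]
      gcongr
      nlinarith
    have h2 : κ ≤ |x / (3 * (t / N ^ 2))| := by
      rw [abs_div, abs_of_pos (by positivity : 0 < 3 * (t / N ^ 2)), le_div_iff₀ (by positivity)]
      exact hx
    rw [sigmaHyp_of_neg σ N t h, hσ.eq_zero _ h1, hσ.eq_zero _ h2, sub_self]

lemma sigmaHyp_eq_one {x : ℝ} (hx : x < 0) (h₁ : 1 / 3 * (t / N ^ 2) ≤ |x|)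
    (h₂ : |x| ≤ 3 * (t / N ^ 2)) : sigmaHyp σ N t x = 1 := by
  have hκ := κ_pos
  have e1 : κ ≤ |κ * x / (1 / 3 * (t / N ^ 2))| := by
    rw [abs_div, abs_mul, abs_of_pos hκ, abs_of_pos (by positivity : 0 < 1 / 3 * (t / N ^ 2)),
      le_div_iff₀ (by positivity)]
    gcongr
  have e2 : |x / (3 * (t / N ^ 2))| ≤ 1 := by
    rw [abs_div, abs_of_pos (by positivity : 0 < 3 * (t / N ^ 2)), div_le_one (by positivity)]
    exact h₂
  rw [sigmaHyp_of_neg σ N t hx, hσ.eq_zero _ e1, hσ.eq_one _ e2, sub_zero]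

omit hT in
lemma abs_sigmaHyp_le_one (x : ℝ) : |sigmaHyp σ N t x| ≤ 1 := by
  rcases le_or_gt 0 x with h | h
  · rw [sigmaHyp_of_nonneg σ N t h]; simp
  · rw [sigmaHyp_of_neg σ N t h, abs_le]
    have := hσ.nonneg (x / (3 * (t / N ^ 2)))
    have := hσ.nonneg (κ * x / (1 / 3 * (t / N ^ 2)))
    have := hσ.le_one (x / (3 * (t / N ^ 2)))
    have := hσ.le_one (κ * x / (1 / 3 * (t / N ^ 2)))
    constructor <;> linarith

omit hσ hT in
lemma sigmaHyp_eventuallyEq_of_neg {x : ℝ} (h : x < 0) : sigmaHyp σ N t =ᶠ[nhds x]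
    fun x => σ (x / (3 * (t / N ^ 2))) - σ (κ * x / (1 / 3 * (t / N ^ 2))) := by
  filter_upwards [Iio_mem_nhds h] with y hy using sigmaHyp_of_neg σ N t hy

/-- The cutoff vanishes for `|x| ≤ κ⁻¹ t/(3N²)`, so the factor `1_{x<0}` produces no discontinuity
at the origin. -/
lemma sigmaHyp_eventuallyEq_zero {x : ℝ} (h : 0 ≤ x) : sigmaHyp σ N t =ᶠ[nhds x] fun _ => 0 := by
  have hκ := κ_pos
  have : -(κ⁻¹ * (1 / 3 * (t / N ^ 2))) < x := lt_of_lt_of_le (neg_lt_zero.2 (by positivity)) h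
  filter_upwards [Ioi_mem_nhds this] with y hy
  rcases le_or_gt 0 y with h0 | h0
  · exact sigmaHyp_of_nonneg σ N t h0
  · refine sigmaHyp_eq_zero_of_le hσ hT ?_
    rw [abs_of_neg h0]
    linarith [mem_Ioi.1 hy]

lemma contDiff_sigmaHyp : ContDiff ℝ 1 (sigmaHyp σ N t) := by
  have hσ1 : ContDiff ℝ 1 σ := hσ.contDiff.of_le (by exact_mod_cast le_top)
  rw [contDiff_iff_contDiffAt]
  intro x
  rcases le_or_gt 0 x with h | h
  · exact contDiffAt_const.congr_of_eventuallyEq (sigmaHyp_eventuallyEq_zero hσ hT h)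
  · refine ContDiffAt.congr_of_eventuallyEq ?_ (sigmaHyp_eventuallyEq_of_neg h)
    exact ((hσ1.comp (contDiff_id.div_const _)).sub
      (hσ1.comp ((contDiff_const.mul contDiff_id).div_const _))).contDiffAt

/-- The derivative of the cutoff lives where the phase of `u_N⁺` is not stationary. -/
lemma deriv_sigmaHyp_eq_zero {x : ℝ} (hx : x < 0) (h₁ : 1 / 3 * (t / N ^ 2) < |x|)
    (h₂ : |x| < 3 * (t / N ^ 2)) : deriv (sigmaHyp σ N t) x = 0 := by
  have : sigmaHyp σ N t =ᶠ[nhds x] fun _ => 1 := by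
    have c1 := (continuous_abs.tendsto x).eventually (Ioo_mem_nhds h₁ h₂)
    filter_upwards [c1, Iio_mem_nhds hx] with y hy hy0
    exact sigmaHyp_eq_one hσ hT hy0 hy.1.le hy.2.le
  rw [this.deriv_eq, deriv_const]

lemma deriv_sigmaHyp_of_nonneg {x : ℝ} (hx : 0 ≤ x) : deriv (sigmaHyp σ N t) x = 0 := by
  rw [(sigmaHyp_eventuallyEq_zero hσ hT hx).deriv_eq, deriv_const]

lemma deriv_sigmaHyp_of_lt {x : ℝ} (hx : |x| < κ⁻¹ * (1 / 3 * (t / N ^ 2))) :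
    deriv (sigmaHyp σ N t) x = 0 := by
  have : sigmaHyp σ N t =ᶠ[nhds x] fun _ => 0 := by
    have c1 := (continuous_abs.tendsto x).eventually (Iio_mem_nhds hx)
    filter_upwards [c1] with y hy
    exact sigmaHyp_eq_zero_of_le hσ hT (le_of_lt hy)
  rw [this.deriv_eq, deriv_const]

lemma deriv_sigmaHyp_of_gt {x : ℝ} (hx : κ * (3 * (t / N ^ 2)) < |x|) :
    deriv (sigmaHyp σ N t) x = 0 := by
  have : sigmaHyp σ N t =ᶠ[nhds x] fun _ => 0 := by
    have c1 := (continuous_abs.tendsto x).eventually (Ioi_mem_nhds hx)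
    filter_upwards [c1] with y hy
    exact sigmaHyp_eq_zero_of_ge hσ hT (le_of_lt hy)
  rw [this.deriv_eq, deriv_const]

omit hσ in
-- On the block `t/ξ²` stays within `[2/3, 2]` times `T = t/N²`. A nonnegative `x` adds to it, `|x|
-- ≤ T/3` leaves at least `T/3`, and `|x| ≥ 3T` leaves at least `T`; all exceed `T/4`.
lemma nonresonant {x : ℝ} (ht : 0 < t) (hN : 0 < N)
    (hx : 0 ≤ x ∨ |x| ≤ 1 / 3 * (t / N ^ 2) ∨ 3 * (t / N ^ 2) ≤ |x|) :
    ∀ ξ ∈ Icc (κ⁻¹ * N) (κ * N), t / (4 * N ^ 2) ≤ |x + t / ξ ^ 2| := by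
  intro ξ hξ
  obtain ⟨h0, h1, h2, h3, h4, h5, h6⟩ := scale_facts hN
  have hξ0 : 0 < ξ := h0.trans_le hξ.1
  set T := t / N ^ 2
  have e1 : t / ξ ^ 2 ≤ 2 * T := by
    simp only [T]
    rw [mul_div_assoc', div_le_div_iff₀ (by positivity) (by positivity)]
    have : N ^ 2 ≤ 2 * ξ ^ 2 := by nlinarith [hξ.1]
    nlinarith
  have e2 : 2 / 3 * T ≤ t / ξ ^ 2 := by
    simp only [T]
    rw [mul_div_assoc', div_le_div_iff₀ (by positivity) (by positivity)]
    have : 2 / 3 * ξ ^ 2 ≤ N ^ 2 := by nlinarith [hξ.2]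
    nlinarith
  have e3 : t / (4 * N ^ 2) = T / 4 := by simp only [T]; ring
  rw [e3]
  rcases hx with hx | hx | hx
  · exact le_trans (by linarith) (le_abs_self _)
  · exact le_trans (by linarith [neg_abs_le x]) (le_abs_self _)
  · rcases le_total 0 x with h | h
    · exact le_trans (by linarith) (le_abs_self _)
    · rw [abs_of_nonpos h] at hx
      exact le_trans (by linarith) (neg_le_abs _)

end SigmaHyp

/-- Scaling: both transitions of the cutoff take place over lengths comparable to `t/N²`, so one
constant serves for all `N` and `t`. -/
lemma exists_abs_deriv_sigmaHyp_le {σ : ℝ → ℝ} (hσ : IsCutoff σ) : ∃ D, 0 < D ∧ ∀ N t x : ℝ,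
    0 < t / N ^ 2 → |deriv (sigmaHyp σ N t) x| ≤ D * (N ^ 2 / t) := by
  have hσ1 : ContDiff ℝ 1 σ := hσ.contDiff.of_le (by exact_mod_cast le_top)
  have hcs : HasCompactSupport σ := HasCompactSupport.intro (isCompact_Icc (a := -κ) (b := κ))
    fun η hη => by
      refine hσ.eq_zero η ?_
      by_contra h
      exact hη (abs_le.1 (not_le.1 h).le)
  obtain ⟨K, hK⟩ := hcs.deriv.exists_bound_of_continuous (hσ1.continuous_deriv le_rfl)
  have hK0 : 0 ≤ K := (norm_nonneg _).trans (hK 0)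
  refine ⟨4 * K + 1, by positivity, fun N t x hT => ?_⟩
  have hT' : N ^ 2 / t = (t / N ^ 2)⁻¹ := (inv_div _ _).symm
  rw [hT']
  rcases le_or_gt 0 x with h | h
  · rw [deriv_sigmaHyp_of_nonneg hσ hT h, abs_zero]; positivity
  · rw [(sigmaHyp_eventuallyEq_of_neg h).deriv_eq]
    set T := t / N ^ 2
    have d1 : HasDerivAt (fun x => σ (x / (3 * T))) (deriv σ (x / (3 * T)) * (1 / (3 * T))) x :=
      HasDerivAt.comp x (hσ1.differentiable one_ne_zero _).hasDerivAt
        ((hasDerivAt_id x).div_const _)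
    have d2 : HasDerivAt (fun x => σ (κ * x / (1 / 3 * T)))
        (deriv σ (κ * x / (1 / 3 * T)) * (κ * 1 / (1 / 3 * T))) x :=
      HasDerivAt.comp x (hσ1.differentiable one_ne_zero _).hasDerivAt
        (((hasDerivAt_id x).const_mul κ).div_const _)
    rw [(d1.fun_sub d2).deriv]
    have hκ := κ_pos
    have hκ' := κ_le
    have b1 := hK (x / (3 * T))
    have b2 := hK (κ * x / (1 / 3 * T))
    rw [Real.norm_eq_abs] at b1 b2
    refine (abs_sub _ _).trans ?_
    rw [abs_mul, abs_mul, abs_of_pos (by positivity : 0 < 1 / (3 * T)),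
      abs_of_pos (by positivity : 0 < κ * 1 / (1 / 3 * T))]
    calc _ ≤ K * (1 / (3 * T)) + K * (11 / 10 * 1 / (1 / 3 * T)) := by gcongr
      _ = (1 / 3 + 33 / 10) * K * T⁻¹ := by field_simp; ring
      _ ≤ _ := by gcongr; linarith

/-! ### Counting dyadic scales and summing the hyperbolic part -/

lemma dyadic_eq (k : ℤ) : dyadic k = κ ^ k := by
  rw [dyadic, κ, Real.rpow_mul (by norm_num), Real.rpow_intCast]

lemma dyadic_pos (k : ℤ) : 0 < dyadic k := Real.rpow_pos_of_pos (by norm_num) _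

lemma logb_dyadic (k : ℤ) : Real.logb κ (dyadic k) = k := by
  rw [dyadic_eq, ← Real.rpow_intCast, Real.logb_rpow κ_pos one_lt_κ.ne']

lemma mem_Icc_of_dyadic {a b : ℝ} (ha : 0 < a) {k : ℤ} (h1 : a ≤ dyadic k) (h2 : dyadic k ≤ b) :
    k ∈ Finset.Icc ⌈Real.logb κ a⌉ ⌊Real.logb κ b⌋ := by
  rw [Finset.mem_Icc, Int.ceil_le, Int.le_floor, ← logb_dyadic k]
  exact ⟨Real.logb_le_logb_of_le one_lt_κ ha h1,
    Real.logb_le_logb_of_le one_lt_κ (dyadic_pos k) h2⟩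

/-- Dyadic points are equally spaced in `log_κ`, so their number in `[a, c a]` is bounded
independently of `a`. This gives the bounded overlap of the hyperbolic pieces. -/
lemma card_Icc_logb_le {a c : ℝ} (ha : 0 < a) (hc : 1 ≤ c) :
    ((Finset.Icc ⌈Real.logb κ a⌉ ⌊Real.logb κ (c * a)⌋).card : ℝ) ≤ Real.logb κ c + 1 := by
  have h0 : 0 ≤ Real.logb κ c := Real.logb_nonneg one_lt_κ hc
  have h1 : Real.logb κ (c * a) = Real.logb κ c + Real.logb κ a :=
    Real.logb_mul (by positivity) ha.ne'
  rw [Int.card_Icc]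
  have h2 := Int.floor_le (Real.logb κ (c * a))
  have h3 := Int.le_ceil (Real.logb κ a)
  rcases le_total 0 (⌊Real.logb κ (c * a)⌋ + 1 - ⌈Real.logb κ a⌉) with h | h
  · have : (((⌊Real.logb κ (c * a)⌋ + 1 - ⌈Real.logb κ a⌉).toNat : ℤ) : ℝ) =
        ⌊Real.logb κ (c * a)⌋ + 1 - ⌈Real.logb κ a⌉ := by
      rw [Int.toNat_of_nonneg h]; push_cast; ring
    rw [Int.cast_natCast] at this
    rw [this]
    linarith
  · rw [Int.toNat_of_nonpos h]
    push_cast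
    linarith

/-- The summation set `F` may grow with `t`; what counts is the set `S` containing the nonzero
terms. -/
lemma norm_sum_le_card_mul {ι : Type*} {F S : Finset ι} {g : ι → ℂ} {B : ℝ} (hB : 0 ≤ B)
    (h : ∀ k ∈ F, g k ≠ 0 → k ∈ S ∧ ‖g k‖ ≤ B) : ‖∑ k ∈ F, g k‖ ≤ S.card * B := by
  classical
  have e : ∑ k ∈ F, g k = ∑ k ∈ F.filter (fun k => g k ≠ 0), g k :=
    (Finset.sum_filter_ne_zero F).symm
  rw [e]
  refine (norm_sum_le_of_le (n := fun _ => B) _ fun k hk => ?_).trans ?_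
  · obtain ⟨h1, h2⟩ := Finset.mem_filter.1 hk
    exact (h k h1 h2).2
  · rw [Finset.sum_const, nsmul_eq_mul]
    gcongr
    intro k hk
    obtain ⟨h1, h2⟩ := Finset.mem_filter.1 hk
    exact (h k h1 h2).1

/-- Where the cutoff and its derivative live. -/
lemma sigmaHyp_support {σ : ℝ → ℝ} (hσ : IsCutoff σ) {N t x : ℝ} (hN : 0 < N) (ht : 0 < t)
    (h : sigmaHyp σ N t x ≠ 0 ∨ deriv (sigmaHyp σ N t) x ≠ 0) :
    x < 0 ∧ 1 / 4 ≤ |x| / t * N ^ 2 ∧ |x| / t * N ^ 2 ≤ 4 := by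
  have hT : 0 < t / N ^ 2 := by positivity
  have e : |x| / t * N ^ 2 = |x| / (t / N ^ 2) := by field_simp
  rw [e, le_div_iff₀ hT, div_le_iff₀ hT]
  have hκ := κ_le
  have hκ' := inv_κ_ge
  refine ⟨?_, ?_, ?_⟩
  · by_contra hx
    rcases h with h | h
    · exact h (sigmaHyp_of_nonneg σ N t (not_lt.1 hx))
    · exact h (deriv_sigmaHyp_of_nonneg hσ hT (not_lt.1 hx))
  · by_contra hx
    have hx' : |x| < κ⁻¹ * (1 / 3 * (t / N ^ 2)) := by nlinarith
    rcases h with h | h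
    · exact h (sigmaHyp_eq_zero_of_le hσ hT hx'.le)
    · exact h (deriv_sigmaHyp_of_lt hσ hT hx')
  · by_contra hx
    have hx' : κ * (3 * (t / N ^ 2)) < |x| := by nlinarith
    rcases h with h | h
    · exact h (sigmaHyp_eq_zero_of_ge hσ hT hx'.le)
    · exact h (deriv_sigmaHyp_of_gt hσ hT hx')

/-- The hyperbolic part is locally a finite sum. -/
lemma exists_local_sum {σ : ℝ → ℝ} (hσ : IsCutoff σ) {t : ℝ} (ht : 0 < t) (f : ℝ → ℝ) (x : ℝ) :
    ∃ F : Finset ℤ, (∀ k ∈ F, dyadic k ≤ t) ∧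
      (∀ k ∉ F, dyadic k ≤ t → sigmaHyp σ (dyadic k) t x = 0 ∧
        deriv (sigmaHyp σ (dyadic k) t) x = 0) ∧
      uHypPlus σ t f =ᶠ[nhds x] fun y => ∑ k ∈ F, uHypPlusAt σ (dyadic k) t f y := by
  classical
  set X := |x| + 1
  have hX : 0 < X := by positivity
  -- For `|y| ≤ X` a nonzero cutoff needs `N² ≥ t/(4X)`. With `N ≤ t` this confines `N` to a finite
  -- set that serves a whole neighbourhood of `x`.
  set a := √(t / (4 * X))
  have ha : 0 < a := Real.sqrt_pos.2 (by positivity)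
  set F := (Finset.Icc ⌈Real.logb κ a⌉ ⌊Real.logb κ t⌋).filter fun k => dyadic k ≤ t
  have hF : ∀ k ∉ F, dyadic k ≤ t → ∀ y, |y| ≤ X → sigmaHyp σ (dyadic k) t y = 0 ∧
      deriv (sigmaHyp σ (dyadic k) t) y = 0 := by
    intro k hk hkt y hy
    by_contra h
    have h' : sigmaHyp σ (dyadic k) t y ≠ 0 ∨ deriv (sigmaHyp σ (dyadic k) t) y ≠ 0 := by tauto
    obtain ⟨-, h1, -⟩ := sigmaHyp_support hσ (dyadic_pos k) ht h'
    refine hk (Finset.mem_filter.2 ⟨mem_Icc_of_dyadic ha ?_ hkt, hkt⟩)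
    refine Real.sqrt_le_iff.2 ⟨(dyadic_pos k).le, ?_⟩
    have h2 : 1 / 4 ≤ X / t * dyadic k ^ 2 := h1.trans (by gcongr)
    rw [div_mul_eq_mul_div, le_div_iff₀ ht] at h2
    rw [div_le_iff₀ (by positivity)]
    linarith
  refine ⟨F, fun k hk => (Finset.mem_filter.1 hk).2, fun k hk hkt => hF k hk hkt x (by simp [X]), ?_⟩
  have hnear : ∀ᶠ y in nhds x, |y| < X :=
    (continuous_abs.tendsto x).eventually (Iio_mem_nhds (by simp [X]))
  filter_upwards [hnear] with y hy
  refine finsum_mem_eq_sum_of_inter_support_eq _ ?_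
  ext k
  simp only [mem_inter_iff, mem_ofPred_eq, Finset.mem_coe, Function.mem_support]
  refine ⟨fun ⟨h1, h2⟩ => ⟨?_, h2⟩, fun ⟨h1, h2⟩ => ⟨(Finset.mem_filter.1 h1).2, h2⟩⟩
  by_contra h
  exact h2 (by rw [uHypPlusAt, (hF k h h1 y hy.le).1]; simp)

/-- Resonance means `N² y ∈ [1/4, 4]`, so powers of `N` and of `y^{-1/2}` are interchangeable;
`4^{|q|}` covers either sign of the exponent. -/
lemma rpow_le_of_resonant {N y q : ℝ} (hN : 0 < N) (hy : 0 < y) (h1 : 1 / 4 ≤ y * N ^ 2)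
    (h2 : y * N ^ 2 ≤ 4) : N ^ (2 * q) ≤ 4 ^ |q| * y ^ (-q) := by
  have e : N ^ (2 * q) = (y * N ^ 2) ^ q * y ^ (-q) := by
    rw [Real.mul_rpow hy.le (by positivity), mul_right_comm, ← Real.rpow_add hy, add_neg_cancel,
      Real.rpow_zero, one_mul, ← Real.rpow_natCast, ← Real.rpow_mul hN.le]
    norm_num
  rw [e]
  gcongr
  have hz : 0 < y * N ^ 2 := by positivity
  rcases le_total 0 q with hq | hq
  · rw [abs_of_nonneg hq]; gcongr
  · rw [abs_of_nonpos hq, Real.rpow_neg (by norm_num), ← Real.inv_rpow (by norm_num)]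
    exact Real.rpow_le_rpow_of_nonpos (by norm_num) (by linarith) hq

/-- Each branch of `scaleBound` gives one of the two powers in the minimum: `N^{1-s}` the exponent
containing `s`, and `N²` the exponent `-3/4 - j/2`. Here `j` is the number of derivatives. -/
lemma exists_resonant_bound (s j : ℝ) : ∃ c, 0 < c ∧ ∀ N t y : ℝ, 0 < N → 0 < t → 0 < y →
    1 / 4 ≤ y * N ^ 2 → y * N ^ 2 ≤ 4 →
    N ^ (j - 1) * (√(scaleBound s N) * √(N ^ 3 / t)) ≤
      c * (t ^ (-(1 / 2) : ℝ) * min (y ^ (s / 4 - 1 / 2 - j / 2)) (y ^ (-(3 / 4) - j / 2))) := by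
  set q₁ := 1 / 2 - s / 4 + j / 2 with hq₁
  set q₂ := 3 / 4 + j / 2 with hq₂
  have p1 : (0 : ℝ) < 4 ^ |q₁| := by positivity
  have p2 : (0 : ℝ) < 4 ^ |q₂| := by positivity
  refine ⟨4 ^ |q₁| + 4 ^ |q₂|, by positivity, fun N t y hN ht hy h1 h2 => ?_⟩
  have e0 : √(N ^ 3 / t) = N ^ (3 / 2 : ℝ) * t ^ (-(1 / 2) : ℝ) := by
    rw [Real.sqrt_eq_rpow, Real.div_rpow (by positivity) ht.le, Real.rpow_neg ht.le,
      ← Real.rpow_natCast, ← Real.rpow_mul hN.le, div_eq_mul_inv]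
    norm_num
  have ht' : 0 < t ^ (-(1 / 2) : ℝ) := by positivity
  have b1 : N ^ (j - 1) * (√(scaleBound s N) * √(N ^ 3 / t)) ≤
      t ^ (-(1 / 2) : ℝ) * N ^ (2 * q₁) := by
    have : √(scaleBound s N) ≤ N ^ ((1 - s) / 2) := by
      refine (Real.sqrt_le_sqrt (min_le_right _ _)).trans (le_of_eq ?_)
      rw [Real.sqrt_eq_rpow, ← Real.rpow_mul hN.le]; congr 1; ring
    calc _ ≤ N ^ (j - 1) * (N ^ ((1 - s) / 2) * √(N ^ 3 / t)) := by gcongr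
      _ = t ^ (-(1 / 2) : ℝ) * (N ^ (j - 1) * N ^ ((1 - s) / 2) * N ^ (3 / 2 : ℝ)) := by
          rw [e0]; ring
      _ = _ := by rw [← Real.rpow_add hN, ← Real.rpow_add hN]; congr 2; rw [hq₁]; ring
  have b2 : N ^ (j - 1) * (√(scaleBound s N) * √(N ^ 3 / t)) ≤
      t ^ (-(1 / 2) : ℝ) * N ^ (2 * q₂) := by
    have : √(scaleBound s N) ≤ N ^ (1 : ℝ) := by
      refine (Real.sqrt_le_sqrt (min_le_left _ _)).trans (le_of_eq ?_)
      rw [Real.sqrt_sq hN.le, Real.rpow_one]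
    calc _ ≤ N ^ (j - 1) * (N ^ (1 : ℝ) * √(N ^ 3 / t)) := by gcongr
      _ = t ^ (-(1 / 2) : ℝ) * (N ^ (j - 1) * N ^ (1 : ℝ) * N ^ (3 / 2 : ℝ)) := by
          rw [e0]; ring
      _ = _ := by rw [← Real.rpow_add hN, ← Real.rpow_add hN]; congr 2; rw [hq₂]; ring
  have c1 := rpow_le_of_resonant (q := q₁) hN hy h1 h2
  have c2 := rpow_le_of_resonant (q := q₂) hN hy h1 h2
  rw [show s / 4 - 1 / 2 - j / 2 = -q₁ by rw [hq₁]; ring,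
    show -(3 / 4) - j / 2 = -q₂ by rw [hq₂]; ring,
    mul_left_comm (4 ^ |q₁| + 4 ^ |q₂|), mul_min_of_nonneg _ _ (by positivity),
    mul_min_of_nonneg _ _ (by positivity)]
  have y1 : 0 < y ^ (-q₁) := by positivity
  have y2 : 0 < y ^ (-q₂) := by positivity
  refine le_min (b1.trans ?_) (b2.trans ?_)
  · refine mul_le_mul_of_nonneg_left (c1.trans ?_) ht'.le
    gcongr; linarith
  · refine mul_le_mul_of_nonneg_left (c2.trans ?_) ht'.le
    gcongr; linarith

section Hyp

variable {σ : ℝ → ℝ} {t : ℝ} {f : ℝ → ℝ}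

lemma hasDerivAt_sum_uHypPlusAt (hσ : IsCutoff σ) (ht : 0 < t)
    (hu : ∀ k, ContDiff ℝ 1 (uPlusAt σ (dyadic k) f)) (F : Finset ℤ) (x : ℝ) :
    HasDerivAt (fun y => ∑ k ∈ F, uHypPlusAt σ (dyadic k) t f y)
      (∑ k ∈ F, (((deriv (sigmaHyp σ (dyadic k) t) x : ℝ) : ℂ) * uPlusAt σ (dyadic k) f x +
        (sigmaHyp σ (dyadic k) t x : ℂ) * deriv (uPlusAt σ (dyadic k) f) x)) x := by
  refine HasDerivAt.fun_sum fun k _ => ?_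
  have hT : 0 < t / dyadic k ^ 2 := div_pos ht (pow_pos (dyadic_pos k) 2)
  exact (((contDiff_sigmaHyp hσ hT).differentiable one_ne_zero x).hasDerivAt.ofReal_comp).mul
    ((hu k).differentiable one_ne_zero x).hasDerivAt

lemma contDiff_uHypPlus (hσ : IsCutoff σ) (ht : 0 < t)
    (hu : ∀ k, ContDiff ℝ 1 (uPlusAt σ (dyadic k) f)) : ContDiff ℝ 1 (uHypPlus σ t f) := by
  rw [contDiff_iff_contDiffAt]
  intro x
  obtain ⟨F, -, -, h⟩ := exists_local_sum hσ ht f x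
  refine ContDiffAt.congr_of_eventuallyEq (ContDiff.contDiffAt ?_) h
  refine ContDiff.sum fun k _ => ?_
  have hT : 0 < t / dyadic k ^ 2 := div_pos ht (pow_pos (dyadic_pos k) 2)
  exact (Complex.ofRealCLM.contDiff.comp (contDiff_sigmaHyp hσ hT)).mul (hu k)

/-- Every point where the cutoff lives is stationary for a comparable frequency. -/
lemma exists_stationary {N x : ℝ} (hN : 0 < N) (ht : 0 < t) (hx : x < 0)
    (h1 : 1 / 4 ≤ |x| / t * N ^ 2) (h2 : |x| / t * N ^ 2 ≤ 4) :
    ∃ ξ₀ ∈ Icc (N / 2) (2 * N), x = -(t / ξ₀ ^ 2) := by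
  have hx' : 0 < |x| := abs_pos.2 hx.ne
  rw [div_mul_eq_mul_div, le_div_iff₀ ht] at h1
  rw [div_mul_eq_mul_div, div_le_iff₀ ht] at h2
  refine ⟨√(t / |x|), ⟨?_, ?_⟩, ?_⟩
  · refine Real.le_sqrt_of_sq_le ?_
    rw [le_div_iff₀ hx']
    nlinarith
  · refine Real.sqrt_le_iff.2 ⟨by positivity, ?_⟩
    rw [div_le_iff₀ hx']
    nlinarith
  · rw [Real.sq_sqrt (by positivity), div_div_cancel₀ ht.ne', abs_of_neg hx, neg_neg]

end Hyp

/-- Wherever the cutoff or its derivative is nonzero, `x` is stationary for a frequency comparable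
to `N`, so the resonant bound applies term by term, and the number of terms is bounded. -/
theorem hyperbolic_bounds {σ : ℝ → ℝ} (hσ : IsCutoff σ) {s : ℝ} (hs : 3 / 2 < s) :
    ∃ C, 0 < C ∧ ∀ (f : ℝ → ℝ) (t : ℝ), 1 ≤ t → MemX s t f →
      ContDiff ℝ 1 (uHypPlus σ t f) ∧
      (∀ x, ‖uHypPlus σ t f x‖ ≤ C * (t ^ (-(1 / 2) : ℝ) *
        min ((|x| / t) ^ (s / 4 - 1 / 2)) ((|x| / t) ^ (-(3 / 4) : ℝ)) * xNorm s t f)) ∧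
      (∀ x, ‖deriv (uHypPlus σ t f) x‖ ≤ C * (t ^ (-(1 / 2) : ℝ) *
        min ((|x| / t) ^ (s / 4 - 1)) ((|x| / t) ^ (-(5 / 4) : ℝ)) * xNorm s t f)) := by
  obtain ⟨M, hM, hMb⟩ := exists_pieceBound hσ hs
  obtain ⟨D, hD, hDb⟩ := exists_abs_deriv_sigmaHyp_le hσ
  obtain ⟨c₀, hc₀, hc₀b⟩ := exists_resonant_bound s 0
  obtain ⟨c₁, hc₁, hc₁b⟩ := exists_resonant_bound s 1
  set n := Real.logb κ 4 + 1
  have hn : 0 < n := by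
    have := Real.logb_nonneg one_lt_κ (by norm_num : (1 : ℝ) ≤ 4)
    positivity
  refine ⟨n * M * c₀ + n * ((D + 1) * M * c₁), by positivity, fun f t ht1 hf => ?_⟩
  have ht : 0 < t := by linarith
  have hA : 0 ≤ xNorm s t f := xNorm_nonneg
  have hP := fun k => hMb f t ht hf (dyadic k) (dyadic_pos k)
  set A := xNorm s t f
  have hu := fun k => (hP k).contDiff
  have hcard : ∀ x : ℝ, x < 0 → ∃ S : Finset ℤ, (S.card : ℝ) ≤ n ∧ ∀ k,
      1 / 4 ≤ |x| / t * dyadic k ^ 2 → |x| / t * dyadic k ^ 2 ≤ 4 → k ∈ S := by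
    intro x hx
    have hx' : 0 < |x| := abs_pos.2 hx.ne
    -- The condition `1/4 ≤ |x| N²/t ≤ 4` reads `a ≤ N ≤ 4a`.
    set a := √(t / (4 * |x|))
    have ha : 0 < a := Real.sqrt_pos.2 (by positivity)
    refine ⟨_, card_Icc_logb_le ha (by norm_num : (1 : ℝ) ≤ 4), fun k h1 h2 => ?_⟩
    rw [div_mul_eq_mul_div, le_div_iff₀ ht] at h1
    rw [div_mul_eq_mul_div, div_le_iff₀ ht] at h2
    refine mem_Icc_of_dyadic ha ?_ ?_
    · refine Real.sqrt_le_iff.2 ⟨(dyadic_pos k).le, ?_⟩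
      rw [div_le_iff₀ (by positivity)]
      linarith
    · refine abs_le_of_sq_le_sq' ?_ (by positivity) |>.2
      rw [mul_pow, Real.sq_sqrt (by positivity), mul_div_assoc', le_div_iff₀ (by positivity)]
      linarith
  refine ⟨contDiff_uHypPlus hσ ht hu, fun x => ?_, fun x => ?_⟩
  · obtain ⟨F, hF1, -, hF3⟩ := exists_local_sum hσ ht f x
    rw [hF3.eq_of_nhds]
    rcases le_or_gt 0 x with hx | hx
    -- For `x ≥ 0` every cutoff vanishes; this covers `x = 0`, where the negative power on the right
    -- takes the value `0`.
    · rw [Finset.sum_eq_zero fun k _ => by rw [uHypPlusAt, sigmaHyp_of_nonneg _ _ _ hx]; simp,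
        norm_zero]
      positivity
    · have hy : 0 < |x| / t := div_pos (abs_pos.2 hx.ne) ht
      obtain ⟨S, hS, hSm⟩ := hcard x hx
      set Y := t ^ (-(1 / 2) : ℝ) * min ((|x| / t) ^ (s / 4 - 1 / 2)) ((|x| / t) ^ (-(3 / 4) : ℝ))
      have hY : 0 ≤ Y := by positivity
      have key := norm_sum_le_card_mul (F := F) (S := S)
        (g := fun k => uHypPlusAt σ (dyadic k) t f x) (B := M * A * (c₀ * Y)) (by positivity)
        (fun k hk hne => by
          have h0 : sigmaHyp σ (dyadic k) t x ≠ 0 := fun h => hne (by simp [uHypPlusAt, h])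
          obtain ⟨-, h1, h2⟩ := sigmaHyp_support hσ (dyadic_pos k) ht (Or.inl h0)
          refine ⟨hSm k h1 h2, ?_⟩
          obtain ⟨ξ₀, hξ₀, hxe⟩ := exists_stationary (dyadic_pos k) ht hx h1 h2
          have b := (hP k).norm_le_res ξ₀ hξ₀
          rw [← hxe] at b
          have b2 := hc₀b (dyadic k) t (|x| / t) (dyadic_pos k) ht hy h1 h2
          rw [zero_sub, Real.rpow_neg_one, zero_div, sub_zero, sub_zero] at b2
          rw [uHypPlusAt, norm_mul, Complex.norm_real]
          refine (mul_le_of_le_one_left (norm_nonneg _) (abs_sigmaHyp_le_one hσ x)).trans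
            (b.trans ?_)
          gcongr)
      refine key.trans ?_
      calc _ ≤ n * (M * A * (c₀ * Y)) := by gcongr
        _ = n * M * c₀ * (Y * A) := by ring
        _ ≤ _ := by gcongr; linarith [(by positivity : 0 ≤ n * ((D + 1) * M * c₁))]
  · obtain ⟨F, hF1, -, hF3⟩ := exists_local_sum hσ ht f x
    rw [hF3.deriv_eq, (hasDerivAt_sum_uHypPlusAt hσ ht hu F x).deriv]
    rcases le_or_gt 0 x with hx | hx
    · rw [Finset.sum_eq_zero fun k _ => by
        rw [sigmaHyp_of_nonneg _ _ _ hx,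
          deriv_sigmaHyp_of_nonneg hσ (div_pos ht (pow_pos (dyadic_pos k) 2)) hx]; simp,
        norm_zero]
      positivity
    · have hy : 0 < |x| / t := div_pos (abs_pos.2 hx.ne) ht
      obtain ⟨S, hS, hSm⟩ := hcard x hx
      set Y := t ^ (-(1 / 2) : ℝ) * min ((|x| / t) ^ (s / 4 - 1)) ((|x| / t) ^ (-(5 / 4) : ℝ))
        with hYdef
      have hY : 0 ≤ Y := by positivity
      have key := norm_sum_le_card_mul (F := F) (S := S)
        (g := fun k => ((deriv (sigmaHyp σ (dyadic k) t) x : ℝ) : ℂ) * uPlusAt σ (dyadic k) f x +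
        (sigmaHyp σ (dyadic k) t x : ℂ) * deriv (uPlusAt σ (dyadic k) f) x)
        (B := (D + 1) * (M * A * (c₁ * Y))) (by positivity)
        (fun k hk hne => by
          have h0 : sigmaHyp σ (dyadic k) t x ≠ 0 ∨ deriv (sigmaHyp σ (dyadic k) t) x ≠ 0 := by
            by_contra h
            rw [not_or, not_not, not_not] at h
            exact hne (by simp [h])
          have hN := dyadic_pos k
          obtain ⟨-, h1, h2⟩ := sigmaHyp_support hσ hN ht h0
          refine ⟨hSm k h1 h2, ?_⟩
          obtain ⟨ξ₀, hξ₀, hxe⟩ := exists_stationary hN ht hx h1 h2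
          have b := (hP k).norm_le_res ξ₀ hξ₀
          have b' := (hP k).norm_deriv_le_res ξ₀ hξ₀
          rw [← hxe] at b b'
          have b2 := hc₁b (dyadic k) t (|x| / t) hN ht hy h1 h2
          rw [sub_self, Real.rpow_zero, one_mul,
            show s / 4 - 1 / 2 - 1 / 2 = s / 4 - 1 by ring,
            show -(3 / 4) - (1 : ℝ) / 2 = -(5 / 4) by norm_num, ← hYdef] at b2
          have b3 := hDb (dyadic k) t x (by positivity)
          have hNt := hF1 k hk
          refine (norm_add_le _ _).trans ?_
          rw [norm_mul, norm_mul, Complex.norm_real, Complex.norm_real]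
          set Z := √(scaleBound s (dyadic k)) * √(dyadic k ^ 3 / t)
          have hZ : 0 ≤ Z := by positivity
          -- Differentiating the cutoff costs `N²/t` while `u_N⁺` is better than its derivative by
          -- `N⁻¹`. The net factor `N/t` is at most `1` precisely because only `N ≤ t` enter the
          -- sum.
          have r : dyadic k ^ 2 / t * (dyadic k)⁻¹ ≤ 1 := by
            rw [div_mul_eq_mul_div, div_le_one ht, sq, mul_assoc, mul_inv_cancel₀ hN.ne', mul_one]
            exact hNt
          calc _ ≤ D * (dyadic k ^ 2 / t) * (M * A * ((dyadic k)⁻¹ * Z)) + 1 * (M * A * Z) := by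
                have := abs_sigmaHyp_le_one hσ (N := dyadic k) (t := t) x
                rw [← Real.norm_eq_abs] at this b3
                gcongr
            _ = D * (M * A * Z) * (dyadic k ^ 2 / t * (dyadic k)⁻¹) + M * A * Z := by ring
            _ ≤ D * (M * A * Z) * 1 + M * A * Z := by gcongr
            _ = (D + 1) * (M * A * Z) := by ring
            _ ≤ _ := by gcongr)
      refine key.trans ?_
      calc _ ≤ n * ((D + 1) * (M * A * (c₁ * Y))) := by gcongr
        _ = n * ((D + 1) * M * c₁) * (Y * A) := by ring
        _ ≤ _ := by gcongr; linarith [(by positivity : 0 ≤ n * M * c₀)]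

/-! ### The dyadic partition of unity and summation of the elliptic part -/

section Partition

variable {σ : ℝ → ℝ} (hσ : IsCutoff σ)
include hσ

lemma IsCutoff.ampl_nonneg (η : ℝ) : 0 ≤ ampl σ η := by
  by_cases h : 0 < η
  · rw [ampl, indicator_of_mem (mem_Ioi.2 h)]
    rcases le_total η 1 with h1 | h1
    · rw [hσ.eq_one η (by rwa [abs_of_pos h])]
      linarith [hσ.le_one (κ * η)]
    · have h2 : κ ≤ |κ * η| := by
        rw [abs_of_pos (mul_pos κ_pos h)]
        exact le_mul_of_one_le_right κ_pos.le h1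
      rw [hσ.eq_zero (κ * η) h2]
      linarith [hσ.nonneg η]
  · rw [ampl, indicator_of_notMem (by simpa using h)]

/-- The dyadic partition of unity on positive frequencies. -/
lemma hasSum_ampl (ξ : ℝ) : HasSum (fun k : ℤ => ampl σ (ξ / dyadic k))
    ((Ioi (0 : ℝ)).indicator (fun _ => 1) ξ) := by
  have hκ := κ_pos
  by_cases h : 0 < ξ
  · obtain ⟨k₀, h1, h2⟩ := exists_mem_Ico_zpow h one_lt_κ
    -- With `κ^{k₀} ≤ ξ < κ^{k₀+1}` the two terms telescope to a cutoff equal to `1` minus a cutoff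
    -- equal to `0`.
    have e : ∑ k ∈ ({k₀, k₀ + 1} : Finset ℤ), ampl σ (ξ / dyadic k) = 1 := by
      rw [Finset.sum_pair (by simp)]
      have hd : ∀ k, ampl σ (ξ / dyadic k) = σ (ξ / κ ^ k) - σ (ξ / κ ^ (k - 1)) := by
        intro k
        rw [ampl, indicator_of_mem (mem_Ioi.2 (div_pos h (dyadic_pos k))), dyadic_eq,
          zpow_sub_one₀ hκ.ne']
        congr 2
        field_simp
      rw [hd, hd, add_sub_cancel_right]
      have a1 : |ξ / κ ^ (k₀ + 1)| ≤ 1 := by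
        rw [abs_of_pos (by positivity), div_le_one (by positivity)]
        exact h2.le
      have a2 : κ ≤ |ξ / κ ^ (k₀ - 1)| := by
        rw [abs_of_pos (by positivity), le_div_iff₀ (by positivity), zpow_sub_one₀ hκ.ne']
        refine le_trans (le_of_eq ?_) h1
        field_simp
      rw [hσ.eq_one _ a1, hσ.eq_zero _ a2]
      ring
    rw [indicator_of_mem (mem_Ioi.2 h), ← e]
    refine hasSum_sum_of_ne_finset_zero fun k hk => ?_
    simp only [Finset.mem_insert, Finset.mem_singleton, not_or] at hk
    rw [dyadic_eq]
    rcases lt_or_ge k k₀ with h3 | h3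
    · refine hσ.ampl_eq_zero_right ?_
      rw [le_div_iff₀ (by positivity), ← zpow_one_add₀ hκ.ne']
      exact (zpow_le_zpow_right₀ one_lt_κ.le (by omega)).trans h1
    · refine hσ.ampl_eq_zero_left ?_
      rw [div_le_iff₀ (by positivity), ← zpow_neg_one, ← zpow_add₀ hκ.ne']
      exact h2.le.trans (zpow_le_zpow_right₀ one_lt_κ.le (by omega))
  · rw [indicator_of_notMem (by simpa using h)]
    have : ∀ k : ℤ, ampl σ (ξ / dyadic k) = 0 := fun k => hσ.ampl_eq_zero_left
      ((div_nonpos_of_nonpos_of_nonneg (not_lt.1 h) (dyadic_pos k).le).trans (by positivity))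
    simp only [this]
    exact hasSum_zero

/-- Dominated convergence: the amplitudes are nonnegative and sum to the indicator of `ξ > 0`, so
the sum of the absolute values is at most `|b|`. -/
lemma hasSum_invInt {b : ℝ → ℂ} (hb : Integrable b) (x : ℝ) :
    HasSum (fun k : ℤ => invInt (fun ξ => (ampl σ (ξ / dyadic k) : ℂ) * b ξ) x)
      (invInt (fun ξ => (Ioi (0 : ℝ)).indicator (fun _ => 1) ξ * b ξ) x) := by
  refine HasSum.mul_left _ ?_
  have hs : ∀ ξ, HasSum (fun k : ℤ => ampl σ (ξ / dyadic k) * ‖b ξ‖)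
      ((Ioi (0 : ℝ)).indicator (fun _ => 1) ξ * ‖b ξ‖) := fun ξ => (hasSum_ampl hσ ξ).mul_right _
  refine hasSum_integral_of_dominated_convergence
    (fun k ξ => ampl σ (ξ / dyadic k) * ‖b ξ‖) (fun k => ?_) (fun k => ?_) ?_ ?_ ?_
  · have hc := hσ.contDiff_ampl.continuous
    refine AEStronglyMeasurable.mul (by fun_prop) (AEStronglyMeasurable.mul ?_ hb.1)
    exact (by fun_prop : Continuous fun ξ : ℝ => (ampl σ (ξ / dyadic k) : ℂ)).aestronglyMeasurable
  · refine Filter.Eventually.of_forall fun ξ => ?_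
    rw [norm_mul, norm_exp_I_mul, one_mul, norm_mul, Complex.norm_real,
      Real.norm_of_nonneg (hσ.ampl_nonneg _)]
  · exact Filter.Eventually.of_forall fun ξ => (hs ξ).summable
  · have := hb.norm.indicator (measurableSet_Ioi (a := (0 : ℝ)))
    refine this.congr (Filter.Eventually.of_forall fun ξ => ?_)
    trans (Ioi (0 : ℝ)).indicator (fun _ => (1 : ℝ)) ξ * ‖b ξ‖
    · by_cases h : ξ ∈ Ioi (0 : ℝ)
      · rw [indicator_of_mem h, indicator_of_mem h, one_mul]
      · rw [indicator_of_notMem h, indicator_of_notMem h, zero_mul]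
    · exact (hs ξ).tsum_eq.symm
  · refine Filter.Eventually.of_forall fun ξ => ?_
    refine HasSum.mul_left _ (HasSum.mul_right _ ?_)
    have := Complex.hasSum_ofReal.2 (hasSum_ampl hσ ξ)
    have e : (((Ioi (0 : ℝ)).indicator (fun _ => (1 : ℝ)) ξ : ℝ) : ℂ) =
        (Ioi (0 : ℝ)).indicator (fun _ => (1 : ℂ)) ξ := by
      by_cases h : ξ ∈ Ioi (0 : ℝ)
      · rw [indicator_of_mem h, indicator_of_mem h, Complex.ofReal_one]
      · rw [indicator_of_notMem h, indicator_of_notMem h, Complex.ofReal_zero]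
    rw [← e]
    exact this

end Partition

/-- Summation of a bound peaked at the scale `t^{1/(a+b)}`. -/
lemma exists_hasSum_min {a b : ℝ} (ha : 0 < a) (hb : 0 < b) : ∃ C, 0 < C ∧ ∀ t : ℝ, 0 < t →
    ∃ g : ℤ → ℝ, HasSum g (C * t ^ (-(b / (a + b)))) ∧
      ∀ k, min (dyadic k ^ a / t) (dyadic k ^ (-b)) ≤ g k := by
  have hκ := κ_pos
  set c := min a b
  have hc : 0 < c := lt_min ha hb
  set r := κ ^ (-c)
  have hr0 : 0 < r := by positivity
  have hr1 : r < 1 := Real.rpow_lt_one_of_one_lt_of_neg one_lt_κ (by linarith)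
  have hsum : Summable fun j : ℤ => r ^ j.natAbs := by
    refine Summable.of_nat_of_neg ?_ ?_ <;> simpa using summable_geometric_of_lt_one hr0.le hr1
  set S := ∑' j : ℤ, r ^ j.natAbs
  have hS : 0 < S := hsum.tsum_pos (fun j => by positivity) 0 (by positivity)
  refine ⟨κ ^ c * S, by positivity, fun t ht => ?_⟩
  -- `P` is the scale at which `N^a/t` and `N^{-b}` agree, with common value `P^{-b}`.
  set P := t ^ (1 / (a + b)) with hPdef
  have hP : 0 < P := by positivity
  set μ := Real.logb κ P
  have hPμ : P = κ ^ μ := (Real.rpow_logb κ_pos one_lt_κ.ne' hP).symm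
  have hPt : P ^ (a + b) = t := by
    rw [hPdef, ← Real.rpow_mul ht.le, one_div_mul_cancel (by positivity), Real.rpow_one]
  have hPb : t ^ (-(b / (a + b))) = P ^ (-b) := by
    rw [hPdef, ← Real.rpow_mul ht.le]; congr 1; ring
  -- Away from `P` the minimum decays at least like `κ^{-c|k-μ|}`. The majorant is centred at `⌊μ⌋`
  -- to be a translate of one fixed geometric series, and the factor `κ^c` pays for the rounding.
  refine ⟨fun k => P ^ (-b) * κ ^ c * r ^ (k - ⌊μ⌋).natAbs, ?_, fun k => ?_⟩
  · have h := ((Equiv.subRight ⌊μ⌋).hasSum_iff.2 hsum.hasSum).mul_left (P ^ (-b) * κ ^ c)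
    rw [hPb, show κ ^ c * S * P ^ (-b) = P ^ (-b) * κ ^ c * S by ring]
    exact h
  · have hN : dyadic k = κ ^ ((k : ℝ) - μ) * P := by
      rw [hPμ, ← Real.rpow_add κ_pos, sub_add_cancel, Real.rpow_intCast, dyadic_eq]
    set θ := (k : ℝ) - μ
    have h1 : dyadic k ^ a / t = P ^ (-b) * κ ^ (θ * a) := by
      rw [hN, Real.mul_rpow (by positivity) hP.le, ← hPt, Real.rpow_add hP, Real.rpow_neg hP.le,
        ← Real.rpow_mul hκ.le]
      field_simp
    have h2 : dyadic k ^ (-b) = P ^ (-b) * κ ^ (θ * -b) := by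
      rw [hN, Real.mul_rpow (by positivity) hP.le, ← Real.rpow_mul hκ.le]
      ring
    have h3 : κ ^ (-c * |θ|) ≤ κ ^ c * r ^ (k - ⌊μ⌋).natAbs := by
      rw [← Real.rpow_natCast, ← Real.rpow_mul hκ.le, ← Real.rpow_add hκ]
      refine Real.rpow_le_rpow_of_exponent_le one_lt_κ.le ?_
      have h4 : (((k - ⌊μ⌋).natAbs : ℕ) : ℝ) = |(k : ℝ) - ⌊μ⌋| := by
        rw [← Int.cast_natCast, Int.natCast_natAbs]; push_cast; rfl
      have h5 : |(k : ℝ) - ⌊μ⌋| ≤ |θ| + 1 := by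
        have e : (k : ℝ) - ⌊μ⌋ = θ + (μ - ⌊μ⌋) := by simp only [θ]; ring
        rw [e]
        refine (abs_add_le _ _).trans ?_
        have h6 : |μ - ⌊μ⌋| ≤ 1 := by
          rw [abs_le]
          constructor <;> linarith [Int.floor_le μ, Int.lt_floor_add_one μ]
        linarith
      rw [h4]
      nlinarith
    have h7 : min (κ ^ (θ * a)) (κ ^ (θ * -b)) ≤ κ ^ (-c * |θ|) := by
      rcases le_total 0 θ with h | h
      · refine (min_le_right _ _).trans (Real.rpow_le_rpow_of_exponent_le one_lt_κ.le ?_)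
        rw [abs_of_nonneg h]
        nlinarith [min_le_right a b]
      · refine (min_le_left _ _).trans (Real.rpow_le_rpow_of_exponent_le one_lt_κ.le ?_)
        rw [abs_of_nonpos h]
        nlinarith [min_le_left a b]
    rw [h1, h2, ← mul_min_of_nonneg _ _ (by positivity)]
    beta_reduce
    rw [mul_assoc]
    gcongr
    exact h7.trans h3

/-- The bounds for pieces without stationary points. -/
lemma PieceBound.elliptic {s t A M N x : ℝ} {v : ℝ → ℂ} (P : PieceBound s t A M v N) (hs : 0 ≤ s)
    (hMA : 0 ≤ M * A) (hN : 0 < N) (ht : 1 ≤ t)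
    (h : (∀ ξ ∈ Icc (κ⁻¹ * N) (κ * N), t / (4 * N ^ 2) ≤ |x + t / ξ ^ 2|) ∨ t < N) :
    ‖v x‖ ≤ M * A * min (N ^ (3 / 2 : ℝ) / t) (N ^ (-(s - 1 / 2))) ∧
    ‖deriv v x‖ ≤ M * A * min (N ^ (5 / 2 : ℝ) / t) (N ^ (-(s - 3 / 2))) := by
  have ht0 : 0 < t := by linarith
  have hβ : scaleBound s N ≤ N ^ (1 - s) := min_le_right _ _
  have e0 : N⁻¹ * (N ^ (1 - s) * √N) = N ^ (-(s - 1 / 2)) := by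
    rw [← Real.rpow_neg_one, Real.sqrt_eq_rpow, ← Real.rpow_add hN, ← Real.rpow_add hN]
    congr 1; ring
  have e1 : N ^ (1 - s) * √N = N ^ (-(s - 3 / 2)) := by
    rw [Real.sqrt_eq_rpow, ← Real.rpow_add hN]; congr 1; ring
  have e2 : N ^ 2 * √N = N ^ (5 / 2 : ℝ) := by
    rw [← Real.rpow_natCast, Real.sqrt_eq_rpow, ← Real.rpow_add hN]; norm_num
  have e3 : N⁻¹ * (N ^ 2 * √N) = N ^ (3 / 2 : ℝ) := by
    rw [e2, ← Real.rpow_neg_one, ← Real.rpow_add hN]; norm_num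
  have t0 : ‖v x‖ ≤ M * A * N ^ (-(s - 1 / 2)) := by
    refine (P.norm_le x).trans ?_
    rw [← e0]
    gcongr
  have t1 : ‖deriv v x‖ ≤ M * A * N ^ (-(s - 3 / 2)) := by
    refine (P.norm_deriv_le x).trans ?_
    rw [← e1]
    gcongr
  rcases h with h | h
  · have n0 := P.norm_le_nonres x h
    have n1 := P.norm_deriv_le_nonres x h
    rw [mul_div_assoc', e3] at n0
    rw [e2] at n1
    rw [mul_min_of_nonneg _ _ hMA, mul_min_of_nonneg _ _ hMA]
    exact ⟨le_min n0 t0, le_min n1 t1⟩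
  -- For `N > t` no phase information is needed: the trivial bound is already the smaller entry of
  -- the minimum.
  · have hN1 : 1 ≤ N := ht.trans h.le
    have c : ∀ p q : ℝ, -p ≤ q - 1 → N ^ (-p) ≤ N ^ q / t := by
      intro p q hpq
      rw [le_div_iff₀ ht0]
      calc N ^ (-p) * t ≤ N ^ (q - 1) * N := by gcongr
        _ = N ^ q := by rw [← Real.rpow_add_one hN.ne', sub_add_cancel]
    rw [min_eq_right (c _ _ (by linarith)), min_eq_right (c _ _ (by linarith))]
    exact ⟨t0, t1⟩

section Ell

variable {σ : ℝ → ℝ} {s t : ℝ} {f : ℝ → ℝ}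

lemma integrable_indicator_mul {b : ℝ → ℂ} (hb : Integrable b) :
    Integrable fun ξ => (Ioi (0 : ℝ)).indicator (fun _ => (1 : ℂ)) ξ * b ξ := by
  refine (hb.indicator (measurableSet_Ioi (a := (0 : ℝ)))).congr
    (Filter.Eventually.of_forall fun ξ => ?_)
  by_cases h : ξ ∈ Ioi (0 : ℝ) <;> simp [h]

lemma MemX.integrable_uPlus (hf : MemX s t f) (hs : 3 / 2 < s) :
    Integrable (fun ξ => (Ioi (0 : ℝ)).indicator (fun _ => (1 : ℂ)) ξ * hat (ShortPulse.cplx f) ξ) ∧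
    Integrable (fun ξ : ℝ => (ξ : ℂ) *
      ((Ioi (0 : ℝ)).indicator (fun _ => (1 : ℂ)) ξ * hat (ShortPulse.cplx f) ξ)) := by
  refine ⟨integrable_indicator_mul (hf.integrable_hat hs), ?_⟩
  refine (integrable_indicator_mul (hf.integrable_mul_hat hs)).congr
    (Filter.Eventually.of_forall fun ξ => by ring)

lemma hasSum_uPlusAt (hσ : IsCutoff σ) (hf : MemX s t f) (hs : 3 / 2 < s) (x : ℝ) :
    HasSum (fun k : ℤ => uPlusAt σ (dyadic k) f x) (uPlus f x) := by
  rw [uPlus, multiplier_eq]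
  have := hasSum_invInt hσ (hf.integrable_hat hs) x
  simpa only [← uPlusAt_eq_invInt (dyadic_pos _)] using this

lemma hasSum_deriv_uPlusAt (hσ : IsCutoff σ) (hf : MemX s t f) (hs : 3 / 2 < s) (x : ℝ) :
    HasSum (fun k : ℤ => deriv (uPlusAt σ (dyadic k) f) x) (deriv (uPlus f) x) := by
  have hi : Integrable fun ξ : ℝ => Complex.I * ξ * hat (cplx f) ξ := by
    simpa [mul_assoc] using (hf.integrable_mul_hat hs).const_mul Complex.I
  have h := hasSum_invInt hσ hi x
  obtain ⟨i1, i2⟩ := hf.integrable_uPlus hs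
  have e1 : deriv (uPlus f) x =
      invInt (fun ξ => (Ioi (0 : ℝ)).indicator (fun _ => 1) ξ * (Complex.I * ξ * hat (cplx f) ξ)) x := by
    rw [uPlus, multiplier_eq, (hasDerivAt_invInt i1 i2 x).deriv]
    congr 1; ext ξ; ring
  have e2 : ∀ k : ℤ, deriv (uPlusAt σ (dyadic k) f) x =
      invInt (fun ξ => (ampl σ (ξ / dyadic k) : ℂ) * (Complex.I * ξ * hat (cplx f) ξ)) x := by
    intro k
    obtain ⟨j1, j2⟩ := integrable_ampl_mul_hat hσ hf hs (N := dyadic k)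
    rw [uPlusAt_eq_invInt (dyadic_pos k), (hasDerivAt_invInt j1 j2 x).deriv]
    congr 1; ext ξ; ring
  rw [e1]
  simpa only [e2] using h

end Ell

/-- At each `x` the difference `u⁺ - u^{hyp,+}` is summed over all dyadic `N`. A term with `N ≤ t`
and `x` in the region where the cutoff is `1` is exactly zero, so no resonant contribution survives
and `exists_hasSum_min` handles the rest. -/
theorem elliptic_bounds {σ : ℝ → ℝ} (hσ : IsCutoff σ) {s : ℝ} (hs : 3 / 2 < s) :
    ∃ C, 0 < C ∧ ∀ (f : ℝ → ℝ) (t : ℝ), 1 ≤ t → MemX s t f →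
      ContDiff ℝ 1 (uEllPlus σ t f) ∧
      (∀ x, ‖uEllPlus σ t f x‖ ≤ C * (t ^ (-((2 * s - 1) / (2 * s + 2))) * xNorm s t f)) ∧
      (∀ x, ‖deriv (uEllPlus σ t f) x‖ ≤
        C * (t ^ (-((2 * s - 3) / (2 * s + 2))) * xNorm s t f)) := by
  classical
  obtain ⟨M, hM, hMb⟩ := exists_pieceBound hσ hs
  obtain ⟨D, hD, hDb⟩ := exists_abs_deriv_sigmaHyp_le hσ
  obtain ⟨c₀, hc₀, hc₀b⟩ := exists_hasSum_min (a := 3 / 2) (b := s - 1 / 2) (by norm_num)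
    (by linarith)
  obtain ⟨c₁, hc₁, hc₁b⟩ := exists_hasSum_min (a := 5 / 2) (b := s - 3 / 2) (by norm_num)
    (by linarith)
  rw [show (s - 1 / 2) / (3 / 2 + (s - 1 / 2)) = (2 * s - 1) / (2 * s + 2) by
    rw [div_eq_div_iff (by linarith) (by linarith)]; ring] at hc₀b
  rw [show (s - 3 / 2) / (5 / 2 + (s - 3 / 2)) = (2 * s - 3) / (2 * s + 2) by
    rw [div_eq_div_iff (by linarith) (by linarith)]; ring] at hc₁b
  refine ⟨2 * M * c₀ + (D + 2) * M * c₁, by positivity, fun f t ht1 hf => ?_⟩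
  have ht : 0 < t := by linarith
  have hA : 0 ≤ xNorm s t f := xNorm_nonneg
  have hP := fun k => hMb f t ht hf (dyadic k) (dyadic_pos k)
  set A := xNorm s t f
  have hMA : 0 ≤ M * A := by positivity
  have hu := fun k => (hP k).contDiff
  obtain ⟨i1, i2⟩ := hf.integrable_uPlus hs
  have hplus : ContDiff ℝ 1 (uPlus f) := contDiff_invInt i1 i2
  have hhyp := contDiff_uHypPlus hσ ht hu
  have hT : ∀ k, 0 < t / dyadic k ^ 2 := fun k => div_pos ht (pow_pos (dyadic_pos k) 2)
  have nonres : ∀ k x, ¬ (x < 0 ∧ 1 / 3 * (t / dyadic k ^ 2) < |x| ∧ |x| < 3 * (t / dyadic k ^ 2)) →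
      ‖uPlusAt σ (dyadic k) f x‖ ≤ M * A *
        min (dyadic k ^ (3 / 2 : ℝ) / t) (dyadic k ^ (-(s - 1 / 2))) ∧
      ‖deriv (uPlusAt σ (dyadic k) f) x‖ ≤ M * A *
        min (dyadic k ^ (5 / 2 : ℝ) / t) (dyadic k ^ (-(s - 3 / 2))) := by
    intro k x h
    refine (hP k).elliptic (by linarith) hMA (dyadic_pos k) ht1 (Or.inl ?_)
    refine nonresonant (hT k) ht (dyadic_pos k) ?_
    by_contra h'
    simp only [not_or, not_le] at h'
    exact h h'
  -- Off `F` the piece `u_N⁺` enters unmodified: either `N ≤ t` and the cutoff vanishes at `x`, so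
  -- `x` is nonresonant, or `N > t`.
  have outside : ∀ (F : Finset ℤ) x, (∀ k ∉ F, dyadic k ≤ t → sigmaHyp σ (dyadic k) t x = 0 ∧
        deriv (sigmaHyp σ (dyadic k) t) x = 0) → ∀ k ∉ F,
      ‖uPlusAt σ (dyadic k) f x‖ ≤ M * A *
        min (dyadic k ^ (3 / 2 : ℝ) / t) (dyadic k ^ (-(s - 1 / 2))) ∧
      ‖deriv (uPlusAt σ (dyadic k) f) x‖ ≤ M * A *
        min (dyadic k ^ (5 / 2 : ℝ) / t) (dyadic k ^ (-(s - 3 / 2))) := by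
    intro F x hF k hk
    rcases le_or_gt (dyadic k) t with h | h
    · refine nonres k x fun ⟨h1, h2, h3⟩ => ?_
      have := (hF k hk h).1
      rw [sigmaHyp_eq_one hσ (hT k) h1 h2.le h3.le] at this
      exact one_ne_zero this
    · exact (hP k).elliptic (by linarith) hMA (dyadic_pos k) ht1 (Or.inr h)
  have hsub : ∀ (c : ℝ) (z : ℂ), |c| ≤ 1 → ‖z - c * z‖ ≤ 2 * ‖z‖ := by
    intro c z hc
    refine (norm_sub_le _ _).trans ?_
    rw [norm_mul, Complex.norm_real, Real.norm_eq_abs, two_mul]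
    gcongr
    exact mul_le_of_le_one_left (norm_nonneg _) hc
  refine ⟨hplus.sub hhyp, fun x => ?_, fun x => ?_⟩
  · obtain ⟨F, hF1, hF2, hF3⟩ := exists_local_sum hσ ht f x
    obtain ⟨g, hg, hgb⟩ := hc₀b t ht
    -- The locally finite sum is extended by zero to all of `ℤ`, so it can be subtracted termwise
    -- from the decomposition of `u⁺`.
    have s1 : HasSum (fun k => if k ∈ F then uHypPlusAt σ (dyadic k) t f x else 0)
        (uHypPlus σ t f x) := by
      rw [hF3.eq_of_nhds]
      have : HasSum (fun k => if k ∈ F then uHypPlusAt σ (dyadic k) t f x else 0)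
          (∑ k ∈ F, if k ∈ F then uHypPlusAt σ (dyadic k) t f x else 0) :=
        hasSum_sum_of_ne_finset_zero fun k hk => if_neg hk
      rwa [Finset.sum_congr rfl fun k hk => if_pos hk] at this
    have key := ((hasSum_uPlusAt hσ hf hs x).sub s1).norm_le_of_bounded (hg.mul_left (2 * (M * A)))
      fun k => by
        have hm : 0 ≤ min (dyadic k ^ (3 / 2 : ℝ) / t) (dyadic k ^ (-(s - 1 / 2))) := by
          have := dyadic_pos k
          positivity
        have target : ‖uPlusAt σ (dyadic k) f x -
            if k ∈ F then uHypPlusAt σ (dyadic k) t f x else 0‖ ≤ 2 * (M * A *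
            min (dyadic k ^ (3 / 2 : ℝ) / t) (dyadic k ^ (-(s - 1 / 2)))) := by
          split_ifs with hk
          · by_cases h : x < 0 ∧ 1 / 3 * (t / dyadic k ^ 2) < |x| ∧ |x| < 3 * (t / dyadic k ^ 2)
            · rw [uHypPlusAt, sigmaHyp_eq_one hσ (hT k) h.1 h.2.1.le h.2.2.le, Complex.ofReal_one,
                one_mul, sub_self, norm_zero]
              positivity
            · exact (hsub _ _ (abs_sigmaHyp_le_one hσ x)).trans (by gcongr; exact (nonres k x h).1)
          · rw [sub_zero]
            refine (outside F x hF2 k hk).1.trans ?_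
            exact le_mul_of_one_le_left (by positivity) (by norm_num)
        refine target.trans ?_
        rw [← mul_assoc]
        exact mul_le_mul_of_nonneg_left (hgb k) (by positivity)
    refine key.trans ?_
    set Y := t ^ (-((2 * s - 1) / (2 * s + 2)))
    calc _ = 2 * M * c₀ * (Y * A) := by ring
      _ ≤ _ := by gcongr; linarith [(by positivity : 0 ≤ (D + 2) * M * c₁)]
  · obtain ⟨F, hF1, hF2, hF3⟩ := exists_local_sum hσ ht f x
    obtain ⟨g, hg, hgb⟩ := hc₁b t ht
    have ed : deriv (uEllPlus σ t f) x = deriv (uPlus f) x - deriv (uHypPlus σ t f) x :=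
      deriv_fun_sub (hplus.differentiable one_ne_zero x) (hhyp.differentiable one_ne_zero x)
    rw [ed]
    set h' : ℤ → ℂ := fun k =>
      ((deriv (sigmaHyp σ (dyadic k) t) x : ℝ) : ℂ) * uPlusAt σ (dyadic k) f x +
        (sigmaHyp σ (dyadic k) t x : ℂ) * deriv (uPlusAt σ (dyadic k) f) x with hh'
    have s1 : HasSum (fun k => if k ∈ F then h' k else 0) (deriv (uHypPlus σ t f) x) := by
      rw [hF3.deriv_eq, (hasDerivAt_sum_uHypPlusAt hσ ht hu F x).deriv]
      have : HasSum (fun k => if k ∈ F then h' k else 0) (∑ k ∈ F, if k ∈ F then h' k else 0) :=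
        hasSum_sum_of_ne_finset_zero fun k hk => if_neg hk
      rwa [Finset.sum_congr rfl fun k hk => if_pos hk] at this
    have key := ((hasSum_deriv_uPlusAt hσ hf hs x).sub s1).norm_le_of_bounded
      (hg.mul_left ((D + 2) * (M * A))) fun k => by
        have hN := dyadic_pos k
        set m₀ := min (dyadic k ^ (3 / 2 : ℝ) / t) (dyadic k ^ (-(s - 1 / 2))) with hm₀
        set m := min (dyadic k ^ (5 / 2 : ℝ) / t) (dyadic k ^ (-(s - 3 / 2))) with hmdef
        have hm : 0 ≤ m := by positivity
        -- A factor `N` converts the bound for `u_N⁺` into the one for its derivative. Since `N²/t ≤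
        -- N` for `N ≤ t`, the term in which the cutoff is differentiated obeys the same bound.
        have hmm : dyadic k * m₀ = m := by
          rw [hm₀, mul_min_of_nonneg _ _ hN.le, mul_div_assoc', mul_comm (dyadic k),
            mul_comm (dyadic k), ← Real.rpow_add_one hN.ne', ← Real.rpow_add_one hN.ne', hmdef]
          congr 2
          · congr 1; norm_num
          · ring
        have target : ‖deriv (uPlusAt σ (dyadic k) f) x - if k ∈ F then h' k else 0‖ ≤
            (D + 2) * (M * A * m) := by
          split_ifs with hk
          · have hNt := hF1 k hk
            by_cases h : x < 0 ∧ 1 / 3 * (t / dyadic k ^ 2) < |x| ∧ |x| < 3 * (t / dyadic k ^ 2)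
            · rw [hh']
              simp only
              rw [sigmaHyp_eq_one hσ (hT k) h.1 h.2.1.le h.2.2.le,
                deriv_sigmaHyp_eq_zero hσ (hT k) h.1 h.2.1 h.2.2]
              simp only [Complex.ofReal_zero, zero_mul, Complex.ofReal_one, one_mul, zero_add,
                sub_self, norm_zero]
              positivity
            · obtain ⟨b0, b1⟩ := nonres k x h
              have e : deriv (uPlusAt σ (dyadic k) f) x - h' k =
                  (deriv (uPlusAt σ (dyadic k) f) x -
                    (sigmaHyp σ (dyadic k) t x : ℂ) * deriv (uPlusAt σ (dyadic k) f) x) -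
                  ((deriv (sigmaHyp σ (dyadic k) t) x : ℝ) : ℂ) * uPlusAt σ (dyadic k) f x := by
                rw [hh']; ring
              rw [e]
              refine (norm_sub_le _ _).trans ?_
              rw [norm_mul, Complex.norm_real]
              have b2 := hDb (dyadic k) t x (hT k)
              rw [← Real.norm_eq_abs] at b2
              have b3 : dyadic k ^ 2 / t ≤ dyadic k := by
                rw [div_le_iff₀ ht, sq]
                gcongr
              calc _ ≤ 2 * (M * A * m) + D * dyadic k * (M * A * m₀) := by
                    refine add_le_add ((hsub _ _ (abs_sigmaHyp_le_one hσ x)).trans (by gcongr)) ?_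
                    refine mul_le_mul (b2.trans (by gcongr)) b0 (norm_nonneg _) (by positivity)
                _ = 2 * (M * A * m) + D * (M * A * (dyadic k * m₀)) := by ring
                _ = _ := by rw [hmm]; ring
          · rw [sub_zero]
            refine (outside F x hF2 k hk).2.trans ?_
            exact le_mul_of_one_le_left (by positivity) (by linarith)
        refine target.trans ?_
        rw [← mul_assoc]
        exact mul_le_mul_of_nonneg_left (hgb k) (by positivity)
    refine key.trans ?_
    set Y := t ^ (-((2 * s - 3) / (2 * s + 2)))
    calc _ = (D + 2) * M * c₁ * (Y * A) := by ring
      _ ≤ _ := by gcongr; linarith [(by positivity : 0 ≤ 2 * M * c₀)]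

end ShortPulse

end

/-! ### Assembly of the proposition -/

theorem proposition3p2 :
    (∀ s : ℝ, 3 / 2 < s → ∃ C : ℝ, 0 < C ∧
      ∀ (u : ℝ → ℝ → ℝ) (t : ℝ), 0 < t → t < 1 → ShortPulse.MemX s t (u t) →
        ∃ v : ℝ → ℝ, ContDiff ℝ 1 v ∧ u t =ᵐ[volume] v ∧
          (∀ x, |v x| ≤ C * ShortPulse.xNorm s t (u t)) ∧
          (∀ x, |deriv v x| ≤ C * ShortPulse.xNorm s t (u t))) ∧
    (∀ σ : ℝ → ℝ, ShortPulse.IsCutoff σ → ∀ s : ℝ, 5 / 2 < s → ∃ C : ℝ, 0 < C ∧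
      ∀ (u : ℝ → ℝ → ℝ) (t : ℝ), 1 ≤ t → ShortPulse.MemX s t (u t) →
        ContDiff ℝ 1 (ShortPulse.uHypPlus σ t (u t)) ∧
        (∀ x, ‖ShortPulse.uHypPlus σ t (u t) x‖ ≤
          C * (t ^ (-(1 / 2) : ℝ) *
            min ((|x| / t) ^ (s / 4 - 1 / 2)) ((|x| / t) ^ (-(3 / 4) : ℝ)) *
            ShortPulse.xNorm s t (u t))) ∧
        (∀ x, ‖deriv (ShortPulse.uHypPlus σ t (u t)) x‖ ≤
          C * (t ^ (-(1 / 2) : ℝ) *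
            min ((|x| / t) ^ (s / 4 - 1)) ((|x| / t) ^ (-(5 / 4) : ℝ)) *
            ShortPulse.xNorm s t (u t))) ∧
        ContDiff ℝ 1 (ShortPulse.uEll σ t (u t)) ∧
        (∀ x, |ShortPulse.uEll σ t (u t) x| ≤
          C * (t ^ (-((2 * s - 1) / (2 * s + 2))) * (1 + Real.log t) *
            ShortPulse.xNorm s t (u t))) ∧
        (∀ x, |deriv (ShortPulse.uEll σ t (u t)) x| ≤
          C * (t ^ (-((2 * s - 3) / (2 * s + 2))) * (1 + Real.log t) *
            ShortPulse.xNorm s t (u t)))) := by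
  refine ⟨fun s hs => ?_, fun σ hσ s hs => ?_⟩
  · obtain ⟨C, hC, h⟩ := ShortPulse.sobolev_embedding s hs
    exact ⟨C, hC, fun u t _ _ hu => h (u t) t hu⟩
  · obtain ⟨C₁, hC₁, h₁⟩ := ShortPulse.hyperbolic_bounds hσ (by linarith : 3 / 2 < s)
    obtain ⟨C₂, hC₂, h₂⟩ := ShortPulse.elliptic_bounds hσ (by linarith : 3 / 2 < s)
    refine ⟨C₁ + 2 * C₂, by positivity, fun u t ht hu => ?_⟩
    obtain ⟨a₁, a₂, a₃⟩ := h₁ (u t) t ht hu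
    obtain ⟨b₁, b₂, b₃⟩ := h₂ (u t) t ht hu
    have hA : 0 ≤ ShortPulse.xNorm s t (u t) := ShortPulse.xNorm_nonneg
    have ht0 : 0 < t := by linarith
    -- The elliptic estimate carries no logarithm, so the factor `1 + log t` is inserted using only
    -- that it is at least `1`.
    have hlog : 1 ≤ 1 + Real.log t := by linarith [Real.log_nonneg ht]
    have hder : ∀ x, HasDerivAt (ShortPulse.uEll σ t (u t))
        (2 * (deriv (ShortPulse.uEllPlus σ t (u t)) x).re) x := fun x =>
      (Complex.reCLM.hasFDerivAt.comp_hasDerivAt x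
        (b₁.differentiable one_ne_zero x).hasDerivAt).const_mul 2
    have conv : ∀ (z : ℂ) (Y : ℝ), 0 ≤ Y → ‖z‖ ≤ C₂ * (Y * ShortPulse.xNorm s t (u t)) →
        |2 * z.re| ≤ (C₁ + 2 * C₂) * (Y * (1 + Real.log t) * ShortPulse.xNorm s t (u t)) := by
      intro z Y hY hz
      rw [abs_mul, abs_two]
      calc 2 * |z.re| ≤ 2 * (C₂ * (Y * ShortPulse.xNorm s t (u t))) := by
            gcongr
            exact (Complex.abs_re_le_norm z).trans hz
        _ = 2 * C₂ * (Y * 1 * ShortPulse.xNorm s t (u t)) := by ring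
        _ ≤ _ := by gcongr; linarith
    refine ⟨a₁, fun x => (a₂ x).trans ?_, fun x => (a₃ x).trans ?_,
      contDiff_const.mul (Complex.reCLM.contDiff.comp b₁), fun x => ?_, fun x => ?_⟩
    · gcongr; linarith
    · gcongr; linarith
    · exact conv _ _ (by positivity) (b₂ x)
    · rw [(hder x).deriv]
      exact conv _ _ (by positivity) (b₃ x)
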